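/- Let $S^2\subset\mathbb{R}^3$ be the unit sphere with its round metric $g$, identified with the Riemann sphere $\mathbb{C}\cup\{\infty\}$ by stereographic projection from the north pole (which corresponds to $\infty$). A conformal transformation is a diffeomorphism $\varphi$ of $S^2$ such that $\varphi^*g$ is a positive multiple of $g$ at each point. A smooth unparameterised curve is a connected embedded smooth one-dimensional submanifold $C\subset S^2$; it is conformally homogeneous if some group of conformal transformations preserves $C$ and acts transitively on it. A round circle is a section of $S^2$ by a plane at distance less than $1$ from the origin. For real $\beta\neq0$, a loxodrome of bearing $\beta$ is the image of the logarithmic spiral $\{e^{(\beta+i)\theta}:\theta\in\mathbb{R}\}$ under a fractional linear transformation of $\mathbb{C}\cup\{\infty\}$; it is called right-handed if $\beta>0$ and left-handed if $\beta<0$. Theorem. (1) The maximal (with respect to inclusion) conformally homogeneous unparameterised curves on $S^2$ are exactly the round circles, the right-handed loxodromes of bearing $\beta>0$, and the left-handed loxodromes of bearing $\beta<0$. (2) More precisely, a smooth unparameterised curve $C\subset S^2$ is conformally homogeneous if and only if it is contained in a round circle (so that $C$ is a round circle, a round circle with one point removed, or an open arc of a round circle), or is a right-handed loxodrome of some bearing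 $\beta>0$, or is a left-handed loxodrome of some bearing $\beta<0$. (3) The list has no repetitions: for $\beta\ne0$, a loxodrome of bearing $\beta$ is not a round circle, and its bearing is uniquely determined. -/

import Mathlib

open scoped Manifold ContDiff

noncomputable section

namespace ConfLox

/-- Euclidean three-space. -/
abbrev E3 : Type := EuclideanSpace ℝ (Fin 3)

/-- The unit sphere in Euclidean three-space, with Mathlib's smooth manifold structure. -/
abbrev S2 : Type := Metric.sphere (0 : E3) 1

/-- The differential at `x` of the inclusion of the sphere in three-space. -/
def dIncl (x : S2) : TangentSpace (𝓡 2) x →L[ℝ] E3 :=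
  mfderiv (𝓡 2) 𝓘(ℝ, E3) (fun y : S2 => (y : E3)) x

/-- The round metric on the sphere: the metric induced by the inclusion in three-space. -/
def roundMetric (x : S2) (v w : TangentSpace (𝓡 2) x) : ℝ :=
  inner ℝ (dIncl x v) (dIncl x w)

/-- A conformal transformation of the round sphere: a diffeomorphism of the sphere that pulls the
round metric back to a positive multiple of itself at every point. -/
structure IsConformalTransformation (φ : Equiv.Perm S2) : Prop where
  smooth : ContMDiff (𝓡 2) (𝓡 2) ∞ φ
  smooth_symm : ContMDiff (𝓡 2) (𝓡 2) ∞ φ.symm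
  conformal : ∀ x : S2, ∃ c : ℝ, 0 < c ∧ ∀ v w : TangentSpace (𝓡 2) x,
    roundMetric (φ x) (mfderiv (𝓡 2) (𝓡 2) φ x v) (mfderiv (𝓡 2) (𝓡 2) φ x w)
      = c * roundMetric x v w

/-- An unparameterised smooth curve: a connected (in particular nonempty) embedded smooth
one-dimensional submanifold of the sphere.  Near each of its points it is the image of a smooth
regular parameterisation which is a homeomorphism onto its image. -/
structure IsSmoothCurve (C : Set S2) : Prop where
  connected : IsConnected C
  submanifold : ∀ x ∈ C, ∃ (U : Set S2) (α : ℝ → S2), IsOpen U ∧ x ∈ U ∧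
    ContDiff ℝ ∞ (fun t => (α t : E3)) ∧ (∀ t, deriv (fun t => (α t : E3)) t ≠ 0) ∧
    Topology.IsEmbedding α ∧ C ∩ U = Set.range α

/-- A conformally homogeneous curve: a smooth curve on which some group of conformal
transformations of the round sphere acts transitively. -/
def IsHomogeneousCurve (C : Set S2) : Prop :=
  IsSmoothCurve C ∧ ∃ H : Subgroup (Equiv.Perm S2),
    (∀ φ ∈ H, IsConformalTransformation φ) ∧
    (∀ φ ∈ H, φ '' C = C) ∧
    (∀ x ∈ C, ∀ y ∈ C, ∃ φ ∈ H, φ x = y)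

/-- A round circle: the section of the sphere by a plane at distance less than one from the
centre. -/
def IsRoundCircle (K : Set S2) : Prop :=
  ∃ (n : E3) (d : ℝ), ‖n‖ = 1 ∧ |d| < 1 ∧ K = {x : S2 | inner ℝ n (x : E3) = d}

/-- Inverse stereographic projection from the north pole `(0, 0, 1)`, with values in space. -/
def stereoInvAux (z : ℂ) : E3 :=
  !₂[2 * z.re / (Complex.normSq z + 1), 2 * z.im / (Complex.normSq z + 1),
    (Complex.normSq z - 1) / (Complex.normSq z + 1)]

theorem stereoInvAux_mem (z : ℂ) : stereoInvAux z ∈ Metric.sphere (0 : E3) 1 := by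
  have h : Complex.normSq z + 1 ≠ 0 := by
    have := Complex.normSq_nonneg z
    positivity
  rw [mem_sphere_zero_iff_norm, EuclideanSpace.norm_eq, Real.sqrt_eq_one, Fin.sum_univ_three]
  simp only [stereoInvAux, Real.norm_eq_abs, sq_abs]
  simp only [Matrix.cons_val_zero, Matrix.cons_val_one, Matrix.cons_val]
  field_simp
  rw [Complex.normSq_apply]
  ring

/-- The north pole. -/
def northPole : S2 := ⟨!₂[0, 0, 1], by
  rw [mem_sphere_zero_iff_norm, EuclideanSpace.norm_eq, Real.sqrt_eq_one, Fin.sum_univ_three]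
  simp⟩

/-- The standard conformal identification of the Riemann sphere `ℂ ∪ {∞}` with the round sphere:
`∞` is the north pole, `0` the south pole, the unit circle the equator and `arg z` the longitude,
measured eastwards. -/
def fromRiemannSphere (p : OnePoint ℂ) : S2 :=
  p.elim northPole (fun z => ⟨stereoInvAux z, stereoInvAux_mem z⟩)

/-- The logarithmic spiral `ζ = exp((β + i)θ)`, `θ ∈ ℝ`. -/
def logSpiral (β : ℝ) : Set (OnePoint ℂ) :=
  Set.range fun θ : ℝ => ((Complex.exp ((β + Complex.I) * θ) : ℂ) : OnePoint ℂ)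

/-- `L` is a loxodrome of bearing `β`: for some fractional linear transformation `g` of the Riemann
sphere it is the image of the logarithmic spiral of parameter `β`; its poles are the images of
`0` and `∞`. -/
def IsLoxodrome (β : ℝ) (L : Set S2) : Prop :=
  ∃ g : GL (Fin 2) ℂ, L = (fun p => fromRiemannSphere (g • p)) '' logSpiral β

/-- A right-handed loxodrome of bearing `β`; the bearing is positive. -/
def IsRightHandedLoxodrome (β : ℝ) (L : Set S2) : Prop := 0 < β ∧ IsLoxodrome β L

/-- A left-handed loxodrome of bearing `β`; the bearing is negative. -/
def IsLeftHandedLoxodrome (β : ℝ) (L : Set S2) : Prop := β < 0 ∧ IsLoxodrome β L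

end ConfLox

end

/-! Conformal transformations of the sphere are exactly the fractional linear maps and their
composites with complex conjugation. That fractional linear maps are conformal comes from the
Lorentz action on the light cone (`lorentz_form`, `isConformalTransformation_mobPerm`). Conversely,
a conformal transformation fixing the north pole becomes, in the stereographic coordinate, an
injective entire function or the conjugate of one; it tends to infinity at infinity, so Liouville's
theorem makes it affine (`IsConformalTransformation.exists_gl`).

The local classification rests on the Schwarzian derivative S of a parameterised plane curve. It is
invariant under fractional linear maps, is conjugated by complex conjugation, and changes under a
real reparameterisation r by S(f∘r) = S(f)∘r · r'² + S(r). It determines the curve up to a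
fractional linear map (`exists_gl_of_schw_eq`). Only its real part is affected by the term S(r), so
√|Im S| dt is an invariant 1-form up to sign. On a homogeneous curve Im S therefore vanishes near
the base point or is nonzero there. If it vanishes, the curve lies locally on a circle. Otherwise
let σ be an antiderivative of √|Im S|; homogeneity forces (Re S − S(σ))/σ'² to be a constant, so S
equals the Schwarzian of exp(cσ) for a constant c with nonzero real and imaginary parts, and the
curve lies locally on a loxodrome (`SchwHomogeneous.classification`,
`locally_subset_of_extHomogeneous`).

Local becomes global by rigidity: an extended fractional linear map carrying an arc of a circle or
of a spiral into that same set preserves the whole set (`IsCirc.isRigid`, `isRigid_logSpiral`). With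
connectedness this puts the entire curve in one circle or one loxodrome
(`IsRigid.subset_of_locally_subset`). A homogeneous curve inside a loxodrome is all of it, because
the symmetries act on the spiral parameter by isometries (`eq_logSpiral_of_subset`).

For the converse, circles and spirals have visible transitive groups, and a smooth curve inside a
circle is the circle or is equivalent to an open real interval, on which fractional linear maps act
transitively (`mobHomogeneous_of_subset_isCirc`). Uniqueness of the bearing is again the Schwarzian
comparison, in `eq_spiral_of_schw`. -/

namespace ConfLox

open Complex ComplexConjugate
open OnePoint (infty smul_some_eq_ite smul_infty_eq_ite)

/-! ### Homogeneous coordinates on the sphere -/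

/-- The point of the sphere with homogeneous coordinates `v : w` on the Riemann sphere. -/
noncomputable def proj (v w : ℂ) : E3 :=
  !₂[2 * (v * conj w).re / (normSq v + normSq w), 2 * (v * conj w).im / (normSq v + normSq w),
    (normSq v - normSq w) / (normSq v + normSq w)]

theorem normSq_add_pos {v w : ℂ} (h : v ≠ 0 ∨ w ≠ 0) : 0 < normSq v + normSq w := by
  rcases h with h | h
  · exact add_pos_of_pos_of_nonneg (normSq_pos.2 h) (normSq_nonneg _)
  · exact add_pos_of_nonneg_of_pos (normSq_nonneg _) (normSq_pos.2 h)

theorem E3_ext {x y : E3} (h0 : x 0 = y 0) (h1 : x 1 = y 1) (h2 : x 2 = y 2) : x = y := by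
  ext i; fin_cases i <;> assumption

theorem proj_zero (v w : ℂ) : proj v w 0 = 2 * (v * conj w).re / (normSq v + normSq w) := rfl
theorem proj_one (v w : ℂ) : proj v w 1 = 2 * (v * conj w).im / (normSq v + normSq w) := rfl
theorem proj_two (v w : ℂ) : proj v w 2 = (normSq v - normSq w) / (normSq v + normSq w) := rfl

theorem coe_fromRiemannSphere_coe (z : ℂ) : (fromRiemannSphere (z : OnePoint ℂ) : E3) = proj z 1 := by
  change stereoInvAux z = _
  apply E3_ext <;> simp [stereoInvAux, proj]

theorem coe_fromRiemannSphere_infty : (fromRiemannSphere infty : E3) = proj 1 0 := by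
  change (northPole : E3) = _
  apply E3_ext <;> simp [northPole, proj]

theorem proj_mul {t : ℂ} (ht : t ≠ 0) (v w : ℂ) : proj (t * v) (t * w) = proj v w := by
  have h : normSq t ≠ 0 := by simpa using ht
  have e : t * v * conj (t * w) = (normSq t : ℂ) * (v * conj w) := by
    rw [map_mul, normSq_eq_conj_mul_self]; ring
  apply E3_ext
  · rw [proj_zero, proj_zero, e, re_ofReal_mul, normSq_mul, normSq_mul, ← mul_add, mul_left_comm,
      mul_div_mul_left _ _ h]
  · rw [proj_one, proj_one, e, im_ofReal_mul, normSq_mul, normSq_mul, ← mul_add, mul_left_comm,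
      mul_div_mul_left _ _ h]
  · rw [proj_two, proj_two, normSq_mul, normSq_mul, ← mul_add, ← mul_sub, mul_div_mul_left _ _ h]

/-- The conditional is the shape in which Mathlib describes the action of a matrix on `OnePoint ℂ`;
homogeneous coordinates remove the case distinction. -/
theorem coe_fromRiemannSphere_ite {v w : ℂ} (h : v ≠ 0 ∨ w ≠ 0) :
    (fromRiemannSphere (if w = 0 then infty else ((v / w : ℂ) : OnePoint ℂ)) : E3) = proj v w := by
  split_ifs with hw
  · subst hw
    have hv : v ≠ 0 := by simpa using h
    rw [coe_fromRiemannSphere_infty]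
    simpa using (proj_mul hv 1 0).symm
  · rw [coe_fromRiemannSphere_coe, ← proj_mul hw]
    field_simp

theorem gl_col_ne_zero (A : GL (Fin 2) ℂ) : A 0 0 ≠ 0 ∨ A 1 0 ≠ 0 := by
  by_contra! h
  apply A.det_ne_zero
  rw [Matrix.det_fin_two, h.1, h.2]; ring

theorem gl_apply_ne_zero (A : GL (Fin 2) ℂ) {v w : ℂ} (h : v ≠ 0 ∨ w ≠ 0) :
    A 0 0 * v + A 0 1 * w ≠ 0 ∨ A 1 0 * v + A 1 1 * w ≠ 0 := by
  by_contra! h'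
  have hd := A.det_ne_zero
  rw [Matrix.det_fin_two] at hd
  have h1 : (A 0 0 * A 1 1 - A 0 1 * A 1 0) * v = 0 := by
    linear_combination A 1 1 * h'.1 - A 0 1 * h'.2
  have h2 : (A 0 0 * A 1 1 - A 0 1 * A 1 0) * w = 0 := by
    linear_combination A 0 0 * h'.2 - A 1 0 * h'.1
  rcases h with h | h
  · exact h ((mul_eq_zero.1 h1).resolve_left hd)
  · exact h ((mul_eq_zero.1 h2).resolve_left hd)

theorem coe_fromRiemannSphere_smul_coe (A : GL (Fin 2) ℂ) (z : ℂ) :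
    (fromRiemannSphere (A • (z : OnePoint ℂ)) : E3)
      = proj (A 0 0 * z + A 0 1) (A 1 0 * z + A 1 1) := by
  rw [smul_some_eq_ite, coe_fromRiemannSphere_ite]
  simpa using gl_apply_ne_zero A (v := z) (w := 1) (by simp)

theorem coe_fromRiemannSphere_smul_infty (A : GL (Fin 2) ℂ) :
    (fromRiemannSphere (A • (infty : OnePoint ℂ)) : E3) = proj (A 0 0) (A 1 0) := by
  rw [smul_infty_eq_ite, coe_fromRiemannSphere_ite (gl_col_ne_zero A)]

/-! ### The Riemann sphere is homeomorphic to the round sphere -/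

theorem sphere_eq (x : S2) : (x : E3) 0 ^ 2 + (x : E3) 1 ^ 2 + (x : E3) 2 ^ 2 = 1 := by
  have h := x.2
  rw [mem_sphere_zero_iff_norm, EuclideanSpace.norm_eq, Real.sqrt_eq_one, Fin.sum_univ_three] at h
  simpa using h

theorem eq_northPole_of {x : S2} (h : (x : E3) 2 = 1) : x = northPole := by
  have := sphere_eq x
  rw [h] at this
  have h0 : (x : E3) 0 = 0 := by nlinarith [sq_nonneg ((x : E3) 0), sq_nonneg ((x : E3) 1)]
  have h1 : (x : E3) 1 = 0 := by nlinarith [sq_nonneg ((x : E3) 0), sq_nonneg ((x : E3) 1)]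
  apply Subtype.ext
  apply E3_ext <;> simp [northPole, *]

/-- Stereographic projection from the north pole, as a function on space. -/
noncomputable def stereo (x : E3) : ℂ := ⟨x 0 / (1 - x 2), x 1 / (1 - x 2)⟩

theorem stereo_stereoInvAux (z : ℂ) : stereo (stereoInvAux z) = z := by
  have h : normSq z + 1 ≠ 0 := by have := normSq_nonneg z; positivity
  have h2 : 1 - (normSq z - 1) / (normSq z + 1) = 2 / (normSq z + 1) := by field_simp; ring
  apply Complex.ext
  · change _ / (1 - (normSq z - 1) / (normSq z + 1)) = _
    rw [h2]
    simp [stereoInvAux]; field_simp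
  · change _ / (1 - (normSq z - 1) / (normSq z + 1)) = _
    rw [h2]
    simp [stereoInvAux]; field_simp

theorem stereoInvAux_stereo {x : S2} (h : x ≠ northPole) : stereoInvAux (stereo x) = x := by
  have h2 : 1 - (x : E3) 2 ≠ 0 := fun h' => h (eq_northPole_of (by linarith))
  have hs := sphere_eq x
  have hn : normSq (stereo x) + 1 = 2 / (1 - (x : E3) 2) := by
    rw [normSq_apply]
    simp only [stereo]
    field_simp
    linear_combination hs
  have hn' : normSq (stereo x) - 1 = 2 * (x : E3) 2 / (1 - (x : E3) 2) := by
    rw [← sub_eq_zero, show normSq (stereo x) - 1 = normSq (stereo x) + 1 - 2 by ring, hn]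
    field_simp; ring
  apply E3_ext
  · change 2 * (stereo x).re / _ = _
    rw [hn]; simp only [stereo]; field_simp
  · change 2 * (stereo x).im / _ = _
    rw [hn]; simp only [stereo]; field_simp
  · change (normSq (stereo x) - 1) / _ = _
    rw [hn, hn']; field_simp

theorem fromRiemannSphere_coe_ne (z : ℂ) : fromRiemannSphere (z : OnePoint ℂ) ≠ northPole := by
  intro h
  have := congrArg (fun x : S2 => (x : E3) 2) h
  have h' : normSq z + 1 ≠ 0 := by have := normSq_nonneg z; positivity
  change (normSq z - 1) / (normSq z + 1) = 1 at this
  field_simp at this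
  linarith

theorem fromRiemannSphere_bijective : Function.Bijective fromRiemannSphere := by
  constructor
  · intro p q h
    induction p with
    | infty =>
      induction q with
      | infty => rfl
      | coe w => exact absurd h.symm (fromRiemannSphere_coe_ne w)
    | coe z =>
      induction q with
      | infty => exact absurd h (fromRiemannSphere_coe_ne z)
      | coe w =>
        have : stereoInvAux z = stereoInvAux w := congrArg Subtype.val h
        rw [← stereo_stereoInvAux z, this, stereo_stereoInvAux]
  · intro x
    by_cases h : x = northPole
    · exact ⟨infty, h.symm⟩
    · exact ⟨(stereo x : ℂ), Subtype.ext (stereoInvAux_stereo h)⟩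

theorem contDiff_stereoInvAux : ContDiff ℝ ∞ stereoInvAux := by
  have hn : ContDiff ℝ ∞ fun z : ℂ => normSq z := by
    simp only [normSq_apply]
    exact (reCLM.contDiff.mul reCLM.contDiff).add (imCLM.contDiff.mul imCLM.contDiff)
  have h : ∀ z : ℂ, normSq z + 1 ≠ 0 := fun z => by have := normSq_nonneg z; positivity
  rw [contDiff_euclidean]
  intro i
  fin_cases i
  · exact (contDiff_const.mul reCLM.contDiff).div (hn.add contDiff_const) h
  · exact (contDiff_const.mul imCLM.contDiff).div (hn.add contDiff_const) h
  · exact (hn.sub contDiff_const).div (hn.add contDiff_const) h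

theorem continuous_fromRiemannSphere : Continuous fromRiemannSphere := by
  rw [OnePoint.continuous_iff]
  constructor
  · rw [Filter.coclosedCompact_eq_cocompact, tendsto_subtype_rng]
    have hN : Filter.Tendsto (fun z : ℂ => normSq z + 1) (Filter.cocompact ℂ) Filter.atTop := by
      apply Filter.tendsto_atTop_add_const_right
      have := (tendsto_norm_cocompact_atTop (E := ℂ))
      refine Filter.Tendsto.congr (fun z => (Complex.normSq_eq_norm_sq z).symm) <|
        (Filter.tendsto_pow_atTop (α := ℝ) two_ne_zero).comp this
    have hN' : Filter.Tendsto (fun z : ℂ => (normSq z + 1)⁻¹) (Filter.cocompact ℂ) (nhds 0) :=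
      hN.inv_tendsto_atTop
    have hpos : ∀ z : ℂ, 0 < normSq z + 1 := fun z => by have := normSq_nonneg z; positivity
    have h2 : Filter.Tendsto (fun z : ℂ => (normSq z - 1) / (normSq z + 1))
        (Filter.cocompact ℂ) (nhds 1) := by
      have : (fun z : ℂ => (normSq z - 1) / (normSq z + 1))
          = fun z => 1 - 2 * (normSq z + 1)⁻¹ := by
        ext z; have := (hpos z).ne'; field_simp; ring
      rw [this]
      simpa using (hN'.const_mul 2).const_sub 1
    -- Both horizontal coordinates decay like 1/|z|: from g² ≤ |z|² the quotient g/(|z|² + 1) is at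
    -- most (|z|² + 1)^(-1/2) in absolute value.
    have key : ∀ g : ℂ → ℝ, (∀ z, g z ^ 2 ≤ normSq z) →
        Filter.Tendsto (fun z : ℂ => 2 * g z / (normSq z + 1)) (Filter.cocompact ℂ) (nhds 0) := by
      intro g hg
      have hs : Filter.Tendsto (fun z : ℂ => 2 * √((normSq z + 1)⁻¹)) (Filter.cocompact ℂ)
          (nhds 0) := by
        simpa using (hN'.sqrt).const_mul 2
      apply squeeze_zero_norm _ hs
      intro z
      rw [Real.norm_eq_abs, abs_div, abs_mul, abs_two, abs_of_pos (hpos z), mul_div_assoc]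
      gcongr
      apply Real.le_sqrt_of_sq_le
      rw [div_pow, sq_abs]
      have := hpos z
      rw [inv_eq_one_div, div_le_div_iff₀ (by positivity) this]
      nlinarith [hg z, normSq_nonneg z]
    have hre := key re (fun z => by rw [normSq_apply]; nlinarith [sq_nonneg z.im])
    have him := key im (fun z => by rw [normSq_apply]; nlinarith [sq_nonneg z.re])
    rw [(PiLp.homeomorph 2 _).isInducing.tendsto_nhds_iff, tendsto_pi_nhds]
    intro i
    fin_cases i
    · exact hre
    · exact him
    · exact h2
  · exact contDiff_stereoInvAux.continuous.subtype_mk _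

/-- The identification of the Riemann sphere with the round sphere, as a homeomorphism. -/
noncomputable def sphereHomeo : OnePoint ℂ ≃ₜ S2 :=
  Continuous.homeoOfEquivCompactToT2
    (f := Equiv.ofBijective fromRiemannSphere fromRiemannSphere_bijective)
    continuous_fromRiemannSphere

theorem sphereHomeo_apply (p : OnePoint ℂ) : sphereHomeo p = fromRiemannSphere p := rfl

theorem sphereHomeo_symm_fromRiemannSphere (p : OnePoint ℂ) :
    sphereHomeo.symm (fromRiemannSphere p) = p := sphereHomeo.symm_apply_apply p

/-! ### Fractional linear transformations act on the sphere by Lorentz transformations -/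

/-- The time component of the Lorentz transformation of `(τ, x)` given by a complex matrix. -/
noncomputable def lorTime (A : Matrix (Fin 2) (Fin 2) ℂ) (τ : ℝ) (x : E3) : ℝ :=
  ((normSq (A 0 0) + normSq (A 1 0)) * (τ + x 2) + (normSq (A 0 1) + normSq (A 1 1)) * (τ - x 2)) / 2
    + (A 0 0 * conj (A 0 1) + A 1 0 * conj (A 1 1)).re * x 0
    - (A 0 0 * conj (A 0 1) + A 1 0 * conj (A 1 1)).im * x 1

/-- The space component of the Lorentz transformation of `(τ, x)` given by a complex matrix. -/
noncomputable def lorSpace (A : Matrix (Fin 2) (Fin 2) ℂ) (τ : ℝ) (x : E3) : E3 :=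
  !₂[(A 0 0 * conj (A 1 0)).re * (τ + x 2) + (A 0 0 * conj (A 1 1)).re * x 0
        - (A 0 0 * conj (A 1 1)).im * x 1 + (A 0 1 * conj (A 1 0)).re * x 0
        + (A 0 1 * conj (A 1 0)).im * x 1 + (A 0 1 * conj (A 1 1)).re * (τ - x 2),
    (A 0 0 * conj (A 1 0)).im * (τ + x 2) + (A 0 0 * conj (A 1 1)).im * x 0
        + (A 0 0 * conj (A 1 1)).re * x 1 + (A 0 1 * conj (A 1 0)).im * x 0
        - (A 0 1 * conj (A 1 0)).re * x 1 + (A 0 1 * conj (A 1 1)).im * (τ - x 2),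
    ((normSq (A 0 0) - normSq (A 1 0)) * (τ + x 2)
        + (normSq (A 0 1) - normSq (A 1 1)) * (τ - x 2)) / 2
      + (A 0 0 * conj (A 0 1) - A 1 0 * conj (A 1 1)).re * x 0
      - (A 0 0 * conj (A 0 1) - A 1 0 * conj (A 1 1)).im * x 1]

theorem inner_E3 (x y : E3) : inner ℝ x y = x 0 * y 0 + x 1 * y 1 + x 2 * y 2 := by
  rw [EuclideanSpace.inner_eq_star_dotProduct]
  simp [dotProduct, Fin.sum_univ_three]
  ring

/-- Identify (τ, x) with the Hermitian matrix X whose determinant is τ² − |x|². The matrix A acts by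
X ↦ A X A*, which multiplies the determinant by |det A|²; this is the polarised form of that fact.
-/
theorem lorentz_form (A : Matrix (Fin 2) (Fin 2) ℂ) (τ σ : ℝ) (x y : E3) :
    inner ℝ (lorSpace A τ x) (lorSpace A σ y) - lorTime A τ x * lorTime A σ y
      = normSq A.det * (inner ℝ x y - τ * σ) := by
  simp only [inner_E3, lorSpace, lorTime, Matrix.det_fin_two, normSq_apply]
  simp
  ring

theorem lorTime_add_smul (A : Matrix (Fin 2) (Fin 2) ℂ) (x h : E3) (t : ℝ) :
    lorTime A 1 (x + t • h) = lorTime A 1 x + t * lorTime A 0 h := by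
  simp only [lorTime, PiLp.add_apply, PiLp.smul_apply, smul_eq_mul]; ring

theorem lorSpace_add_smul (A : Matrix (Fin 2) (Fin 2) ℂ) (x h : E3) (t : ℝ) :
    lorSpace A 1 (x + t • h) = lorSpace A 1 x + t • lorSpace A 0 h := by
  apply E3_ext <;> simp [lorSpace] <;> ring

theorem contDiff_lorTime (A : Matrix (Fin 2) (Fin 2) ℂ) : ContDiff ℝ ∞ (lorTime A 1) := by
  unfold lorTime; fun_prop

theorem contDiff_lorSpace (A : Matrix (Fin 2) (Fin 2) ℂ) : ContDiff ℝ ∞ (lorSpace A 1) := by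
  rw [contDiff_euclidean]
  intro i
  fin_cases i <;> simp [lorSpace] <;> fun_prop

/-- The projective action of the Lorentz transformation on the celestial sphere. -/
noncomputable def celestial (A : Matrix (Fin 2) (Fin 2) ℂ) (x : E3) : E3 :=
  (lorTime A 1 x)⁻¹ • lorSpace A 1 x

theorem contDiffAt_celestial (A : Matrix (Fin 2) (Fin 2) ℂ) {x : E3} (hx : lorTime A 1 x ≠ 0) :
    ContDiffAt ℝ ∞ (celestial A) x :=
  ((contDiff_lorTime A).contDiffAt.inv hx).smul (contDiff_lorSpace A).contDiffAt

/-- The null vector (1, `proj v w`) corresponds to the rank-one Hermitian matrix of (v, w) scaled by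
2/(|v|² + |w|²). Its image is the rank-one matrix of A(v, w) with the same scalar, and the time
component is half the trace. -/
theorem lorTime_proj (A : Matrix (Fin 2) (Fin 2) ℂ) {v w : ℂ} (h : v ≠ 0 ∨ w ≠ 0) :
    lorTime A 1 (proj v w) =
      (normSq (A 0 0 * v + A 0 1 * w) + normSq (A 1 0 * v + A 1 1 * w)) / (normSq v + normSq w) := by
  have hN := (normSq_add_pos h).ne'
  rw [eq_div_iff hN]
  simp only [lorTime, proj_zero, proj_one, proj_two]
  field_simp
  simp only [normSq_apply, add_re, add_im, mul_re, mul_im, conj_re, conj_im]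
  ring

theorem lorSpace_proj (A : Matrix (Fin 2) (Fin 2) ℂ) {v w : ℂ} (h : v ≠ 0 ∨ w ≠ 0)
    (h' : A 0 0 * v + A 0 1 * w ≠ 0 ∨ A 1 0 * v + A 1 1 * w ≠ 0) :
    lorSpace A 1 (proj v w) =
      lorTime A 1 (proj v w) • proj (A 0 0 * v + A 0 1 * w) (A 1 0 * v + A 1 1 * w) := by
  have hN := (normSq_add_pos h).ne'
  have hM := (normSq_add_pos h').ne'
  rw [lorTime_proj A h]
  have cancel : ∀ {M N a : ℝ}, M ≠ 0 → M / N * (a / M) = a / N := fun hM => by field_simp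
  apply E3_ext
  · simp only [lorSpace, PiLp.smul_apply, Matrix.cons_val, smul_eq_mul]
    rw [proj_zero (_ + _), cancel hM, eq_div_iff hN]
    simp only [proj_zero, proj_one, proj_two]
    field_simp
    simp only [normSq_apply, add_re, add_im, mul_re, mul_im, conj_re, conj_im]
    ring
  · simp only [lorSpace, PiLp.smul_apply, Matrix.cons_val, smul_eq_mul]
    rw [proj_one (_ + _), cancel hM, eq_div_iff hN]
    simp only [proj_zero, proj_one, proj_two]
    field_simp
    simp only [normSq_apply, add_re, add_im, mul_re, mul_im, conj_re, conj_im]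
    ring
  · simp only [lorSpace, PiLp.smul_apply, Matrix.cons_val, smul_eq_mul]
    rw [proj_two (_ + _), cancel hM, eq_div_iff hN]
    simp only [proj_zero, proj_one, proj_two]
    field_simp
    simp only [normSq_apply, add_re, add_im, sub_re, sub_im, mul_re, mul_im, conj_re, conj_im]
    ring

/-! ### Fractional linear transformations as conformal transformations -/

/-- The permutation of the sphere induced by a fractional linear transformation. -/
noncomputable def mobPerm (A : GL (Fin 2) ℂ) : Equiv.Perm S2 :=
  (sphereHomeo.symm.toEquiv.trans (MulAction.toPerm A)).trans sphereHomeo.toEquiv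

theorem mobPerm_fromRiemannSphere (A : GL (Fin 2) ℂ) (p : OnePoint ℂ) :
    mobPerm A (fromRiemannSphere p) = fromRiemannSphere (A • p) := by
  simp [mobPerm, ← sphereHomeo_apply]

theorem mobPerm_mul (A B : GL (Fin 2) ℂ) : mobPerm (A * B) = mobPerm A * mobPerm B := by
  ext1 x
  obtain ⟨p, rfl⟩ := fromRiemannSphere_bijective.2 x
  simp [mobPerm_fromRiemannSphere, mul_smul]

theorem mobPerm_one : mobPerm 1 = 1 := by
  ext1 x
  obtain ⟨p, rfl⟩ := fromRiemannSphere_bijective.2 x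
  simp [mobPerm_fromRiemannSphere]

theorem mobPerm_inv (A : GL (Fin 2) ℂ) : mobPerm A⁻¹ = (mobPerm A)⁻¹ := by
  rw [eq_inv_iff_mul_eq_one, ← mobPerm_mul, inv_mul_cancel, mobPerm_one]

theorem exists_proj (A : GL (Fin 2) ℂ) (x : S2) : ∃ v w : ℂ, (v ≠ 0 ∨ w ≠ 0) ∧
    (x : E3) = proj v w ∧
      (mobPerm A x : E3) = proj (A 0 0 * v + A 0 1 * w) (A 1 0 * v + A 1 1 * w) := by
  obtain ⟨p, rfl⟩ := fromRiemannSphere_bijective.2 x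
  rw [mobPerm_fromRiemannSphere]
  induction p with
  | infty => exact ⟨1, 0, by simp, coe_fromRiemannSphere_infty, by
      simpa using coe_fromRiemannSphere_smul_infty A⟩
  | coe z => exact ⟨z, 1, by simp, coe_fromRiemannSphere_coe z, by
      simpa using coe_fromRiemannSphere_smul_coe A z⟩

theorem lorTime_pos (A : GL (Fin 2) ℂ) (x : S2) : 0 < lorTime (A : Matrix _ _ ℂ) 1 x := by
  obtain ⟨v, w, h, hx, -⟩ := exists_proj A x
  rw [hx, lorTime_proj _ h]
  exact div_pos (normSq_add_pos (gl_apply_ne_zero A h)) (normSq_add_pos h)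

theorem coe_mobPerm (A : GL (Fin 2) ℂ) (x : S2) :
    (mobPerm A x : E3) = celestial (A : Matrix _ _ ℂ) x := by
  have hpos := (lorTime_pos A x).ne'
  obtain ⟨v, w, h, hx, hy⟩ := exists_proj A x
  rw [celestial, eq_inv_smul_iff₀ hpos, hy, hx, lorSpace_proj _ h (gl_apply_ne_zero A h)]

/-- Write the map as S/T, the quotient of space by time component. The image of (1, x) is null, so
S·S = T², and since h is tangent, S·S' = T T'. These make the terms from differentiating 1/T
collapse, leaving (S'·S' − T'T')/T², which the Lorentz form evaluates. -/
theorem inner_fderiv_celestial (A : Matrix (Fin 2) (Fin 2) ℂ) {x h k : E3}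
    (hx : lorTime A 1 x ≠ 0) (hx1 : inner ℝ x x = 1) (hh : inner ℝ x h = 0)
    (hk : inner ℝ x k = 0) :
    inner ℝ (fderiv ℝ (celestial A) x h) (fderiv ℝ (celestial A) x k)
      = normSq A.det / lorTime A 1 x ^ 2 * inner ℝ h k := by
  have key : ∀ h : E3, fderiv ℝ (celestial A) x h = (lorTime A 1 x)⁻¹ • lorSpace A 0 h
      + (-(lorTime A 0 h) / lorTime A 1 x ^ 2) • lorSpace A 1 x := by
    intro h
    have hd : HasFDerivAt (celestial A) (fderiv ℝ (celestial A) x) (x + (0 : ℝ) • h) := by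
      rw [zero_smul, add_zero]
      exact ((contDiffAt_celestial A hx).differentiableAt (by simp)).hasFDerivAt
    have hl : HasDerivAt (fun t : ℝ => x + t • h) h 0 := by
      simpa using ((hasDerivAt_id (0 : ℝ)).smul_const h).const_add x
    have h1 := hd.comp_hasDerivAt (0 : ℝ) hl
    have hT : HasDerivAt (fun t : ℝ => lorTime A 1 (x + t • h)) (lorTime A 0 h) 0 := by
      simp only [lorTime_add_smul]
      simpa using ((hasDerivAt_id (0 : ℝ)).mul_const (lorTime A 0 h)).const_add (lorTime A 1 x)
    have hS : HasDerivAt (fun t : ℝ => lorSpace A 1 (x + t • h)) (lorSpace A 0 h) 0 := by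
      simp only [lorSpace_add_smul]
      simpa using ((hasDerivAt_id (0 : ℝ)).smul_const (lorSpace A 0 h)).const_add (lorSpace A 1 x)
    have h2 := (hT.fun_inv (by simpa using hx)).smul hS
    have := h1.unique h2
    simpa using this
  have e0 := lorentz_form A 1 1 x x
  have e1 := lorentz_form A 1 0 x h
  have e2 := lorentz_form A 1 0 x k
  have e3 := lorentz_form A 0 0 h k
  rw [hx1] at e0
  rw [hh] at e1
  rw [hk] at e2
  rw [key, key]
  simp only [inner_add_left, inner_add_right, real_inner_smul_left, real_inner_smul_right]
  rw [real_inner_comm (lorSpace A 1 x) (lorSpace A 0 h)]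
  have e3' : inner ℝ (lorSpace A 0 h) (lorSpace A 0 k)
    = normSq A.det * inner ℝ h k + lorTime A 0 h * lorTime A 0 k := by linarith
  have e0' : inner ℝ (lorSpace A 1 x) (lorSpace A 1 x) = lorTime A 1 x ^ 2 := by linarith
  have e1' : inner ℝ (lorSpace A 1 x) (lorSpace A 0 h) = lorTime A 1 x * lorTime A 0 h := by
    linarith
  have e2' : inner ℝ (lorSpace A 1 x) (lorSpace A 0 k) = lorTime A 1 x * lorTime A 0 k := by
    linarith
  rw [e0', e1', e2', e3']
  field_simp
  ring

theorem contMDiff_coe_S2 : ContMDiff (𝓡 2) 𝓘(ℝ, E3) ∞ (fun y : S2 => (y : E3)) :=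
  haveI : Fact (Module.finrank ℝ E3 = 2 + 1) := ⟨finrank_euclideanSpace_fin⟩
  contMDiff_coe_sphere

theorem differentiableAt_coe_sphere (x : S2) :
    MDifferentiableAt (𝓡 2) 𝓘(ℝ, E3) (fun y : S2 => (y : E3)) x :=
  contMDiff_coe_S2.mdifferentiableAt (by simp)

theorem inner_dIncl (x : S2) (v : TangentSpace (𝓡 2) x) : inner ℝ (x : E3) (dIncl x v) = 0 := by
  have h : dIncl x v ∈ (ℝ ∙ (x : E3))ᗮ := by
    have : Fact (Module.finrank ℝ E3 = 2 + 1) := ⟨finrank_euclideanSpace_fin⟩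
    rw [← range_mvfderiv_subtypeVal (n := 2) x]
    exact ⟨v, rfl⟩
  exact Submodule.mem_orthogonal_singleton_iff_inner_right.1 h

theorem dIncl_mfderiv {φ : S2 → S2} {x : S2} (hφ : MDifferentiableAt (𝓡 2) (𝓡 2) φ x)
    (v : TangentSpace (𝓡 2) x) :
    dIncl (φ x) (mfderiv (𝓡 2) (𝓡 2) φ x v)
      = mfderiv (𝓡 2) 𝓘(ℝ, E3) (fun y => (φ y : E3)) x v := by
  have := mfderiv_comp x (differentiableAt_coe_sphere (φ x)) hφ
  exact (congrArg (fun L => L v) this).symm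

theorem contMDiff_mobPerm (A : GL (Fin 2) ℂ) : ContMDiff (𝓡 2) (𝓡 2) ∞ (mobPerm A) := by
  have h : ContMDiff (𝓡 2) 𝓘(ℝ, E3) ∞ (fun x : S2 => (mobPerm A x : E3)) := by
    intro x
    have h1 : ContMDiffAt 𝓘(ℝ, E3) 𝓘(ℝ, E3) ∞ (celestial (A : Matrix _ _ ℂ)) (x : E3) :=
      (contDiffAt_celestial _ (lorTime_pos A x).ne').contMDiffAt
    have h2 := h1.comp x (contMDiff_coe_S2 x)
    exact h2.congr_of_eventuallyEq (Filter.Eventually.of_forall fun y => coe_mobPerm A y)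
  have : Fact (Module.finrank ℝ E3 = 2 + 1) := ⟨finrank_euclideanSpace_fin⟩
  exact h.codRestrict_sphere (n := 2) (fun x => (mobPerm A x).2)

theorem isConformalTransformation_mobPerm (A : GL (Fin 2) ℂ) :
    IsConformalTransformation (mobPerm A) := by
  refine ⟨contMDiff_mobPerm A, ?_, fun x => ?_⟩
  · have := contMDiff_mobPerm A⁻¹
    rwa [mobPerm_inv] at this
  have hx := lorTime_pos A x
  refine ⟨normSq (A : Matrix (Fin 2) (Fin 2) ℂ).det / lorTime (A : Matrix _ _ ℂ) 1 x ^ 2,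
    div_pos (normSq_pos.2 (Matrix.GeneralLinearGroup.det_ne_zero A)) (by positivity), fun v w => ?_⟩
  have key : ∀ v : TangentSpace (𝓡 2) x, dIncl (mobPerm A x) (mfderiv (𝓡 2) (𝓡 2) (mobPerm A) x v)
      = fderiv ℝ (celestial (A : Matrix _ _ ℂ)) x (dIncl x v) := by
    intro v
    rw [dIncl_mfderiv ((contMDiff_mobPerm A).mdifferentiableAt (by simp))]
    have e : (fun y : S2 => (mobPerm A y : E3))
      = celestial (A : Matrix _ _ ℂ) ∘ (fun y : S2 => (y : E3)) := funext fun y => coe_mobPerm A y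
    have hd : MDifferentiableAt 𝓘(ℝ, E3) 𝓘(ℝ, E3) (celestial (A : Matrix _ _ ℂ)) (x : E3) :=
      ((contDiffAt_celestial _ hx.ne').differentiableAt (by simp)).mdifferentiableAt
    have := mfderiv_comp x hd (differentiableAt_coe_sphere x)
    rw [e, this, mfderiv_eq_fderiv]
    rfl
  unfold roundMetric
  rw [key, key]
  apply inner_fderiv_celestial _ hx.ne' _ (inner_dIncl x v) (inner_dIncl x w)
  rw [real_inner_self_eq_norm_sq, mem_sphere_zero_iff_norm.1 x.2]; norm_num

end ConfLox

namespace ConfLox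

open Complex ComplexConjugate Filter Topology
open OnePoint (infty smul_some_eq_ite smul_infty_eq_ite)

/-! ### Fractional linear transformations with prescribed coefficients -/

/-- The invertible matrix with the given entries. -/
noncomputable def glMk (a b c d : ℂ) (h : a * d - b * c ≠ 0) : GL (Fin 2) ℂ :=
  Matrix.GeneralLinearGroup.mkOfDetNeZero !![a, b; c, d] (by rwa [Matrix.det_fin_two_of])

theorem glMk_smul_coe {a b c d : ℂ} (h : a * d - b * c ≠ 0) (z : ℂ) :
    glMk a b c d h • (z : OnePoint ℂ)
      = if c * z + d = 0 then infty else (((a * z + b) / (c * z + d) : ℂ) : OnePoint ℂ) :=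
  smul_some_eq_ite

theorem glMk_smul_infty {a b c d : ℂ} (h : a * d - b * c ≠ 0) :
    glMk a b c d h • (infty : OnePoint ℂ)
      = if c = 0 then infty else ((a / c : ℂ) : OnePoint ℂ) :=
  smul_infty_eq_ite _

theorem exists_smul_eq_infty_zero {p q : OnePoint ℂ} (h : p ≠ q) :
    ∃ A : GL (Fin 2) ℂ, A • p = infty ∧ A • q = ((0 : ℂ) : OnePoint ℂ) := by
  induction p with
  | infty =>
    induction q with
    | infty => exact absurd rfl h
    | coe w =>
      refine ⟨glMk 1 (-w) 0 1 (by simp), ?_, ?_⟩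
      · rw [glMk_smul_infty]; simp
      · rw [glMk_smul_coe]; simp
  | coe z =>
    induction q with
    | infty =>
      refine ⟨glMk 0 1 1 (-z) (by simp), ?_, ?_⟩
      · rw [glMk_smul_coe]; simp
      · rw [glMk_smul_infty]; simp
    | coe w =>
      have hzw : w - z ≠ 0 := fun h' => h (by rw [sub_eq_zero.1 h'])
      refine ⟨glMk 1 (-w) 1 (-z) (by rwa [one_mul, mul_one, sub_neg_eq_add, neg_add_eq_sub]), ?_, ?_⟩
      · rw [glMk_smul_coe]; simp
      · rw [glMk_smul_coe, if_neg (by simpa [sub_eq_add_neg] using hzw)]; simp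

theorem exists_smul_eq_infty (p : OnePoint ℂ) : ∃ A : GL (Fin 2) ℂ, A • p = infty := by
  obtain ⟨q, hq⟩ : ∃ q : OnePoint ℂ, p ≠ q := by
    by_cases h : p = infty
    · exact ⟨((0 : ℂ) : OnePoint ℂ), by rw [h]; exact OnePoint.infty_ne_coe _⟩
    · exact ⟨infty, h⟩
  obtain ⟨A, hA, -⟩ := exists_smul_eq_infty_zero hq
  exact ⟨A, hA⟩

theorem exists_smul_eq_zero (p : OnePoint ℂ) :
    ∃ A : GL (Fin 2) ℂ, A • p = ((0 : ℂ) : OnePoint ℂ) := by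
  obtain ⟨q, hq⟩ : ∃ q : OnePoint ℂ, q ≠ p := by
    by_cases h : p = infty
    · exact ⟨((0 : ℂ) : OnePoint ℂ), by rw [h]; exact OnePoint.coe_ne_infty _⟩
    · exact ⟨infty, Ne.symm h⟩
  obtain ⟨A, -, hA⟩ := exists_smul_eq_infty_zero hq
  exact ⟨A, hA⟩

/-! ### Entire functions with a pole at infinity that is simple by injectivity -/

/-- The pole of F at infinity forces 1/F(z) = O(1/z). Since z₀ is the only zero of F and is simple,
(z − z₀)/F(z) extends to an entire function; it is bounded, hence constant by Liouville's theorem.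
-/
theorem affine_of_entire_of_injective {F : ℂ → ℂ} (hF : Differentiable ℂ F)
    (hinj : Function.Injective F) (hlim : Tendsto F (cocompact ℂ) (cocompact ℂ))
    (hd : ∀ z, deriv F z ≠ 0) {z₀ : ℂ} (hz₀ : F z₀ = 0) :
    ∃ a : ℂ, a ≠ 0 ∧ ∀ z, F z = a * (z - z₀) := by
  have hne : ∀ z, z ≠ z₀ → F z ≠ 0 := fun z hz h => hz (hinj (h.trans hz₀.symm))
  -- the function `1 / F (1 / w)` has a removable singularity at the origin
  let K : ℂ → ℂ := Function.update (fun w => (F w⁻¹)⁻¹) 0 0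
  have hKc : ContinuousAt K 0 := by
    rw [continuousAt_update_same]
    have h1 : Tendsto (fun w : ℂ => w⁻¹) (𝓝[≠] 0) (cocompact ℂ) := by
      rw [← Metric.cobounded_eq_cocompact]; exact tendsto_inv₀_nhdsNE_zero
    have h2 := hlim.comp h1
    rw [← Metric.cobounded_eq_cocompact] at h2
    exact tendsto_inv₀_cobounded.comp h2
  have hK0 : K 0 = 0 := Function.update_self _ _ _
  have hKne : ∀ w, w ≠ 0 → K w = (F w⁻¹)⁻¹ := fun w hw => Function.update_of_ne hw _ _
  have hKd : ∀ᶠ w in 𝓝[≠] (0 : ℂ), DifferentiableAt ℂ K w := by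
    have h1 : Tendsto (fun w : ℂ => w⁻¹) (𝓝[≠] 0) (cocompact ℂ) := by
      rw [← Metric.cobounded_eq_cocompact]; exact tendsto_inv₀_nhdsNE_zero
    have h3 : ∀ᶠ w in 𝓝[≠] (0 : ℂ), w⁻¹ ≠ z₀ :=
      h1.eventually ((Set.finite_singleton z₀).isCompact.compl_mem_cocompact)
    filter_upwards [h3, self_mem_nhdsWithin] with w hw hw0
    have hw0' : w ≠ 0 := hw0
    have : K =ᶠ[𝓝 w] fun w => (F w⁻¹)⁻¹ := by
      filter_upwards [isOpen_ne.mem_nhds hw0'] with x hx using hKne x hx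
    rw [this.differentiableAt_iff]
    exact ((hF _).comp w (differentiableAt_inv hw0')).inv (hne _ hw)
  have hKan : DifferentiableAt ℂ K 0 :=
    (Complex.analyticAt_of_differentiable_on_punctured_nhds_of_continuousAt hKd
      hKc).differentiableAt
  obtain ⟨M, hM⟩ := hKan.isBigO_sub.bound
  have hM' : ∀ᶠ z in cocompact ℂ, ‖(F z)⁻¹‖ ≤ M * ‖z⁻¹‖ := by
    rw [← Metric.cobounded_eq_cocompact]
    filter_upwards [tendsto_inv₀_cobounded.eventually hM,
      (Bornology.isBounded_def.1 (Bornology.isBounded_singleton (x := (0 : ℂ))))] with z hz hz0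
    have hz0' : z ≠ 0 := hz0
    rwa [hK0, sub_zero, sub_zero, hKne _ (inv_ne_zero hz0'), inv_inv] at hz
  -- hence `(z - z₀) / F z` is bounded
  have hg : Differentiable ℂ (dslope F z₀) := by
    have := (differentiableOn_dslope (f := F) (s := Set.univ) (c := z₀) univ_mem).2
      hF.differentiableOn
    exact differentiableOn_univ.1 this
  have hg0 : ∀ z, dslope F z₀ z ≠ 0 := by
    intro z
    by_cases hz : z = z₀
    · subst hz; rw [dslope_same]; exact hd z
    · rw [dslope_of_ne _ hz, slope_def_field, hz₀, sub_zero]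
      exact div_ne_zero (hne z hz) (sub_ne_zero.2 hz)
  have hgi : Differentiable ℂ (fun z => (dslope F z₀ z)⁻¹) := hg.inv hg0
  have hbig : ∀ᶠ z in cocompact ℂ, ‖(dslope F z₀ z)⁻¹‖ ≤ 2 * M := by
    rw [← Metric.cobounded_eq_cocompact] at hM' ⊢
    filter_upwards [hM', (Bornology.isBounded_def.1 (Bornology.isBounded_singleton (x := z₀))),
      (Bornology.isBounded_def.1 (Bornology.isBounded_singleton (x := (0 : ℂ)))),
      (Bornology.isBounded_def.1 (Metric.isBounded_ball (x := (0 : ℂ)) (r := ‖z₀‖)))] with z hz hz1 hz0 hz2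
    have hz1' : z ≠ z₀ := hz1
    have hz0' : 0 < ‖z‖ := norm_pos_iff.2 hz0
    have hz2' : ‖z₀‖ ≤ ‖z‖ := by
      by_contra! h
      exact hz2 (mem_ball_zero_iff.2 h)
    rw [dslope_of_ne _ hz1', slope_def_field, hz₀, sub_zero, inv_div, div_eq_mul_inv, norm_mul]
    have hs : ‖z - z₀‖ ≤ 2 * ‖z‖ := (norm_sub_le _ _).trans (by linarith)
    calc ‖z - z₀‖ * ‖(F z)⁻¹‖ ≤ (2 * ‖z‖) * (M * ‖z⁻¹‖) := by gcongr
      _ = 2 * M := by rw [norm_inv]; field_simp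
  obtain ⟨k, hk⟩ : ∃ k, ∀ z, (dslope F z₀ z)⁻¹ = k := by
    apply hgi.exists_const_forall_eq_of_bounded
    obtain ⟨S, hS, hS'⟩ := mem_cocompact.1 hbig
    obtain ⟨C, hC⟩ := (hS.image hgi.continuous).isBounded.exists_norm_le
    refine (Metric.isBounded_closedBall (x := (0 : ℂ)) (r := max C (2 * M))).subset ?_
    rintro _ ⟨z, rfl⟩
    rw [mem_closedBall_zero_iff]
    by_cases hz : z ∈ S
    · exact (hC _ ⟨z, hz, rfl⟩).trans (le_max_left _ _)
    · exact (show ‖(dslope F z₀ z)⁻¹‖ ≤ 2 * M from hS' hz).trans (le_max_right _ _)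
  refine ⟨k⁻¹, inv_ne_zero (by rw [← hk z₀]; exact inv_ne_zero (hg0 _)), fun z => ?_⟩
  rw [← hk z, inv_inv]
  have := sub_smul_dslope F z₀ z
  rw [hz₀, sub_zero, smul_eq_mul] at this
  rw [mul_comm, this]

/-! ### Conformal transformations of the plane -/

theorem inner_fderiv_stereoInvAux (z v w : ℂ) :
    inner ℝ (fderiv ℝ stereoInvAux z v) (fderiv ℝ stereoInvAux z w)
      = 4 / (normSq z + 1) ^ 2 * inner ℝ v w := by
  have hpos : ∀ z : ℂ, normSq z + 1 ≠ 0 := fun z => by have := normSq_nonneg z; positivity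
  have key : ∀ v : ℂ, ∀ i, fderiv ℝ stereoInvAux z v i =
      (!₂[(2 * v.re * (normSq z + 1) - 2 * z.re * (2 * (z.re * v.re + z.im * v.im)))
          / (normSq z + 1) ^ 2,
        (2 * v.im * (normSq z + 1) - 2 * z.im * (2 * (z.re * v.re + z.im * v.im)))
          / (normSq z + 1) ^ 2,
        4 * (z.re * v.re + z.im * v.im) / (normSq z + 1) ^ 2] : E3) i := by
    intro v i
    have hd : HasFDerivAt stereoInvAux (fderiv ℝ stereoInvAux z) (z + (0 : ℝ) • v) := by
      rw [zero_smul, add_zero]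
      exact (contDiff_stereoInvAux.differentiable (by simp) z).hasFDerivAt
    have hl : HasDerivAt (fun t : ℝ => z + t • v) v 0 := by
      simpa using ((hasDerivAt_id (0 : ℝ)).smul_const v).const_add z
    have h1 := (EuclideanSpace.proj (𝕜 := ℝ) i).hasFDerivAt.comp_hasDerivAt (0 : ℝ)
      (hd.comp_hasDerivAt (0 : ℝ) hl)
    have hre : HasDerivAt (fun t : ℝ => z.re + t * v.re) v.re 0 := by
      simpa using ((hasDerivAt_id (0 : ℝ)).mul_const v.re).const_add z.re
    have him : HasDerivAt (fun t : ℝ => z.im + t * v.im) v.im 0 := by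
      simpa using ((hasDerivAt_id (0 : ℝ)).mul_const v.im).const_add z.im
    have hN : HasDerivAt (fun t : ℝ => normSq (z + t • v) + 1)
        (2 * (z.re * v.re + z.im * v.im)) 0 := by
      have := ((hre.mul hre).add (him.mul him)).add_const 1
      convert! this using 1
      · ext t; simp [normSq_apply]
      · simp; ring
    have hN0 : normSq (z + (0 : ℝ) • v) + 1 ≠ 0 := hpos _
    refine h1.unique ?_
    fin_cases i
    · have := (hre.const_mul 2).div hN hN0
      convert! this using 1
      · ext t; simp [stereoInvAux]
      · simp
    · have := (him.const_mul 2).div hN hN0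
      convert! this using 1
      · ext t; simp [stereoInvAux]
      · simp
    -- The numerator |z|² − 1 is treated as (|z|² + 1) − 2 so that the derivative of the denominator
    -- can be reused.
    · have := (hN.sub_const 2).div hN hN0
      convert! this using 1
      · ext t; simp [stereoInvAux]; ring
      · simp; ring
  have hz := hpos z
  rw [inner_E3]
  simp only [key, Matrix.cons_val]
  simp only [Complex.inner, mul_re, conj_re, conj_im]
  rw [normSq_apply] at hz ⊢
  field_simp
  ring

theorem contDiffAt_stereo {x : E3} (h : x 2 ≠ 1) : ContDiffAt ℝ ∞ stereo x := by
  have h' : 1 - x 2 ≠ 0 := fun h' => h (by linarith)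
  have e : stereo = fun x : E3 =>
      ((x 0 / (1 - x 2) : ℝ) : ℂ) + ((x 1 / (1 - x 2) : ℝ) : ℂ) * I := by
    ext x
    apply Complex.ext <;> simp [stereo, -ofReal_div]
  rw [e]
  have h0 : ContDiffAt ℝ ∞ (fun x : E3 => x 0 / (1 - x 2)) x := by
    refine ContDiffAt.div (f := fun x : E3 => x 0) (g := fun x : E3 => 1 - x 2) ?_ ?_ h' <;> fun_prop
  have h1 : ContDiffAt ℝ ∞ (fun x : E3 => x 1 / (1 - x 2)) x := by
    refine ContDiffAt.div (f := fun x : E3 => x 1) (g := fun x : E3 => 1 - x 2) ?_ ?_ h' <;> fun_prop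
  exact (ofRealCLM.contDiff.contDiffAt.comp x h0).add
    ((ofRealCLM.contDiff.contDiffAt.comp x h1).mul contDiffAt_const)

/-- A smooth real map of the plane that is conformal everywhere is holomorphic or its conjugate
is. -/
theorem holomorphic_or_conj_of_conformal {F : ℂ → ℂ} (hF : ContDiff ℝ ∞ F)
    (hc : ∀ z, IsConformalMap (fderiv ℝ F z)) :
    Differentiable ℂ F ∨ Differentiable ℂ (fun z => conj (F z)) := by
  have hcont : Continuous (fderiv ℝ F) := hF.continuous_fderiv (by simp)
  have hdF : Differentiable ℝ F := hF.differentiable (by simp)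
  have hc1 : IsClosed {z | fderiv ℝ F z I = I * fderiv ℝ F z 1} :=
    isClosed_eq (hcont.clm_apply continuous_const)
      (continuous_const.mul (hcont.clm_apply continuous_const))
  have hc2 : IsClosed {z | fderiv ℝ F z I = -I * fderiv ℝ F z 1} :=
    isClosed_eq (hcont.clm_apply continuous_const)
      (continuous_const.mul (hcont.clm_apply continuous_const))
  have hcov : ∀ z, fderiv ℝ F z I = I * fderiv ℝ F z 1 ∨
      fderiv ℝ F z I = -I * fderiv ℝ F z 1 := by
    intro z
    rcases (hc z).is_complex_or_conj_linear with ⟨m, hm⟩ | ⟨m, hm⟩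
    · left
      rw [← hm]
      have := m.map_smul I 1
      simpa using this
    · right
      have e1 : fderiv ℝ F z 1 = m 1 := by
        have := congrArg (fun L => L 1) hm
        simpa using this.symm
      have e2 : fderiv ℝ F z I = m (-I) := by
        have := congrArg (fun L => L (-I)) hm
        simpa using this.symm
      rw [e1, e2]
      have := m.map_smul (-I) 1
      simpa using this
  have hdisj : ∀ z, ¬ (fderiv ℝ F z I = I * fderiv ℝ F z 1 ∧
      fderiv ℝ F z I = -I * fderiv ℝ F z 1) := by
    rintro z ⟨h1, h2⟩
    have h3 : fderiv ℝ F z 1 = 0 := by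
      have : 2 * I * fderiv ℝ F z 1 = 0 := by linear_combination h2 - h1
      simpa using this
    have := (hc z).injective (h3.trans (map_zero _).symm)
    exact one_ne_zero this
  -- The holomorphic and antiholomorphic loci are closed, cover the plane, and are disjoint because
  -- a conformal differential is injective. Connectedness of the plane then selects one of them.
  have hclopen : IsClopen {z | fderiv ℝ F z I = I * fderiv ℝ F z 1} := by
    refine ⟨hc1, ?_⟩
    have : {z | fderiv ℝ F z I = I * fderiv ℝ F z 1}
        = {z | fderiv ℝ F z I = -I * fderiv ℝ F z 1}ᶜ := by
      ext z
      simp only [Set.mem_ofPred_eq, Set.mem_compl_iff]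
      constructor
      · exact fun h h' => hdisj z ⟨h, h'⟩
      · exact fun h => (hcov z).resolve_right h
    rw [this]
    exact hc2.isOpen_compl
  rcases isClopen_iff.1 hclopen with h | h
  · right
    intro z
    rw [differentiableAt_complex_iff_differentiableAt_real]
    have hz : fderiv ℝ F z I = -I * fderiv ℝ F z 1 := by
      refine (hcov z).resolve_left fun h' => ?_
      have : z ∈ {z | fderiv ℝ F z I = I * fderiv ℝ F z 1} := h'
      rw [h] at this
      exact this
    have hd : HasFDerivAt (fun z => conj (F z))
        ((conjCLE : ℂ →L[ℝ] ℂ).comp (fderiv ℝ F z)) z :=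
      (conjCLE : ℂ →L[ℝ] ℂ).hasFDerivAt.comp z (hdF z).hasFDerivAt
    refine ⟨hd.differentiableAt, ?_⟩
    rw [hd.fderiv]
    simp [hz]
  · left
    intro z
    rw [differentiableAt_complex_iff_differentiableAt_real]
    have : z ∈ {z | fderiv ℝ F z I = I * fderiv ℝ F z 1} := by rw [h]; trivial
    exact ⟨hdF z, this⟩

/-! ### Conformal transformations of the sphere are fractional linear or conjugate to such -/

theorem IsConformalTransformation.mul {φ ψ : Equiv.Perm S2} (hφ : IsConformalTransformation φ)
    (hψ : IsConformalTransformation ψ) : IsConformalTransformation (φ * ψ) := by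
  refine ⟨hφ.smooth.comp hψ.smooth, hψ.smooth_symm.comp hφ.smooth_symm, fun x => ?_⟩
  obtain ⟨c, hc, h⟩ := hφ.conformal (ψ x)
  obtain ⟨d, hd, h'⟩ := hψ.conformal x
  refine ⟨c * d, mul_pos hc hd, fun v w => ?_⟩
  have e := mfderiv_comp x (hφ.smooth.mdifferentiableAt (x := ψ x) (by simp))
    (hψ.smooth.mdifferentiableAt (x := x) (by simp))
  rw [mul_assoc, ← h' v w, ← h]
  have e1 : ∀ v, mfderiv (𝓡 2) (𝓡 2) (φ * ψ : Equiv.Perm S2) x v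
      = mfderiv (𝓡 2) (𝓡 2) φ (ψ x) (mfderiv (𝓡 2) (𝓡 2) ψ x v) := fun v =>
    congrArg (fun L => L v) e
  rw [e1, e1]
  rfl

theorem contMDiff_fromRiemannSphere_coe :
    ContMDiff 𝓘(ℝ, ℂ) (𝓡 2) ∞ (fun z : ℂ => fromRiemannSphere (z : OnePoint ℂ)) :=
  have : Fact (Module.finrank ℝ E3 = 2 + 1) := ⟨finrank_euclideanSpace_fin⟩
  (contDiff_stereoInvAux.contMDiff).codRestrict_sphere (n := 2) stereoInvAux_mem

/-- The action of complex conjugation on the Riemann sphere. -/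
noncomputable def conjRS (p : OnePoint ℂ) : OnePoint ℂ := OnePoint.map conj p

@[simp] theorem conjRS_coe (z : ℂ) : conjRS (z : OnePoint ℂ) = ((conj z : ℂ) : OnePoint ℂ) := rfl

@[simp] theorem conjRS_infty : conjRS infty = infty := rfl

/-- In the stereographic coordinate the transformation is a smooth conformal bijection F of the
plane, so F or its conjugate is entire and the previous results make it affine. -/
theorem affine_of_conformal_fixing_north {ψ : Equiv.Perm S2} (hψ : IsConformalTransformation ψ)
    (hN : ψ northPole = northPole) :
    ∃ B : GL (Fin 2) ℂ, (∀ p, ψ (fromRiemannSphere p) = fromRiemannSphere (B • p)) ∨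
      (∀ p, ψ (fromRiemannSphere p) = fromRiemannSphere (B • conjRS p)) := by
  have hne : ∀ z : ℂ, ψ (fromRiemannSphere (z : OnePoint ℂ)) ≠ northPole := fun z h =>
    fromRiemannSphere_coe_ne z (ψ.injective (h.trans hN.symm))
  have hne2 : ∀ z : ℂ, (ψ (fromRiemannSphere (z : OnePoint ℂ)) : E3) 2 ≠ 1 := fun z h =>
    hne z (eq_northPole_of h)
  let F : ℂ → ℂ := fun z => stereo (ψ (fromRiemannSphere (z : OnePoint ℂ)))
  have hFψ : ∀ z : ℂ, ψ (fromRiemannSphere (z : OnePoint ℂ)) = fromRiemannSphere (F z : ℂ) :=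
    fun z => Subtype.ext (stereoInvAux_stereo (hne z)).symm
  have hψΦ : ContMDiff 𝓘(ℝ, ℂ) (𝓡 2) ∞ (fun z : ℂ => ψ (fromRiemannSphere (z : OnePoint ℂ))) :=
    hψ.smooth.comp contMDiff_fromRiemannSphere_coe
  have hG : ContDiff ℝ ∞ (fun z : ℂ => (ψ (fromRiemannSphere (z : OnePoint ℂ)) : E3)) :=
    contMDiff_iff_contDiff.1 (contMDiff_coe_S2.comp hψΦ)
  have hF : ContDiff ℝ ∞ F := contDiff_iff_contDiffAt.2 fun z =>
    (contDiffAt_stereo (hne2 z)).comp z (f := fun z : ℂ =>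
      (ψ (fromRiemannSphere (z : OnePoint ℂ)) : E3)) hG.contDiffAt
  have hdF : Differentiable ℝ F := hF.differentiable (by simp)
  have hconf : ∀ z, IsConformalMap (fderiv ℝ F z) := by
    intro z
    rw [isConformalMap_iff]
    obtain ⟨c, hc, h⟩ := hψ.conformal (fromRiemannSphere (z : OnePoint ℂ))
    have hpos : ∀ z : ℂ, 0 < normSq z + 1 := fun z => by have := normSq_nonneg z; positivity
    have hpz := hpos z
    have hpF := hpos (F z)
    refine ⟨c * (4 / (normSq z + 1) ^ 2) / (4 / (normSq (F z) + 1) ^ 2), by positivity,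
      fun v w => ?_⟩
    have e1 : ∀ v, fderiv ℝ (fun z : ℂ => (ψ (fromRiemannSphere (z : OnePoint ℂ)) : E3)) z v
        = fderiv ℝ stereoInvAux (F z) (fderiv ℝ F z v) := by
      intro v
      have : (fun z : ℂ => (ψ (fromRiemannSphere (z : OnePoint ℂ)) : E3)) = stereoInvAux ∘ F :=
        funext fun z => (stereoInvAux_stereo (hne z)).symm
      rw [this, fderiv_comp z (contDiff_stereoInvAux.differentiable (by simp) _) (hdF z)]
      rfl
    have hdΦ : MDifferentiableAt 𝓘(ℝ, ℂ) (𝓡 2)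
        (fun z : ℂ => fromRiemannSphere (z : OnePoint ℂ)) z :=
      contMDiff_fromRiemannSphere_coe.mdifferentiableAt (by simp)
    let D : TangentSpace 𝓘(ℝ, ℂ) z →L[ℝ] TangentSpace (𝓡 2) (fromRiemannSphere (z : OnePoint ℂ)) :=
      mfderiv 𝓘(ℝ, ℂ) (𝓡 2) (fun z : ℂ => fromRiemannSphere (z : OnePoint ℂ)) z
    have e2 : ∀ v : ℂ, fderiv ℝ (fun z : ℂ => (ψ (fromRiemannSphere (z : OnePoint ℂ)) : E3)) z v
        = dIncl _ (mfderiv (𝓡 2) (𝓡 2) ψ (fromRiemannSphere (z : OnePoint ℂ)) (D v)) := by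
      intro v
      rw [← mfderiv_eq_fderiv, dIncl_mfderiv (hψ.smooth.mdifferentiableAt (by simp))]
      have hd2 : MDifferentiableAt (𝓡 2) 𝓘(ℝ, E3) (fun y : S2 => (ψ y : E3))
          (fromRiemannSphere (z : OnePoint ℂ)) :=
        (contMDiff_coe_S2.comp hψ.smooth).mdifferentiableAt (by simp)
      have := mfderiv_comp z hd2 hdΦ
      exact congrArg (fun L => L v) this
    have e3 : ∀ v : ℂ, fderiv ℝ stereoInvAux z v = dIncl _ (D v) := by
      intro v
      have := mfderiv_comp z (differentiableAt_coe_sphere (fromRiemannSphere (z : OnePoint ℂ))) hdΦ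
      rw [← mfderiv_eq_fderiv]
      exact congrArg (fun L => L v) this
    have h1 := h (D v) (D w)
    unfold roundMetric at h1
    rw [← e2, ← e2, ← e3, ← e3, e1, e1, inner_fderiv_stereoInvAux, inner_fderiv_stereoInvAux] at h1
    rw [div_mul_eq_mul_div, eq_div_iff (by positivity), mul_comm, h1, mul_assoc]
  have hbij : Function.Bijective F := by
    constructor
    · intro z w h
      have := (hFψ z).trans ((congrArg (fun t : ℂ => fromRiemannSphere (t : OnePoint ℂ)) h).trans
        (hFψ w).symm)
      exact OnePoint.coe_injective (fromRiemannSphere_bijective.1 (ψ.injective this))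
    · intro w
      obtain ⟨x, hx⟩ := ψ.surjective (fromRiemannSphere (w : OnePoint ℂ))
      obtain ⟨p, rfl⟩ := fromRiemannSphere_bijective.2 x
      induction p with
      | infty =>
        exact absurd (hx.symm.trans hN) (fromRiemannSphere_coe_ne w)
      | coe z =>
        exact ⟨z, OnePoint.coe_injective
          (fromRiemannSphere_bijective.1 ((hFψ z).symm.trans hx))⟩
  -- Properness of F is continuity of the transformation at the fixed point ∞, read in the one-point
  -- compactification.
  have hlim : Tendsto F (cocompact ℂ) (cocompact ℂ) := by
    have hcont : Continuous fun p : OnePoint ℂ => sphereHomeo.symm (ψ (sphereHomeo p)) :=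
      sphereHomeo.symm.continuous.comp (hψ.smooth.continuous.comp sphereHomeo.continuous)
    have h1 := (OnePoint.continuous_iff _).1 hcont |>.1
    have e : sphereHomeo.symm (ψ (sphereHomeo infty)) = infty := by
      change sphereHomeo.symm (ψ northPole) = infty
      rw [hN]
      exact sphereHomeo_symm_fromRiemannSphere infty
    rw [e, coclosedCompact_eq_cocompact] at h1
    have e2 : (fun z : ℂ => sphereHomeo.symm (ψ (sphereHomeo (z : OnePoint ℂ))))
        = fun z => (F z : OnePoint ℂ) := by
      funext z
      rw [sphereHomeo_apply, hFψ, sphereHomeo_symm_fromRiemannSphere]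
    rw [e2] at h1
    rw [← coclosedCompact_eq_cocompact (X := ℂ), ← OnePoint.comap_coe_nhds_infty,
      tendsto_comap_iff, OnePoint.comap_coe_nhds_infty, coclosedCompact_eq_cocompact]
    exact h1
  have hderiv : ∀ z, fderiv ℝ F z 1 ≠ 0 := fun z h =>
    one_ne_zero ((hconf z).injective (h.trans (map_zero _).symm))
  obtain ⟨z₀, hz₀⟩ := hbij.2 0
  rcases holomorphic_or_conj_of_conformal hF hconf with h | h
  · have hd : ∀ z, deriv F z ≠ 0 := by
      intro z hz
      apply hderiv z
      rw [((h z).hasFDerivAt.restrictScalars ℝ).fderiv]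
      simpa using hz
    obtain ⟨a, ha, hFa⟩ := affine_of_entire_of_injective h hbij.1 hlim hd hz₀
    refine ⟨glMk a (-(a * z₀)) 0 1 (by simpa using ha), Or.inl fun p => ?_⟩
    induction p with
    | infty => rw [glMk_smul_infty, if_pos rfl]; exact hN
    | coe z =>
      rw [glMk_smul_coe, hFψ, hFa]
      simp [mul_add, sub_eq_add_neg]
  · have hd : ∀ z, deriv (fun z => conj (F z)) z ≠ 0 := by
      intro z hz
      apply hderiv z
      have h1 := ((h z).hasFDerivAt.restrictScalars ℝ)
      have h2 : HasFDerivAt (fun z => conj (F z)) ((conjCLE : ℂ →L[ℝ] ℂ).comp (fderiv ℝ F z)) z :=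
        (conjCLE : ℂ →L[ℝ] ℂ).hasFDerivAt.comp z (hdF z).hasFDerivAt
      have h3 := congrArg (fun L => L 1) (h1.unique h2)
      have h4 : (0 : ℂ) = conj (fderiv ℝ F z 1) := by
        rw [← hz]
        simpa using h3
      simpa using h4.symm
    have hlim' : Tendsto (fun z => conj (F z)) (cocompact ℂ) (cocompact ℂ) :=
      (conjCLE.toHomeomorph.isClosedEmbedding.tendsto_cocompact).comp hlim
    obtain ⟨a, ha, hFa⟩ := affine_of_entire_of_injective h
      ((starRingEnd ℂ).injective.comp hbij.1) hlim' hd (z₀ := z₀) (by simp [hz₀])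
    refine ⟨glMk (conj a) (-(conj a * conj z₀)) 0 1 (by simpa using ha), Or.inr fun p => ?_⟩
    induction p with
    | infty => rw [conjRS_infty, glMk_smul_infty, if_pos rfl]; exact hN
    | coe z =>
      have : F z = conj a * (conj z - conj z₀) := by
        rw [← map_sub, ← map_mul, ← hFa, conj_conj]
      rw [conjRS_coe, glMk_smul_coe, hFψ, this]
      simp [mul_add, sub_eq_add_neg]

/-- Every conformal transformation of the sphere is a fractional linear transformation, possibly
preceded by complex conjugation. -/
theorem IsConformalTransformation.exists_gl {φ : Equiv.Perm S2} (hφ : IsConformalTransformation φ) :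
    ∃ B : GL (Fin 2) ℂ, (∀ p, φ (fromRiemannSphere p) = fromRiemannSphere (B • p)) ∨
      (∀ p, φ (fromRiemannSphere p) = fromRiemannSphere (B • conjRS p)) := by
  obtain ⟨p, hp⟩ := fromRiemannSphere_bijective.2 (φ northPole)
  -- Composing with A brings the image of the north pole back to the north pole and reduces to the
  -- affine case.
  obtain ⟨A, hA⟩ := exists_smul_eq_infty p
  obtain ⟨B, hB⟩ := affine_of_conformal_fixing_north
    ((isConformalTransformation_mobPerm A).mul hφ) (by
      rw [Equiv.Perm.mul_apply, ← hp, mobPerm_fromRiemannSphere, hA]; rfl)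
  have key : ∀ x q, (mobPerm A * φ) x = fromRiemannSphere (B • q) →
      φ x = fromRiemannSphere ((A⁻¹ * B) • q) := by
    intro x q h
    apply (mobPerm A).injective
    rw [mobPerm_fromRiemannSphere, mul_smul, smul_inv_smul]
    exact h
  exact ⟨A⁻¹ * B, hB.imp (fun h p => key _ _ (h p)) (fun h p => key _ _ (h p))⟩

/-! ### Germs of regular curves and their Schwarzian derivatives -/

section Schwarzian

variable {𝕜 : Type*} [NontriviallyNormedField 𝕜] [NormedAlgebra ℝ 𝕜]

/-- The function `f` is smooth and regular near `t`. -/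
def Reg (f : ℝ → 𝕜) (t : ℝ) : Prop :=
  ∀ᶠ s in 𝓝 t, ContDiffAt ℝ ∞ f s ∧ deriv f s ≠ 0

/-- The pre-Schwarzian derivative. -/
noncomputable def pre (f : ℝ → 𝕜) (t : ℝ) : 𝕜 := deriv (deriv f) t / deriv f t

/-- The Schwarzian derivative. -/
noncomputable def schw (f : ℝ → 𝕜) (t : ℝ) : 𝕜 := deriv (pre f) t - pre f t ^ 2 / 2

theorem contDiffAt_deriv {f : ℝ → 𝕜} {t : ℝ} (h : ContDiffAt ℝ ∞ f t) :
    ContDiffAt ℝ ∞ (deriv f) t :=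
  (h.fderiv_right (m := ∞) (by simp)).clm_apply contDiffAt_const

theorem Reg.contDiffAt {f : ℝ → 𝕜} {t : ℝ} (h : Reg f t) : ContDiffAt ℝ ∞ f t :=
  h.self_of_nhds.1

theorem Reg.deriv_ne {f : ℝ → 𝕜} {t : ℝ} (h : Reg f t) : deriv f t ≠ 0 := h.self_of_nhds.2

theorem Reg.eventually {f : ℝ → 𝕜} {t : ℝ} (h : Reg f t) : ∀ᶠ s in 𝓝 t, Reg f s :=
  eventually_eventually_nhds.2 h

theorem reg_of_contDiffAt {f : ℝ → 𝕜} {t : ℝ} (h : ∀ᶠ s in 𝓝 t, ContDiffAt ℝ ∞ f s)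
    (h' : deriv f t ≠ 0) : Reg f t :=
  h.and ((contDiffAt_deriv h.self_of_nhds).continuousAt.eventually_ne h')

theorem contDiffAt_div {f g : ℝ → 𝕜} {t : ℝ} (hf : ContDiffAt ℝ ∞ f t) (hg : ContDiffAt ℝ ∞ g t)
    (h : g t ≠ 0) : ContDiffAt ℝ ∞ (fun s => f s / g s) t := by
  simp only [div_eq_mul_inv]
  exact hf.mul (hg.inv h)

theorem Reg.contDiffAt_pre {f : ℝ → 𝕜} {t : ℝ} (h : Reg f t) : ContDiffAt ℝ ∞ (pre f) t :=
  contDiffAt_div (contDiffAt_deriv (contDiffAt_deriv h.contDiffAt)) (contDiffAt_deriv h.contDiffAt)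
    h.deriv_ne

theorem Reg.contDiffAt_schw {f : ℝ → 𝕜} {t : ℝ} (h : Reg f t) : ContDiffAt ℝ ∞ (schw f) t :=
  (contDiffAt_deriv h.contDiffAt_pre).sub ((h.contDiffAt_pre.pow 2).div_const 2)

theorem hasDerivAt_of_contDiffAt {f : ℝ → 𝕜} {t : ℝ} (h : ContDiffAt ℝ ∞ f t) :
    HasDerivAt f (deriv f t) t :=
  (h.differentiableAt (by simp)).hasDerivAt

theorem Reg.hasDerivAt {f : ℝ → 𝕜} {t : ℝ} (h : Reg f t) : HasDerivAt f (deriv f t) t :=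
  hasDerivAt_of_contDiffAt h.contDiffAt

/-- Together with `Reg.hasDerivAt_pre` this closes f', the pre-Schwarzian and the Schwarzian under
differentiation, so that the transformation rules below become algebra. -/
theorem Reg.hasDerivAt_deriv {f : ℝ → 𝕜} {t : ℝ} (h : Reg f t) :
    HasDerivAt (deriv f) (pre f t * deriv f t) t := by
  rw [pre, div_mul_cancel₀ _ h.deriv_ne]
  exact hasDerivAt_of_contDiffAt (contDiffAt_deriv h.contDiffAt)

theorem Reg.hasDerivAt_pre {f : ℝ → 𝕜} {t : ℝ} (h : Reg f t) :
    HasDerivAt (pre f) (schw f t + pre f t ^ 2 / 2) t := by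
  rw [schw, sub_add_cancel]
  exact hasDerivAt_of_contDiffAt h.contDiffAt_pre

theorem pre_eventuallyEq {f g : ℝ → 𝕜} {t : ℝ} (h : f =ᶠ[𝓝 t] g) : pre f =ᶠ[𝓝 t] pre g :=
  h.deriv.deriv.div h.deriv

theorem schw_eventuallyEq {f g : ℝ → 𝕜} {t : ℝ} (h : f =ᶠ[𝓝 t] g) : schw f =ᶠ[𝓝 t] schw g := by
  filter_upwards [(pre_eventuallyEq h), (pre_eventuallyEq h).deriv] with s h1 h2
  rw [schw, schw, h1, h2]

theorem schw_congr {f g : ℝ → 𝕜} {t : ℝ} (h : f =ᶠ[𝓝 t] g) : schw f t = schw g t :=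
  (schw_eventuallyEq h).eq_of_nhds

theorem schw_of_pre_eventuallyEq {f g : ℝ → 𝕜} {t : ℝ} (h : pre f =ᶠ[𝓝 t] pre g) :
    schw f t = schw g t := by
  rw [schw, schw, h.eq_of_nhds, h.deriv_eq]

theorem schw_of_deriv_eventuallyEq_mul {f g : ℝ → 𝕜} {t : ℝ} {k : 𝕜} (hk : k ≠ 0)
    (h : ∀ᶠ s in 𝓝 t, deriv f s = k * deriv g s) : schw f t = schw g t := by
  apply schw_of_pre_eventuallyEq
  have h' : deriv f =ᶠ[𝓝 t] fun s => k * deriv g s := h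
  filter_upwards [h', h'.deriv] with s h1 h2
  rw [pre, h1, h2, deriv_const_mul_field, mul_div_mul_left _ _ hk, pre]

/-- To compute a Schwarzian derivative from explicit first and second logarithmic derivatives. -/
theorem schw_eq_of {f : ℝ → 𝕜} {p : ℝ → 𝕜} {q : 𝕜} {t : ℝ}
    (hp : ∀ᶠ s in 𝓝 t, deriv f s ≠ 0 ∧ HasDerivAt (deriv f) (p s * deriv f s) s)
    (hq : HasDerivAt p q t) :
    (∀ᶠ s in 𝓝 t, pre f s = p s) ∧ schw f t = q - p t ^ 2 / 2 := by
  have h : pre f =ᶠ[𝓝 t] p := by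
    filter_upwards [hp] with s hs
    rw [pre, hs.2.deriv, mul_div_cancel_right₀ _ hs.1]
  exact ⟨h, by rw [schw, h.deriv_eq, hq.deriv, h.eq_of_nhds]⟩

theorem eventually_eq_of_hasDerivAt_zero {F : ℝ → 𝕜} {t : ℝ}
    (h : ∀ᶠ s in 𝓝 t, HasDerivAt F 0 s) : ∀ᶠ s in 𝓝 t, F s = F t := by
  obtain ⟨ε, hε, hb⟩ := Metric.eventually_nhds_iff_ball.1 h
  filter_upwards [Metric.ball_mem_nhds t hε] with s hs
  exact Metric.isOpen_ball.is_const_of_deriv_eq_zero (convex_ball t ε).isPreconnected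
    (fun x hx => (hb x hx).differentiableAt.differentiableWithinAt) (fun x hx => (hb x hx).deriv) hs
    (Metric.mem_ball_self hε)

/-- No theorem on differential equations is needed. With P the pre-Schwarzian, equal Schwarzians
give (P_f − P_g)' = (P_f − P_g)(P_f + P_g)/2, while f'g' has logarithmic derivative P_f + P_g. So
(P_f − P_g)²/(f'g') is constant, and it vanishes at t. Then f'/g' and f − g are constant in turn. -/
theorem eventuallyEq_of_schw_eq {f g : ℝ → 𝕜} {t : ℝ} (hf : Reg f t) (hg : Reg g t)
    (h0 : f t = g t) (h1 : deriv f t = deriv g t) (h2 : pre f t = pre g t)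
    (hS : ∀ᶠ s in 𝓝 t, schw f s = schw g s) : f =ᶠ[𝓝 t] g := by
  have e1 : ∀ᶠ s in 𝓝 t, pre f s = pre g s := by
    have := eventually_eq_of_hasDerivAt_zero
      (F := fun s => (pre f s - pre g s) ^ 2 / (deriv f s * deriv g s)) (t := t) (by
        filter_upwards [hf.eventually, hg.eventually, hS] with s hfs hgs hs
        have hfn := hfs.deriv_ne
        have hgn := hgs.deriv_ne
        have := ((hfs.hasDerivAt_pre.sub hgs.hasDerivAt_pre).pow 2).div
          (hfs.hasDerivAt_deriv.mul hgs.hasDerivAt_deriv) (mul_ne_zero hfn hgn)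
        convert! this using 1
        rw [eq_comm, div_eq_zero_iff]
        left
        simp only [Pi.sub_apply, Pi.pow_apply, Pi.mul_apply, hs]
        have h2 : (2 : 𝕜) ≠ 0 := by
          rw [← map_ofNat (algebraMap ℝ 𝕜) 2]
          exact (map_ne_zero _).2 two_ne_zero
        field_simp
        push_cast
        ring)
    filter_upwards [this, hf, hg] with s hs hfs hgs
    rw [h2, sub_self, zero_pow two_ne_zero, zero_div,
      div_eq_zero_iff, or_iff_left (mul_ne_zero hfs.2 hgs.2)] at hs
    exact sub_eq_zero.1 (pow_eq_zero_iff two_ne_zero |>.1 hs)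
  have e2 : ∀ᶠ s in 𝓝 t, deriv f s = deriv g s := by
    have := eventually_eq_of_hasDerivAt_zero (F := fun s => deriv f s / deriv g s) (t := t) (by
        filter_upwards [hf.eventually, hg.eventually, e1] with s hfs hgs hs
        have := hfs.hasDerivAt_deriv.div hgs.hasDerivAt_deriv hgs.deriv_ne
        convert! this using 1
        rw [eq_comm, div_eq_zero_iff, hs]
        left; ring)
    filter_upwards [this, hg] with s hs hgs
    rwa [h1, div_self hg.deriv_ne, div_eq_one_iff_eq hgs.2] at hs
  have := eventually_eq_of_hasDerivAt_zero (F := fun s => f s - g s) (t := t) (by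
        filter_upwards [hf.eventually, hg.eventually, e2] with s hfs hgs hs
        have := hfs.hasDerivAt.sub hgs.hasDerivAt
        rwa [hs, sub_self] at this)
  filter_upwards [this] with s hs
  rw [h0, sub_self] at hs
  exact sub_eq_zero.1 hs

end Schwarzian

/-! ### Transformation rules of the Schwarzian derivative -/

/-- No differentiability is required: where r is not differentiable, both derivatives take the
default value zero. -/
theorem deriv_ofReal_comp (r : ℝ → ℝ) : deriv (fun t => (r t : ℂ)) = fun t => ((deriv r t : ℝ) : ℂ) := by
  funext t
  by_cases h : DifferentiableAt ℝ r t
  · exact h.hasDerivAt.ofReal_comp.deriv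
  · rw [deriv_zero_of_not_differentiableAt h, ofReal_zero]
    apply deriv_zero_of_not_differentiableAt
    intro h'
    apply h
    have := reCLM.differentiableAt.comp t h'
    exact this

theorem pre_ofReal_comp (r : ℝ → ℝ) : pre (fun t => (r t : ℂ)) = fun t => ((pre r t : ℝ) : ℂ) := by
  funext t
  rw [pre, deriv_ofReal_comp, deriv_ofReal_comp, pre, ofReal_div]

theorem schw_ofReal_comp (r : ℝ → ℝ) (t : ℝ) : schw (fun t => (r t : ℂ)) t = (schw r t : ℝ) := by
  rw [schw, pre_ofReal_comp, deriv_ofReal_comp, schw]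
  push_cast; rfl

theorem schw_conj_comp (f : ℝ → ℂ) (t : ℝ) : schw (fun t => conj (f t)) t = conj (schw f t) := by
  have hd : ∀ f : ℝ → ℂ, deriv (fun t => conj (f t)) = fun t => conj (deriv f t) := fun f =>
    funext fun t => deriv.star
  have hp : pre (fun t => conj (f t)) = fun t => conj (pre f t) := by
    funext t
    rw [pre, hd, hd, pre, map_div₀]
  rw [schw, hp, hd, schw, map_sub, map_div₀, map_pow, conj_ofNat]

theorem pre_conj_comp (f : ℝ → ℂ) (t : ℝ) : pre (fun t => conj (f t)) t = conj (pre f t) := by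
  have hd : ∀ f : ℝ → ℂ, deriv (fun t => conj (f t)) = fun t => conj (deriv f t) := fun f =>
    funext fun t => deriv.star
  rw [pre, hd, hd, pre, map_div₀]

theorem Reg.conj_comp {f : ℝ → ℂ} {t : ℝ} (h : Reg f t) : Reg (fun t => conj (f t)) t := by
  filter_upwards [h] with s hs
  refine ⟨conjCLE.contDiff.contDiffAt.comp s hs.1, ?_⟩
  have : deriv (fun t => conj (f t)) s = conj (deriv f s) := deriv.star
  rw [this]
  simpa using hs.2

theorem Reg.ofReal_comp {r : ℝ → ℝ} {t : ℝ} (h : Reg r t) : Reg (fun t => (r t : ℂ)) t := by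
  filter_upwards [h] with s hs
  refine ⟨ofRealCLM.contDiff.contDiffAt.comp s hs.1, ?_⟩
  rw [deriv_ofReal_comp]
  simpa using hs.2

/-- Besides the invariance of the Schwarzian, the formulas for the first derivative and the
pre-Schwarzian are recorded because they drive the normalization of the 2-jet. -/
theorem Reg.mobius {f : ℝ → ℂ} {t : ℝ} (hf : Reg f t) {a b c d : ℂ} (h : a * d - b * c ≠ 0)
    (ht : c * f t + d ≠ 0) :
    Reg (fun s => (a * f s + b) / (c * f s + d)) t ∧
      deriv (fun s => (a * f s + b) / (c * f s + d)) t
        = (a * d - b * c) * deriv f t / (c * f t + d) ^ 2 ∧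
      pre (fun s => (a * f s + b) / (c * f s + d)) t = pre f t - 2 * c * deriv f t / (c * f t + d) ∧
      schw (fun s => (a * f s + b) / (c * f s + d)) t = schw f t := by
  have hne : ∀ᶠ s in 𝓝 t, c * f s + d ≠ 0 :=
    ((hf.contDiffAt.continuousAt.const_mul c).add_const d).eventually_ne ht
  have hd : ∀ᶠ s in 𝓝 t, deriv (fun s => (a * f s + b) / (c * f s + d)) s
      = (a * d - b * c) * deriv f s / (c * f s + d) ^ 2 := by
    filter_upwards [hf.eventually, hne] with s hs hn
    have := ((hs.hasDerivAt.const_mul a).add_const b).div ((hs.hasDerivAt.const_mul c).add_const d) hn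
    refine (HasDerivAt.deriv this).trans ?_
    congr 1; ring
  have hreg : Reg (fun s => (a * f s + b) / (c * f s + d)) t := by
    filter_upwards [hf, hne, hd] with s hs hn hds
    refine ⟨contDiffAt_div ((contDiffAt_const.mul hs.1).add contDiffAt_const)
      ((contDiffAt_const.mul hs.1).add contDiffAt_const) hn, ?_⟩
    rw [hds]
    exact div_ne_zero (mul_ne_zero h hs.2) (pow_ne_zero _ hn)
  have hp : ∀ᶠ s in 𝓝 t, deriv (fun s => (a * f s + b) / (c * f s + d)) s ≠ 0 ∧
      HasDerivAt (deriv (fun s => (a * f s + b) / (c * f s + d)))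
        ((pre f s - 2 * c * deriv f s / (c * f s + d)) *
          deriv (fun s => (a * f s + b) / (c * f s + d)) s) s := by
    filter_upwards [hf.eventually, hne, hd, hd.eventually_nhds, hreg] with s hs hn hds hdse hr
    refine ⟨hr.2, ?_⟩
    have := (hs.hasDerivAt_deriv.const_mul (a * d - b * c)).div
      (((hs.hasDerivAt.const_mul c).add_const d).pow 2) (pow_ne_zero 2 hn)
    refine (HasDerivAt.congr_of_eventuallyEq ?_ hdse)
    convert! this using 1
    rw [hds]
    field_simp
    simp
    field_simp
  have hq : HasDerivAt (fun s => pre f s - 2 * c * deriv f s / (c * f s + d))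
      (schw f t + pre f t ^ 2 / 2 - ((2 * c * (pre f t * deriv f t)) * (c * f t + d)
        - 2 * c * deriv f t * (c * deriv f t)) / (c * f t + d) ^ 2) t :=
    hf.hasDerivAt_pre.sub ((hf.hasDerivAt_deriv.const_mul (2 * c)).div
      ((hf.hasDerivAt.const_mul c).add_const d) ht)
  obtain ⟨h1, h2⟩ := schw_eq_of hp hq
  refine ⟨hreg, hd.self_of_nhds, h1.self_of_nhds, ?_⟩
  rw [h2]
  field_simp
  ring

/-- The pre-Schwarzian of f ∘ r is P_f(r) r' + P_r. Differentiating it, the mixed terms cancel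
against the square. The correction term is real, since r is. -/
theorem Reg.comp_real {f : ℝ → ℂ} {r : ℝ → ℝ} {t : ℝ} (hf : Reg f (r t)) (hr : Reg r t) :
    Reg (fun s => f (r s)) t ∧
      schw (fun s => f (r s)) t = schw f (r t) * ((deriv r t : ℝ) : ℂ) ^ 2 + ((schw r t : ℝ) : ℂ) := by
  have hfr : ∀ᶠ s in 𝓝 t, Reg f (r s) := hr.contDiffAt.continuousAt.eventually hf.eventually
  have hd : ∀ᶠ s in 𝓝 t, deriv (fun s => f (r s)) s = ((deriv r s : ℝ) : ℂ) * deriv f (r s) := by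
    filter_upwards [hfr, hr.eventually] with s hs hrs
    have := hs.hasDerivAt.scomp s hrs.hasDerivAt
    rw [← real_smul]
    exact this.deriv
  have hreg : Reg (fun s => f (r s)) t := by
    filter_upwards [hfr, hr, hd] with s hs hrs hds
    refine ⟨hs.contDiffAt.comp s hrs.1, ?_⟩
    rw [hds]
    exact mul_ne_zero (by simpa using hrs.2) hs.deriv_ne
  have hp : ∀ᶠ s in 𝓝 t, deriv (fun s => f (r s)) s ≠ 0 ∧ HasDerivAt (deriv (fun s => f (r s)))
      ((pre f (r s) * ((deriv r s : ℝ) : ℂ) + ((pre r s : ℝ) : ℂ)) * deriv (fun s => f (r s)) s) s := by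
    filter_upwards [hfr, hr.eventually, hd, hd.eventually_nhds, hreg] with s hs hrs hds hdse hrg
    refine ⟨hrg.2, HasDerivAt.congr_of_eventuallyEq ?_ hdse⟩
    have h1 := hs.hasDerivAt_deriv.scomp s hrs.hasDerivAt
    have := hrs.hasDerivAt_deriv.ofReal_comp.mul h1
    convert! this using 1
    rw [hds]
    simp
    ring
  have hq : HasDerivAt (fun s => pre f (r s) * ((deriv r s : ℝ) : ℂ) + ((pre r s : ℝ) : ℂ))
      (((deriv r t : ℝ) : ℂ) * (schw f (r t) + pre f (r t) ^ 2 / 2) * ((deriv r t : ℝ) : ℂ)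
        + pre f (r t) * (pre r t * deriv r t : ℝ) + ((schw r t + pre r t ^ 2 / 2 : ℝ) : ℂ)) t := by
    have h1 := hf.hasDerivAt_pre.scomp t hr.hasDerivAt
    rw [real_smul] at h1
    exact (h1.mul hr.hasDerivAt_deriv.ofReal_comp).add hr.hasDerivAt_pre.ofReal_comp
  obtain ⟨h1, h2⟩ := schw_eq_of hp hq
  refine ⟨hreg, ?_⟩
  rw [h2]
  push_cast
  ring

theorem reg_exp {c : ℂ} (hc : c ≠ 0) (t : ℝ) :
    Reg (fun s : ℝ => exp (c * s)) t ∧ schw (fun s : ℝ => exp (c * s)) t = -c ^ 2 / 2 := by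
  have hd' : ∀ s : ℝ, HasDerivAt (fun s : ℝ => exp (c * s)) (c * exp (c * s)) s := by
    intro s
    have := ((hasDerivAt_id s).ofReal_comp.const_mul c).cexp
    simpa [mul_comm] using this
  have hd : deriv (fun s : ℝ => exp (c * s)) = fun s : ℝ => c * exp (c * s) :=
    funext fun s => (hd' s).deriv
  have hne : ∀ s, deriv (fun s : ℝ => exp (c * s)) s ≠ 0 := fun s => by
    rw [hd]; exact mul_ne_zero hc (exp_ne_zero _)
  have hreg : Reg (fun s : ℝ => exp (c * s)) t := Eventually.of_forall fun s =>
    ⟨(contDiff_exp.comp (contDiff_const.mul ofRealCLM.contDiff)).contDiffAt, hne s⟩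
  refine ⟨hreg, ?_⟩
  have := (schw_eq_of (f := fun s : ℝ => exp (c * s)) (p := fun _ => c) (t := t)
    (Eventually.of_forall fun s => ⟨hne s, by
      have := (hd' s).const_mul c
      rw [hd]; exact this⟩) (hasDerivAt_const t c)).2
  rw [this]; ring

/-- Fractional linear maps have just enough parameters to prescribe the 2-jet of a regular curve at
a point; what remains is determined by the Schwarzian. -/
theorem Reg.exists_normalization {f : ℝ → ℂ} {t : ℝ} (hf : Reg f t) :
    ∃ (A : GL (Fin 2) ℂ) (F : ℝ → ℂ), Reg F t ∧
      (∀ᶠ s in 𝓝 t, A • (f s : OnePoint ℂ) = (F s : OnePoint ℂ)) ∧ F t = 0 ∧ deriv F t = 1 ∧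
      pre F t = 0 ∧ ∀ᶠ s in 𝓝 t, schw F s = schw f s := by
  have hk := hf.deriv_ne
  -- The matrix has lower-left entry c = P/(2f') and lower-right entry d = 1 − c f(t), so that the
  -- denominator is 1 at t. Dividing by f' normalizes the first derivative, and 2c f' = P kills the
  -- pre-Schwarzian.
  have hdet : (deriv f t)⁻¹ * (1 - pre f t / 2 * (deriv f t)⁻¹ * f t)
      - (-((deriv f t)⁻¹ * f t)) * (pre f t / 2 * (deriv f t)⁻¹) = (deriv f t)⁻¹ := by ring
  have hdet' := hdet.trans_ne (inv_ne_zero hk)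
  have hden : pre f t / 2 * (deriv f t)⁻¹ * f t + (1 - pre f t / 2 * (deriv f t)⁻¹ * f t) = 1 := by
    ring
  have hne : ∀ᶠ s in 𝓝 t,
      pre f t / 2 * (deriv f t)⁻¹ * f s + (1 - pre f t / 2 * (deriv f t)⁻¹ * f t) ≠ 0 :=
    ((hf.contDiffAt.continuousAt.const_mul _).add_const _).eventually_ne
      (hden.trans_ne one_ne_zero)
  obtain ⟨h1, h2, h3, -⟩ := hf.mobius hdet' (hden.trans_ne one_ne_zero)
  refine ⟨glMk _ _ _ _ hdet', _, h1, ?_, ?_, ?_, ?_, ?_⟩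
  · filter_upwards [hne] with s hs
    rw [glMk_smul_coe, if_neg hs]
  · simp
  · rw [h2, hdet, hden]; field_simp
  · rw [h3, hden]; field_simp; ring
  · filter_upwards [hf.eventually, hne] with s hs hn
    exact (hs.mobius hdet' hn).2.2.2

/-- Two regular curves with the same Schwarzian derivative differ by a fractional linear
transformation. -/
theorem exists_gl_of_schw_eq {f g : ℝ → ℂ} {t : ℝ} (hf : Reg f t) (hg : Reg g t)
    (hS : ∀ᶠ s in 𝓝 t, schw f s = schw g s) :
    ∃ A : GL (Fin 2) ℂ, ∀ᶠ s in 𝓝 t, A • (f s : OnePoint ℂ) = (g s : OnePoint ℂ) := by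
  obtain ⟨A, F, hF, hAF, F0, F1, F2, F3⟩ := hf.exists_normalization
  obtain ⟨B, G, hG, hBG, G0, G1, G2, G3⟩ := hg.exists_normalization
  have := eventuallyEq_of_schw_eq hF hG (F0.trans G0.symm) (F1.trans G1.symm) (F2.trans G2.symm) (by
    filter_upwards [hS, F3, G3] with s h1 h2 h3
    rw [h2, h1, h3])
  refine ⟨B⁻¹ * A, ?_⟩
  filter_upwards [this, hAF, hBG] with s h1 h2 h3
  rw [mul_smul, h2, h1, ← h3, inv_smul_smul]

/-- A regular curve with real Schwarzian derivative lies on a circle. -/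
theorem exists_gl_real_of_schw_im_eq_zero {f : ℝ → ℂ} {t : ℝ} (hf : Reg f t)
    (hS : ∀ᶠ s in 𝓝 t, (schw f s).im = 0) :
    ∃ A : GL (Fin 2) ℂ, ∀ᶠ s in 𝓝 t, ∃ x : ℝ, A • (f s : OnePoint ℂ) = ((x : ℂ) : OnePoint ℂ) := by
  obtain ⟨A, F, hF, hAF, F0, F1, F2, F3⟩ := hf.exists_normalization
  have hd : deriv (fun t => conj (F t)) t = conj (deriv F t) := deriv.star
  -- The normalized curve and its conjugate have the same real 2-jet and the same real Schwarzian,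
  -- so they agree and the curve is real.
  have := eventuallyEq_of_schw_eq hF hF.conj_comp (by simp [F0]) (by simp [hd, F1])
    (by simp [pre_conj_comp, F2]) (by
    filter_upwards [hS, F3] with s h1 h2
    rw [schw_conj_comp, h2, eq_comm, conj_eq_iff_im, h1])
  refine ⟨A, ?_⟩
  filter_upwards [this, hAF] with s h1 h2
  refine ⟨(F s).re, ?_⟩
  rw [h2, conj_eq_iff_re.1 h1.symm]

/-! ### Rigidity of logarithmic spirals -/

theorem Reg.smul {f : ℝ → ℂ} {t : ℝ} (hf : Reg f t) (A : GL (Fin 2) ℂ)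
    (hA : A • (f t : OnePoint ℂ) ≠ infty) :
    ∃ F : ℝ → ℂ, Reg F t ∧ (∀ᶠ s in 𝓝 t, A • (f s : OnePoint ℂ) = (F s : OnePoint ℂ)) ∧
      ∀ᶠ s in 𝓝 t, schw F s = schw f s := by
  have hdet : A 0 0 * A 1 1 - A 0 1 * A 1 0 ≠ 0 := by
    have := A.det_ne_zero
    rwa [Matrix.det_fin_two] at this
  have h0 : A 1 0 * f t + A 1 1 ≠ 0 := fun h => hA (by rw [smul_some_eq_ite, if_pos h])
  have hne : ∀ᶠ s in 𝓝 t, A 1 0 * f s + A 1 1 ≠ 0 :=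
    ((hf.contDiffAt.continuousAt.const_mul _).add_const _).eventually_ne h0
  refine ⟨_, (hf.mobius hdet h0).1, ?_, ?_⟩
  · filter_upwards [hne] with s hs
    rw [smul_some_eq_ite, if_neg hs]
  · filter_upwards [hf.eventually, hne] with s hs hn
    exact (hs.mobius hdet hn).2.2.2

/-- The parameterisation of the logarithmic spiral. -/
noncomputable def spiral (β θ : ℝ) : ℂ := exp ((β + I) * θ)

theorem logSpiral_eq (β : ℝ) : logSpiral β = Set.range fun θ => (spiral β θ : OnePoint ℂ) := rfl

theorem mem_logSpiral {β : ℝ} {p : OnePoint ℂ} :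
    p ∈ logSpiral β ↔ ∃ θ, (spiral β θ : OnePoint ℂ) = p := Iff.rfl

theorem spiral_ne_zero (β θ : ℝ) : spiral β θ ≠ 0 := exp_ne_zero _

theorem norm_spiral (β θ : ℝ) : ‖spiral β θ‖ = Real.exp (β * θ) := by
  rw [spiral, norm_exp]; simp

theorem spiral_add (β θ η : ℝ) : spiral β (θ + η) = spiral β θ * spiral β η := by
  rw [spiral, spiral, spiral, ← exp_add]; push_cast; ring_nf

theorem spiral_neg (β θ : ℝ) : spiral β (-θ) = (spiral β θ)⁻¹ := by
  rw [spiral, spiral, ← exp_neg]; push_cast; ring_nf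

theorem log_norm_spiral {β : ℝ} (hβ : β ≠ 0) (θ : ℝ) : Real.log ‖spiral β θ‖ / β = θ := by
  rw [norm_spiral, Real.log_exp, mul_div_cancel_left₀ _ hβ]

theorem spiral_injective {β : ℝ} (hβ : β ≠ 0) : Function.Injective (spiral β) := fun θ η h => by
  rw [← log_norm_spiral hβ θ, h, log_norm_spiral hβ]

theorem bearing_ne_zero (β : ℝ) : (β + I : ℂ) ≠ 0 := fun h => by
  have := congrArg im h
  simp at this

theorem reg_spiral (β θ : ℝ) :
    Reg (spiral β) θ ∧ schw (spiral β) θ = -(β + I : ℂ) ^ 2 / 2 :=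
  reg_exp (bearing_ne_zero β) θ

theorem quadratic_eq_zero_of_infinite {p q r : ℂ} {S : Set ℂ} (hS : S.Infinite)
    (h : ∀ z ∈ S, p * z ^ 2 + q * z + r = 0) : p = 0 ∧ q = 0 ∧ r = 0 := by
  have := Polynomial.eq_zero_of_infinite_isRoot
    (Polynomial.C p * Polynomial.X ^ 2 + Polynomial.C q * Polynomial.X + Polynomial.C r)
    (hS.mono fun z hz => by simpa [Polynomial.IsRoot] using h z hz)
  refine ⟨?_, ?_, ?_⟩
  · simpa using congrArg (fun P => Polynomial.coeff P 2) this
  · simpa [Polynomial.coeff_X, Polynomial.coeff_C] using congrArg (fun P => Polynomial.coeff P 1) this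
  · simpa using congrArg (fun P => Polynomial.coeff P 0) this

theorem infinite_spiral_image {β : ℝ} (hβ : β ≠ 0) {P : ℝ → Prop} {θ₀ : ℝ}
    (h : ∀ᶠ θ in 𝓝 θ₀, P θ) : (spiral β '' {θ | P θ}).Infinite :=
  (infinite_of_mem_nhds θ₀ h).image (spiral_injective hβ).injOn

/-- A regular curve in a logarithmic spiral whose Schwarzian derivative is that of a logarithmic
spiral is a translate of the standard parameterisation. -/
theorem eq_spiral_of_schw {β β' : ℝ} (hβ' : β' ≠ 0) {w : ℝ → ℂ} {θ₀ : ℝ} (hw : Reg w θ₀)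
    (hS : ∀ᶠ θ in 𝓝 θ₀, schw w θ = -(β + I : ℂ) ^ 2 / 2)
    (hmem : ∀ᶠ θ in 𝓝 θ₀, ∃ η, w θ = spiral β' η) :
    β' = β ∧ ∃ ε k : ℝ, (ε = 1 ∨ ε = -1) ∧ ∀ᶠ θ in 𝓝 θ₀, w θ = spiral β (ε * θ + k) := by
  let r : ℝ → ℝ := fun θ => Real.log ‖w θ‖ / β'
  have hwr : ∀ᶠ θ in 𝓝 θ₀, w θ = spiral β' (r θ) := by
    filter_upwards [hmem] with θ ⟨η, hη⟩
    simp only [r, hη, log_norm_spiral hβ']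
  have hrs : ∀ᶠ θ in 𝓝 θ₀, ContDiffAt ℝ ∞ r θ := by
    filter_upwards [hw, hwr] with θ h1 h2
    have hne : w θ ≠ 0 := by rw [h2]; exact spiral_ne_zero _ _
    exact ((h1.1.norm ℝ hne).log (norm_ne_zero_iff.2 hne)).div_const _
  have hr : Reg r θ₀ := by
    apply reg_of_contDiffAt hrs
    intro h0
    apply hw.deriv_ne
    have h1 : HasDerivAt r 0 θ₀ := by
      have := hasDerivAt_of_contDiffAt hrs.self_of_nhds
      rwa [h0] at this
    have := (reg_spiral β' (r θ₀)).1.hasDerivAt.scomp θ₀ h1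
    rw [zero_smul] at this
    exact (this.congr_of_eventuallyEq hwr).deriv
  have hS2 : ∀ᶠ θ in 𝓝 θ₀, -(β + I : ℂ) ^ 2 / 2
      = -(β' + I : ℂ) ^ 2 / 2 * ((deriv r θ : ℝ) : ℂ) ^ 2 + ((schw r θ : ℝ) : ℂ) := by
    filter_upwards [hS, hr.eventually, hwr.eventually_nhds] with θ h1 h2 h3
    rw [← h1, ← (reg_spiral β' (r θ)).2, ← ((reg_spiral β' (r θ)).1.comp_real h2).2]
    exact schw_congr h3
  -- The imaginary part of the chain rule does not involve the Schwarzian of r, so it forces r'² to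
  -- be constant.
  have him : ∀ᶠ θ in 𝓝 θ₀, β = β' * deriv r θ ^ 2 := by
    filter_upwards [hS2] with θ h
    have := congrArg im h
    simp only [pow_two, add_im, mul_im, mul_re, ofReal_re, ofReal_im, div_ofNat_im, neg_im,
      neg_re, add_re, I_re, I_im, div_ofNat_re] at this
    ring_nf at this ⊢
    linarith
  have hre : ∀ᶠ θ in 𝓝 θ₀, β ^ 2 - 1 = (β' ^ 2 - 1) * deriv r θ ^ 2 - 2 * schw r θ := by
    filter_upwards [hS2] with θ h
    have := congrArg re h
    simp only [pow_two, add_im, mul_im, mul_re, ofReal_re, ofReal_im, div_ofNat_im, neg_im,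
      neg_re, add_re, I_re, I_im, div_ofNat_re] at this
    ring_nf at this ⊢
    linarith
  have hpre : ∀ᶠ θ in 𝓝 θ₀, pre r θ = 0 := by
    filter_upwards [him.eventually_nhds, hr.eventually] with θ h1 h2
    have h3 := h2.hasDerivAt_deriv.pow 2
    have h4 : (deriv r) ^ 2 =ᶠ[𝓝 θ] fun _ => β / β' := by
      filter_upwards [h1] with x hx
      rw [Pi.pow_apply, hx, mul_div_cancel_left₀ _ hβ']
    have h5 := h3.unique ((hasDerivAt_const θ (β / β')).congr_of_eventuallyEq h4)
    have := h2.deriv_ne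
    simpa [this] using h5
  have hschw : schw r θ₀ = 0 := by
    have h : pre r =ᶠ[𝓝 θ₀] fun _ => 0 := hpre
    rw [schw, h.deriv_eq, h.eq_of_nhds]
    simp
  have hpos : 0 < deriv r θ₀ ^ 2 := by have := hr.deriv_ne; positivity
  have e1 := him.self_of_nhds
  have e2 := hre.self_of_nhds
  rw [hschw, e1] at e2
  -- With u = r'² and β = β'u, the real part becomes β'²u² − 1 = (β'² − 1)u, that is (u − 1)(β'²u +
  -- 1) = 0, whose second factor is positive.
  have e3 : deriv r θ₀ ^ 2 = 1 := by
    have : (deriv r θ₀ ^ 2 - 1) * (β' ^ 2 * deriv r θ₀ ^ 2 + 1) = 0 := by linear_combination e2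
    rcases mul_eq_zero.1 this with h | h
    · linarith
    · nlinarith [sq_nonneg β', mul_nonneg (sq_nonneg β') hpos.le]
  rw [e3, mul_one] at e1
  subst e1
  refine ⟨rfl, deriv r θ₀, r θ₀ - deriv r θ₀ * θ₀, sq_eq_one_iff.1 e3, ?_⟩
  have hconst : ∀ᶠ θ in 𝓝 θ₀, deriv r θ = deriv r θ₀ := by
    apply eventually_eq_of_hasDerivAt_zero
    filter_upwards [hpre, hr.eventually] with θ h1 h2
    simpa [h1] using h2.hasDerivAt_deriv
  have hlin := eventually_eq_of_hasDerivAt_zero (F := fun θ => r θ - deriv r θ₀ * θ) (t := θ₀) (by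
    filter_upwards [hconst, hr.eventually] with θ h1 h2
    have := h2.hasDerivAt.sub ((hasDerivAt_id θ).const_mul (deriv r θ₀))
    rw [h1, mul_one, sub_self] at this
    exact this)
  filter_upwards [hlin, hwr] with θ h1 h2
  rw [h2, ← h1]
  ring_nf

/-- The Schwarzian comparison gives the conclusion near θ₀. Clearing denominators turns it into a
quadratic equation in z = `spiral β θ` with infinitely many solutions, so its coefficients vanish: A
is diagonal when ε = 1 and antidiagonal when ε = −1, and the formula holds for all θ. -/
theorem spiral_rigidity {A : GL (Fin 2) ℂ} {β β' : ℝ} (hβ : β ≠ 0) (hβ' : β' ≠ 0) {θ₀ : ℝ}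
    (h : ∀ᶠ θ in 𝓝 θ₀, A • (spiral β θ : OnePoint ℂ) ∈ logSpiral β') :
    β' = β ∧ ∃ ε k : ℝ, (ε = 1 ∨ ε = -1) ∧
      ∀ θ, A • (spiral β θ : OnePoint ℂ) = (spiral β (ε * θ + k) : OnePoint ℂ) := by
  have hfin : A • (spiral β θ₀ : OnePoint ℂ) ≠ infty := by
    obtain ⟨η, hη⟩ := h.self_of_nhds
    rw [← hη]; exact OnePoint.coe_ne_infty _
  obtain ⟨w, hw, hAw, hSw⟩ := (reg_spiral β θ₀).1.smul A hfin
  obtain ⟨e, ε, k, hε, hk⟩ := eq_spiral_of_schw hβ' hw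
    (hSw.mono fun θ hθ => hθ.trans (reg_spiral β θ).2) (by
      filter_upwards [h, hAw] with θ h1 h2
      obtain ⟨η, hη⟩ := h1
      exact ⟨η, OnePoint.coe_injective (h2.symm.trans hη.symm)⟩)
  subst e
  refine ⟨rfl, ε, k, hε, ?_⟩
  have hdet : A 0 0 * A 1 1 - A 0 1 * A 1 0 ≠ 0 := by
    have := A.det_ne_zero
    rwa [Matrix.det_fin_two] at this
  have key : ∀ᶠ θ in 𝓝 θ₀, A 0 0 * spiral β' θ + A 0 1
      = (A 1 0 * spiral β' θ + A 1 1) * spiral β' (ε * θ + k) := by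
    filter_upwards [hAw, hk] with θ h1 h2
    rw [smul_some_eq_ite] at h1
    split_ifs at h1 with h3
    · exact absurd h1 (OnePoint.infty_ne_coe _)
    · rw [← h2, ← OnePoint.coe_injective h1, mul_div_cancel₀ _ h3]
  have hK := spiral_ne_zero β' k
  rcases hε with rfl | rfl
  · have key' : ∀ z ∈ spiral β' '' {θ | A 0 0 * spiral β' θ + A 0 1
        = (A 1 0 * spiral β' θ + A 1 1) * spiral β' (1 * θ + k)},
        A 1 0 * spiral β' k * z ^ 2 + (A 1 1 * spiral β' k - A 0 0) * z + (-A 0 1) = 0 := by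
      rintro _ ⟨θ, hθ, rfl⟩
      rw [Set.mem_ofPred_eq, one_mul, spiral_add] at hθ
      linear_combination -hθ
    obtain ⟨h1, h2, h3⟩ := quadratic_eq_zero_of_infinite (infinite_spiral_image hβ key) key'
    have h1' : A 1 0 = 0 := (mul_eq_zero.1 h1).resolve_right hK
    have h3' : A 0 1 = 0 := neg_eq_zero.1 h3
    have h4 : A 1 1 ≠ 0 := fun h4 => hdet (by rw [h4, h1']; ring)
    intro θ
    rw [smul_some_eq_ite, h1', h3', zero_mul, zero_add, if_neg h4, one_mul, spiral_add,
      ← sub_eq_zero.1 h2]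
    congr 1
    field_simp
    ring
  · have key' : ∀ z ∈ spiral β' '' {θ | A 0 0 * spiral β' θ + A 0 1
        = (A 1 0 * spiral β' θ + A 1 1) * spiral β' (-1 * θ + k)},
        A 0 0 * z ^ 2 + (A 0 1 - A 1 0 * spiral β' k) * z + (-(A 1 1 * spiral β' k)) = 0 := by
      rintro _ ⟨θ, hθ, rfl⟩
      rw [Set.mem_ofPred_eq, neg_one_mul, spiral_add, spiral_neg] at hθ
      have h0 := spiral_ne_zero β' θ
      field_simp at hθ
      linear_combination hθ
    obtain ⟨h1, h2, h3⟩ := quadratic_eq_zero_of_infinite (infinite_spiral_image hβ key) key'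
    have h3' : A 1 1 = 0 := (mul_eq_zero.1 (neg_eq_zero.1 h3)).resolve_right hK
    have h4 : A 1 0 ≠ 0 := fun h4 => hdet (by rw [h4, h1]; ring)
    intro θ
    have h0 := spiral_ne_zero β' θ
    rw [smul_some_eq_ite, h1, h3', zero_mul, zero_add, add_zero, if_neg (mul_ne_zero h4 h0),
      neg_one_mul, spiral_add, spiral_neg, sub_eq_zero.1 h2]
    congr 1
    field_simp

/-- A fractional linear transformation acting on the parameter of a spiral by a Euclidean motion
preserves the spiral. -/
theorem smul_logSpiral_of {A : GL (Fin 2) ℂ} {β ε k : ℝ} (hε : ε = 1 ∨ ε = -1)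
    (h : ∀ θ, A • (spiral β θ : OnePoint ℂ) = (spiral β (ε * θ + k) : OnePoint ℂ)) :
    (fun p => A • p) '' logSpiral β = logSpiral β := by
  have he : ε * ε = 1 := by rcases hε with rfl | rfl <;> norm_num
  ext p
  simp only [Set.mem_image, mem_logSpiral]
  constructor
  · rintro ⟨_, ⟨θ, rfl⟩, rfl⟩
    exact ⟨_, (h θ).symm⟩
  · rintro ⟨θ, rfl⟩
    refine ⟨_, ⟨ε * (θ - k), rfl⟩, ?_⟩
    rw [h, ← mul_assoc, he, one_mul, sub_add_cancel]

/-- Conjugation reverses the bearing; this is what later rules out orientation-reversing symmetries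
of a loxodrome. -/
theorem conj_spiral (β θ : ℝ) : conj (spiral β θ) = spiral (-β) (-θ) := by
  rw [spiral, ← exp_conj, spiral]
  congr 1
  simp
  ring

/-! ### Circles of the Riemann sphere -/

/-- The image of a set under a fractional linear transformation. -/
def mobImage (A : GL (Fin 2) ℂ) (S : Set (OnePoint ℂ)) : Set (OnePoint ℂ) := (fun p => A • p) '' S

theorem mem_mobImage {A : GL (Fin 2) ℂ} {S : Set (OnePoint ℂ)} {p : OnePoint ℂ} :
    p ∈ mobImage A S ↔ A⁻¹ • p ∈ S := by
  constructor
  · rintro ⟨q, hq, rfl⟩; simpa using hq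
  · exact fun h => ⟨_, h, smul_inv_smul A p⟩

theorem smul_mem_mobImage {A : GL (Fin 2) ℂ} {S : Set (OnePoint ℂ)} {p : OnePoint ℂ} :
    A • p ∈ mobImage A S ↔ p ∈ S := by rw [mem_mobImage, inv_smul_smul]

theorem mobImage_mul (A B : GL (Fin 2) ℂ) (S : Set (OnePoint ℂ)) :
    mobImage (A * B) S = mobImage A (mobImage B S) := by
  ext p; simp [mem_mobImage, mul_smul]

theorem mobImage_inv_mobImage (A : GL (Fin 2) ℂ) (S : Set (OnePoint ℂ)) :
    mobImage A⁻¹ (mobImage A S) = S := by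
  ext p; simp [mem_mobImage]

theorem mobImage_mobImage_inv (A : GL (Fin 2) ℂ) (S : Set (OnePoint ℂ)) :
    mobImage A (mobImage A⁻¹ S) = S := by
  ext p; simp [mem_mobImage]

theorem mobImage_mono {A : GL (Fin 2) ℂ} {S T : Set (OnePoint ℂ)} (h : S ⊆ T) :
    mobImage A S ⊆ mobImage A T := Set.image_mono h

theorem mobPerm_image (A : GL (Fin 2) ℂ) (S : Set (OnePoint ℂ)) :
    mobPerm A '' (fromRiemannSphere '' S) = fromRiemannSphere '' mobImage A S := by
  simp [mobImage, Set.image_image, mobPerm_fromRiemannSphere]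

/-- The extended real line. -/
def extReal : Set (OnePoint ℂ) := {p | p.elim True (fun z => z.im = 0)}

@[simp] theorem infty_mem_extReal : infty ∈ extReal := trivial

@[simp] theorem coe_mem_extReal {z : ℂ} : (z : OnePoint ℂ) ∈ extReal ↔ z.im = 0 := Iff.rfl

/-- The zero set of a Hermitian form on the Riemann sphere. -/
def herm (a : ℝ) (b : ℂ) (d : ℝ) : Set (OnePoint ℂ) :=
  {p | p.elim (a = 0) (fun z => a * normSq z + 2 * (conj b * z).re + d = 0)}

@[simp] theorem infty_mem_herm {a d : ℝ} {b : ℂ} : infty ∈ herm a b d ↔ a = 0 := Iff.rfl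

@[simp] theorem coe_mem_herm {a d : ℝ} {b z : ℂ} :
    (z : OnePoint ℂ) ∈ herm a b d ↔ a * normSq z + 2 * (conj b * z).re + d = 0 := Iff.rfl

theorem ite_mem_herm {a d : ℝ} {b v w : ℂ} (h : v ≠ 0 ∨ w ≠ 0) :
    (if w = 0 then infty else ((v / w : ℂ) : OnePoint ℂ)) ∈ herm a b d ↔
      a * normSq v + 2 * (conj b * (v * conj w)).re + d * normSq w = 0 := by
  split_ifs with hw
  · have hv : normSq v ≠ 0 := by simpa [hw] using h
    simp [hw, hv]
  · have hn : normSq w ≠ 0 := by simpa using hw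
    have e : conj b * (v / w) = conj b * (v * conj w) / (normSq w : ℂ) := by
      rw [← mul_conj]
      have : conj w ≠ 0 := by simpa using hw
      field_simp
    rw [coe_mem_herm, e, normSq_div, div_ofReal_re]
    field_simp
    rw [mul_zero]

/-- The Hermitian matrix H of the form is replaced by A*HA, whose determinant is |det A|² det H. The
condition a d < |b|² says that H is indefinite. -/
theorem herm_pullback (A : GL (Fin 2) ℂ) {a d : ℝ} {b : ℂ} (h : a * d < normSq b) :
    ∃ (a' d' : ℝ) (b' : ℂ), a' * d' < normSq b' ∧
      ∀ p, A • p ∈ herm a b d ↔ p ∈ herm a' b' d' := by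
  have hA : 0 < normSq (A 0 0 * A 1 1 - A 0 1 * A 1 0) := by
    have := A.det_ne_zero
    rw [Matrix.det_fin_two] at this
    exact normSq_pos.2 this
  refine ⟨a * normSq (A 0 0) + 2 * (conj b * (A 0 0 * conj (A 1 0))).re + d * normSq (A 1 0),
    a * normSq (A 0 1) + 2 * (conj b * (A 0 1 * conj (A 1 1))).re + d * normSq (A 1 1),
    a * conj (A 0 0) * A 0 1 + b * conj (A 0 0) * A 1 1 + conj b * A 0 1 * conj (A 1 0)
      + d * conj (A 1 0) * A 1 1, ?_, fun p => ?_⟩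
  · rw [← sub_pos] at h ⊢
    have := mul_pos hA h
    refine this.trans_eq ?_
    simp only [normSq_apply, add_re, add_im, sub_re, sub_im, mul_re, mul_im, conj_re, conj_im,
      ofReal_re, ofReal_im]
    ring
  · induction p with
    | infty => rw [smul_infty_eq_ite, ite_mem_herm (gl_col_ne_zero A), infty_mem_herm]
    | coe z =>
      rw [smul_some_eq_ite, ite_mem_herm (by
        simpa using gl_apply_ne_zero A (v := z) (w := 1) (by simp)), coe_mem_herm]
      apply Eq.congr_left
      simp only [normSq_apply, add_re, add_im, mul_re, mul_im, conj_re, conj_im,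
        ofReal_re, ofReal_im]
      ring

theorem extReal_eq_herm : extReal = herm 0 I 0 := by
  ext p
  induction p with
  | infty => simp
  | coe z => simp

theorem herm_eq_extReal {b : ℂ} (hb : b ≠ 0) (h : b.re = 0) : herm 0 b 0 = extReal := by
  have hi : b.im ≠ 0 := fun hi => hb (Complex.ext h hi)
  ext p
  induction p with
  | infty => simp
  | coe z => simp [h, hi]

/-- The locus is the line Re(conj b · z) = 0 through the origin, obtained from the real line by
multiplication by i b. -/
theorem herm_eq_mobImage {b : ℂ} (hb : b ≠ 0) :
    ∃ D : GL (Fin 2) ℂ, herm 0 b 0 = mobImage D extReal ∧ D • (infty : OnePoint ℂ) = infty ∧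
      D • ((0 : ℂ) : OnePoint ℂ) = ((0 : ℂ) : OnePoint ℂ) := by
  have hdet : (I * b) * 1 - 0 * 0 ≠ 0 := by simp [hb]
  have hD : ∀ z : ℂ, glMk (I * b) 0 0 1 hdet • (z : OnePoint ℂ) = ((I * b * z : ℂ) : OnePoint ℂ) :=
    fun z => by rw [glMk_smul_coe]; simp
  have hD2 : glMk (I * b) 0 0 1 hdet • (infty : OnePoint ℂ) = infty := by
    rw [glMk_smul_infty]; simp
  have hn : b.re * b.re + b.im * b.im ≠ 0 := by
    rw [← normSq_apply]; simpa using hb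
  have key : ∀ p, glMk (I * b) 0 0 1 hdet • p ∈ herm 0 b 0 ↔ p ∈ extReal := by
    intro p
    induction p with
    | infty => rw [hD2]; simp
    | coe z =>
      rw [hD, coe_mem_herm, coe_mem_extReal]
      have : 0 * normSq (I * b * z) + 2 * (conj b * (I * b * z)).re + 0
          = -2 * (b.re * b.re + b.im * b.im) * z.im := by
        simp only [mul_re, mul_im, conj_re, conj_im, I_re, I_im]; ring
      rw [this]
      simp only [mul_eq_zero, hn, or_false]
      norm_num
  refine ⟨glMk (I * b) 0 0 1 hdet, ?_, hD2, by rw [hD, mul_zero]⟩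
  ext p
  rw [mem_mobImage, ← key, smul_inv_smul]

/-- Moving p to ∞ and q to 0 kills both diagonal coefficients, so the form becomes that of a line
through the origin. -/
theorem herm_eq_mobImage_of_mem {a d : ℝ} {b : ℂ} (h : a * d < normSq b) {p q : OnePoint ℂ}
    (hpq : p ≠ q) (hp : p ∈ herm a b d) (hq : q ∈ herm a b d) :
    ∃ B : GL (Fin 2) ℂ, herm a b d = mobImage B extReal ∧ B • (infty : OnePoint ℂ) = p ∧
      B • ((0 : ℂ) : OnePoint ℂ) = q := by
  obtain ⟨A, hAp, hAq⟩ := exists_smul_eq_infty_zero hpq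
  obtain ⟨a', d', b', h', hA⟩ := herm_pullback A⁻¹ h
  have hp' := (hA infty).1 (by rwa [← hAp, inv_smul_smul])
  have hq' := (hA ((0 : ℂ) : OnePoint ℂ)).1 (by rwa [← hAq, inv_smul_smul])
  rw [infty_mem_herm] at hp'
  subst hp'
  simp only [coe_mem_herm, map_zero, mul_zero, zero_re, zero_add] at hq'
  subst hq'
  obtain ⟨D, hD, hD1, hD2⟩ := herm_eq_mobImage (b := b') (by
    rintro rfl; simp at h')
  refine ⟨A⁻¹ * D, ?_, by rw [mul_smul, hD1, ← hAp, inv_smul_smul],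
    by rw [mul_smul, hD2, ← hAq, inv_smul_smul]⟩
  rw [mobImage_mul, ← hD]
  ext x
  rw [mem_mobImage, inv_inv, ← hA, inv_smul_smul]

theorem exists_pair_mem_herm {a d : ℝ} {b : ℂ} (h : a * d < normSq b) :
    ∃ p ∈ herm a b d, ∃ q ∈ herm a b d, p ≠ q := by
  by_cases ha : a = 0
  · subst ha
    have hb : normSq b ≠ 0 := by rw [zero_mul] at h; exact h.ne'
    refine ⟨infty, by simp, ((-d / (2 * normSq b) * b : ℂ) : OnePoint ℂ), ?_,
      OnePoint.infty_ne_coe _⟩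
    rw [coe_mem_herm]
    have : conj b * (-d / (2 * normSq b) * b) = ((-d / (2 * normSq b) * normSq b : ℝ) : ℂ) := by
      push_cast
      rw [normSq_eq_conj_mul_self]; ring
    rw [this, ofReal_re]
    field_simp
    ring
  · have hs : 0 < normSq b - a * d := sub_pos.2 h
    have hsq := Real.sq_sqrt hs.le
    have hspos := Real.sqrt_pos.2 hs
    -- The circle has centre −b/a and radius √(|b|² − a d)/|a|; the two signs of s give the ends of
    -- its horizontal diameter.
    have key : ∀ s : ℝ, s ^ 2 = normSq b - a * d →
        (((s - b) / a : ℂ) : OnePoint ℂ) ∈ herm a b d := by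
      intro s hs
      rw [coe_mem_herm, normSq_div, ← mul_div_assoc (conj b), div_ofReal_re, normSq_ofReal]
      rw [normSq_apply] at hs ⊢
      simp only [mul_re, conj_re, conj_im, sub_re, sub_im, ofReal_re, ofReal_im]
      field_simp
      linear_combination hs
    refine ⟨_, key _ hsq, _, key (-√(normSq b - a * d)) (by rw [neg_sq, hsq]), fun h => ?_⟩
    have h1 := OnePoint.coe_injective h
    have ha' : (a : ℂ) ≠ 0 := by simpa using ha
    rw [div_left_inj' ha', sub_left_inj, ofReal_inj] at h1
    linarith

/-- A circle of the Riemann sphere. -/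
def IsCirc (S : Set (OnePoint ℂ)) : Prop := ∃ A : GL (Fin 2) ℂ, S = mobImage A extReal

theorem isCirc_iff {S : Set (OnePoint ℂ)} :
    IsCirc S ↔ ∃ (a d : ℝ) (b : ℂ), a * d < normSq b ∧ S = herm a b d := by
  constructor
  · rintro ⟨A, rfl⟩
    obtain ⟨a', d', b', h', hA⟩ := herm_pullback A⁻¹ (a := 0) (b := I) (d := 0) (by simp)
    refine ⟨a', d', b', h', ?_⟩
    ext p
    rw [mem_mobImage, extReal_eq_herm, hA]
  · rintro ⟨a, d, b, h, rfl⟩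
    obtain ⟨p, hp, q, hq, hpq⟩ := exists_pair_mem_herm h
    obtain ⟨B, hB, -⟩ := herm_eq_mobImage_of_mem h hpq hp hq
    exact ⟨B, hB⟩

theorem IsCirc.mobImage {S : Set (OnePoint ℂ)} (h : IsCirc S) (A : GL (Fin 2) ℂ) :
    IsCirc (mobImage A S) := by
  obtain ⟨B, rfl⟩ := h
  exact ⟨A * B, (mobImage_mul A B _).symm⟩

theorem IsCirc.conjRS_preimage {S : Set (OnePoint ℂ)} (h : IsCirc S) : IsCirc (conjRS ⁻¹' S) := by
  obtain ⟨a, d, b, h, rfl⟩ := isCirc_iff.1 h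
  refine isCirc_iff.2 ⟨a, d, conj b, by rwa [normSq_conj], ?_⟩
  ext p
  induction p with
  | infty => simp
  | coe z => simp

theorem exists_smul_zero_extReal {p : OnePoint ℂ} (hp : p ∈ extReal) :
    ∃ B : GL (Fin 2) ℂ, mobImage B extReal = extReal ∧ B • ((0 : ℂ) : OnePoint ℂ) = p := by
  obtain ⟨q, hq, hqp⟩ : ∃ q ∈ extReal, q ≠ p := by
    by_cases h : p = infty
    · exact ⟨((0 : ℂ) : OnePoint ℂ), by simp, by rw [h]; exact OnePoint.coe_ne_infty _⟩
    · exact ⟨infty, by simp, Ne.symm h⟩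
  rw [extReal_eq_herm] at hp hq
  obtain ⟨B, hB, -, hB2⟩ := herm_eq_mobImage_of_mem (by simp) hqp hq hp
  exact ⟨B, by rw [← hB, extReal_eq_herm], hB2⟩

theorem exists_smul_infty_extReal {p : OnePoint ℂ} (hp : p ∈ extReal) :
    ∃ B : GL (Fin 2) ℂ, mobImage B extReal = extReal ∧ B • (infty : OnePoint ℂ) = p := by
  obtain ⟨B, hB, hB0⟩ := exists_smul_zero_extReal hp
  obtain ⟨D, hD, hD0⟩ := exists_smul_zero_extReal infty_mem_extReal
  refine ⟨B * D⁻¹, ?_, by rw [mul_smul, ← hD0, inv_smul_smul, hB0]⟩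
  rw [mobImage_mul]
  nth_rw 1 [← hD]
  rw [mobImage_inv_mobImage, hB]

/-- On real numbers the Hermitian form is the polynomial a x² + 2 Re(b) x + d. Infinitely many roots
force it to vanish, which leaves a purely imaginary b. -/
theorem extReal_eq_of_infinite {A : GL (Fin 2) ℂ} (h : (extReal ∩ mobImage A extReal).Infinite) :
    mobImage A extReal = extReal := by
  obtain ⟨a, d, b, hlt, e⟩ := isCirc_iff.1 ⟨A, rfl⟩
  rw [e] at h ⊢
  have h' : ((fun z : ℂ => (z : OnePoint ℂ)) ⁻¹' (extReal ∩ herm a b d)).Infinite := by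
    intro hf
    apply h
    refine ((hf.image (fun z : ℂ => (z : OnePoint ℂ))).insert infty).subset ?_
    intro p hp
    induction p with
    | infty => exact Set.mem_insert _ _
    | coe z => exact Set.mem_insert_of_mem _ ⟨z, hp, rfl⟩
  obtain ⟨h1, h2, h3⟩ := quadratic_eq_zero_of_infinite (p := a) (q := (2 * b.re : ℝ)) (r := d) h' (by
    rintro z ⟨h1, h2⟩
    have h1' : z.im = 0 := h1
    rw [coe_mem_herm] at h2
    have hz : z = (z.re : ℂ) := Complex.ext rfl h1'
    rw [hz, ← ofReal_pow, ← ofReal_mul, ← ofReal_mul, ← ofReal_add, ← ofReal_add, ofReal_eq_zero,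
      ← h2, normSq_apply, h1']
    simp [h1']; ring)
  have ha : a = 0 := by exact_mod_cast h1
  have hd : d = 0 := by exact_mod_cast h3
  have hb : 2 * b.re = 0 := by exact_mod_cast h2
  rw [ha, hd] at hlt ⊢
  exact herm_eq_extReal (by rintro rfl; simp at hlt) (by linarith)

theorem IsCirc.eq_of_infinite_inter {S T : Set (OnePoint ℂ)} (hS : IsCirc S) (hT : IsCirc T)
    (h : (S ∩ T).Infinite) : S = T := by
  obtain ⟨A, rfl⟩ := hS
  obtain ⟨B, rfl⟩ := hT
  have := extReal_eq_of_infinite (A := A⁻¹ * B) (by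
    have h1 := h.image (f := fun p => A⁻¹ • p) (MulAction.injective A⁻¹).injOn
    refine h1.mono ?_
    rintro _ ⟨p, ⟨h1, h2⟩, rfl⟩
    refine ⟨mem_mobImage.1 h1, ?_⟩
    rw [mobImage_mul]
    exact smul_mem_mobImage.2 h2)
  rw [mobImage_mul] at this
  exact (congrArg (ConfLox.mobImage A) this).symm.trans (mobImage_mobImage_inv A _)

theorem fromRiemannSphere_coe_mem_plane (n : E3) (e : ℝ) (z : ℂ) :
    inner ℝ n (fromRiemannSphere (z : OnePoint ℂ) : E3) = e ↔
      (z : OnePoint ℂ) ∈ herm (n 2 - e) ⟨n 0, n 1⟩ (-(n 2 + e)) := by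
  have h : normSq z + 1 ≠ 0 := by have := normSq_nonneg z; positivity
  rw [coe_fromRiemannSphere_coe, inner_E3, coe_mem_herm, proj_zero, proj_one, proj_two]
  simp only [map_one, mul_one, mul_re, conj_re, conj_im]
  field_simp
  constructor <;> intro h <;> linear_combination h

theorem plane_eq_herm (n : E3) (e : ℝ) : {x : S2 | inner ℝ n (x : E3) = e}
    = fromRiemannSphere '' herm (n 2 - e) ⟨n 0, n 1⟩ (-(n 2 + e)) := by
  ext x
  obtain ⟨p, rfl⟩ := fromRiemannSphere_bijective.2 x
  rw [fromRiemannSphere_bijective.1.mem_set_image, Set.mem_ofPred_eq]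
  induction p with
  | infty =>
    rw [coe_fromRiemannSphere_infty, inner_E3, infty_mem_herm, proj_zero, proj_one, proj_two]
    simp [sub_eq_zero]
  | coe z => exact fromRiemannSphere_coe_mem_plane n e z

theorem norm_sq_E3 (n : E3) : ‖n‖ ^ 2 = n 0 ^ 2 + n 1 ^ 2 + n 2 ^ 2 := by
  rw [← real_inner_self_eq_norm_sq, inner_E3]; ring

/-- The plane ⟨n, x⟩ = e has |b|² − a d = |n|² − e², so meeting the sphere in a circle is the same
as indefiniteness of the form. Conversely R normalizes the normal vector read off from (a, b, d). -/
theorem isRoundCircle_iff {K : Set S2} :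
    IsRoundCircle K ↔ ∃ S, IsCirc S ∧ K = fromRiemannSphere '' S := by
  constructor
  · rintro ⟨n, e, hn, he, rfl⟩
    refine ⟨_, isCirc_iff.2 ⟨_, _, _, ?_, rfl⟩, plane_eq_herm n e⟩
    have h1 := norm_sq_E3 n
    rw [hn] at h1
    have h2 : e ^ 2 < 1 := by rwa [sq_lt_one_iff_abs_lt_one]
    rw [normSq_apply]
    simp only
    nlinarith
  · rintro ⟨S, hS, rfl⟩
    obtain ⟨a, d, b, h, rfl⟩ := isCirc_iff.1 hS
    have hR0 : 0 < (a - d) ^ 2 / 4 + normSq b := by nlinarith [sq_nonneg (a + d)]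
    obtain ⟨R, hR, hR2⟩ : ∃ R : ℝ, 0 < R ∧ R ^ 2 = (a - d) ^ 2 / 4 + normSq b :=
      ⟨_, Real.sqrt_pos.2 hR0, Real.sq_sqrt hR0.le⟩
    let n : E3 := !₂[b.re / R, b.im / R, (a - d) / 2 / R]
    refine ⟨n, -(a + d) / 2 / R, ?_, ?_, ?_⟩
    · have h1 := norm_sq_E3 n
      simp only [n, Matrix.cons_val] at h1
      have : ‖n‖ ^ 2 = 1 := by
        rw [h1]
        field_simp
        rw [hR2, normSq_apply]; ring
      exact (pow_eq_one_iff_of_nonneg (norm_nonneg _) two_ne_zero).1 this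
    · rw [← sq_lt_one_iff_abs_lt_one, div_pow, div_lt_one (by positivity), hR2]
      nlinarith
    · rw [plane_eq_herm]
      congr 1
      have ha : n 2 - -(a + d) / 2 / R = a / R := by simp [n]; ring
      have hd : -(n 2 + -(a + d) / 2 / R) = d / R := by simp [n]; ring
      rw [ha, hd]
      ext p
      induction p with
      | infty => simp [hR.ne']
      | coe z =>
        simp only [coe_mem_herm, mul_re, conj_re, conj_im, n, Matrix.cons_val]
        field_simp
        rw [zero_mul]

/-! ### Smooth curves and fractional linear transformations -/

/-- The set `C` is an embedded smooth curve near `x`. -/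
def IsSubmanifoldAt (C : Set S2) (x : S2) : Prop :=
  ∃ (U : Set S2) (α : ℝ → S2), IsOpen U ∧ x ∈ U ∧
    ContDiff ℝ ∞ (fun t => (α t : E3)) ∧ (∀ t, deriv (fun t => (α t : E3)) t ≠ 0) ∧
    Topology.IsEmbedding α ∧ C ∩ U = Set.range α

/-- The homeomorphism of the sphere induced by a fractional linear transformation. -/
noncomputable def mobHomeo (A : GL (Fin 2) ℂ) : S2 ≃ₜ S2 where
  toEquiv := mobPerm A
  continuous_toFun := (contMDiff_mobPerm A).continuous
  continuous_invFun := by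
    have := (contMDiff_mobPerm A⁻¹).continuous
    rwa [mobPerm_inv] at this

theorem mobHomeo_apply (A : GL (Fin 2) ℂ) (x : S2) : mobHomeo A x = mobPerm A x := rfl

theorem continuous_gl_smul (A : GL (Fin 2) ℂ) : Continuous fun p : OnePoint ℂ => A • p := by
  have : (fun p : OnePoint ℂ => A • p) = fun p => sphereHomeo.symm (mobHomeo A (sphereHomeo p)) := by
    funext p
    rw [sphereHomeo_apply, mobHomeo_apply, mobPerm_fromRiemannSphere,
      sphereHomeo_symm_fromRiemannSphere]
  rw [this]
  fun_prop

theorem contDiff_mobPerm_comp (A : GL (Fin 2) ℂ) {α : ℝ → S2}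
    (hα : ContDiff ℝ ∞ (fun t => (α t : E3))) : ContDiff ℝ ∞ (fun t => (mobPerm A (α t) : E3)) := by
  simp only [coe_mobPerm]
  exact contDiff_iff_contDiffAt.2 fun t =>
    (contDiffAt_celestial _ (lorTime_pos A (α t)).ne').comp t (f := fun t => (α t : E3))
      hα.contDiffAt

/-- The inverse transformation is smooth as well, so a zero velocity of the image curve would pull
back to a zero velocity of the original. -/
theorem deriv_mobPerm_comp_ne_zero (A : GL (Fin 2) ℂ) {α : ℝ → S2}
    (hα : ContDiff ℝ ∞ (fun t => (α t : E3))) {t : ℝ} (h : deriv (fun t => (α t : E3)) t ≠ 0) :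
    deriv (fun t => (mobPerm A (α t) : E3)) t ≠ 0 := by
  intro h0
  apply h
  have h1 := ((contDiff_mobPerm_comp A hα).differentiable (by simp) t).hasDerivAt
  rw [h0] at h1
  have h2 := ((contDiffAt_celestial _ (lorTime_pos A⁻¹ (mobPerm A (α t))).ne').differentiableAt
    (by simp)).hasFDerivAt.comp_hasDerivAt t h1
  rw [map_zero] at h2
  have e : (fun t => (α t : E3)) = celestial (A⁻¹ : GL (Fin 2) ℂ) ∘ fun t => (mobPerm A (α t) : E3) := by
    funext t
    rw [Function.comp_apply, ← coe_mobPerm, mobPerm_inv]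
    exact congrArg Subtype.val ((mobPerm A).symm_apply_apply (α t)).symm
  rw [e]
  exact h2.deriv

theorem IsSubmanifoldAt.mobPerm_image {C : Set S2} {x : S2} (h : IsSubmanifoldAt C x)
    (A : GL (Fin 2) ℂ) : IsSubmanifoldAt (mobPerm A '' C) (mobPerm A x) := by
  obtain ⟨U, α, hU, hx, hα, hd, he, hr⟩ := h
  refine ⟨mobPerm A '' U, fun t => mobPerm A (α t), (mobHomeo A).isOpen_image.2 hU, ⟨x, hx, rfl⟩,
    contDiff_mobPerm_comp A hα, fun t => deriv_mobPerm_comp_ne_zero A hα (hd t),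
    (mobHomeo A).isEmbedding.comp he, ?_⟩
  rw [← Set.image_inter (mobPerm A).injective, hr, ← Set.range_comp]
  rfl

theorem IsSmoothCurve.mobPerm_image {C : Set S2} (h : IsSmoothCurve C) (A : GL (Fin 2) ℂ) :
    IsSmoothCurve (mobPerm A '' C) := by
  refine ⟨h.connected.image _ (mobHomeo A).continuous.continuousOn, ?_⟩
  rintro _ ⟨x, hx, rfl⟩
  exact IsSubmanifoldAt.mobPerm_image (h.submanifold x hx) A

theorem IsSmoothCurve.mobImage {S : Set (OnePoint ℂ)} (h : IsSmoothCurve (fromRiemannSphere '' S))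
    (A : GL (Fin 2) ℂ) : IsSmoothCurve (fromRiemannSphere '' mobImage A S) := by
  rw [← ConfLox.mobPerm_image]
  exact h.mobPerm_image A

theorem deriv_stereoInvAux_comp_ne_zero {γ : ℝ → ℂ} (hγ : ContDiff ℝ ∞ γ) {t : ℝ}
    (h : deriv γ t ≠ 0) : deriv (fun t => stereoInvAux (γ t)) t ≠ 0 := by
  intro h0
  apply h
  have h1 : HasDerivAt (fun t => stereoInvAux (γ t)) 0 t := by
    rw [← h0]
    exact ((contDiff_stereoInvAux.comp hγ).differentiable (by simp) t).hasDerivAt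
  have hne : stereoInvAux (γ t) 2 ≠ 1 := fun h' => fromRiemannSphere_coe_ne (γ t) (eq_northPole_of h')
  have h2 := ((contDiffAt_stereo hne).differentiableAt (by simp)).hasFDerivAt.comp_hasDerivAt t h1
  rw [map_zero] at h2
  have e : γ = stereo ∘ fun t => stereoInvAux (γ t) := by
    funext t
    rw [Function.comp_apply, stereo_stereoInvAux]
  rw [e]
  exact h2.deriv

theorem isEmbedding_fromRiemannSphere_comp {γ : ℝ → ℂ} (he : IsEmbedding γ) :
    IsEmbedding fun t => fromRiemannSphere (γ t : OnePoint ℂ) :=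
  sphereHomeo.isEmbedding.comp (OnePoint.isOpenEmbedding_coe.isEmbedding.comp he)

theorem isSubmanifoldAt_of_plane_curve {S V : Set (OnePoint ℂ)} {γ : ℝ → ℂ} (hγ : ContDiff ℝ ∞ γ)
    (hd : ∀ t, deriv γ t ≠ 0) (he : IsEmbedding γ) (hV : IsOpen V)
    (hS : S ∩ V = Set.range fun t => (γ t : OnePoint ℂ)) (t : ℝ) :
    IsSubmanifoldAt (fromRiemannSphere '' S) (fromRiemannSphere (γ t : OnePoint ℂ)) := by
  have ht : (γ t : OnePoint ℂ) ∈ V := by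
    have : (γ t : OnePoint ℂ) ∈ S ∩ V := by rw [hS]; exact ⟨t, rfl⟩
    exact this.2
  refine ⟨fromRiemannSphere '' V, fun t => fromRiemannSphere (γ t : OnePoint ℂ),
    sphereHomeo.isOpen_image.2 hV, ⟨_, ht, rfl⟩, contDiff_stereoInvAux.comp hγ,
    fun t => deriv_stereoInvAux_comp_ne_zero hγ (hd t), isEmbedding_fromRiemannSphere_comp he, ?_⟩
  rw [← Set.image_inter fromRiemannSphere_bijective.1, hS, ← Set.range_comp]
  rfl

theorem isEmbedding_ofReal : IsEmbedding (fun t : ℝ => (t : ℂ)) :=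
  isometry_ofReal.isEmbedding

/-- Connectedness comes from the compactified real line. A chart is needed only at 0, since
fractional linear maps preserving the circle carry 0 to any of its points. -/
theorem isSmoothCurve_extReal : IsSmoothCurve (fromRiemannSphere '' extReal) := by
  constructor
  · have hc : Continuous (OnePoint.map (fun t : ℝ => (t : ℂ))) := by
      apply OnePoint.continuous_map continuous_ofReal
      rw [coclosedCompact_eq_cocompact, coclosedCompact_eq_cocompact]
      exact isometry_ofReal.isClosedEmbedding.tendsto_cocompact
    have e : extReal = Set.range (OnePoint.map (fun t : ℝ => (t : ℂ))) := by
      ext p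
      induction p with
      | infty => exact ⟨fun _ => ⟨infty, rfl⟩, fun _ => trivial⟩
      | coe z =>
        rw [coe_mem_extReal]
        constructor
        · intro h
          refine ⟨(z.re : OnePoint ℝ), ?_⟩
          rw [OnePoint.map_some]
          congr 1
          exact Complex.ext rfl (by simp [h])
        · rintro ⟨q, hq⟩
          induction q with
          | infty => exact absurd hq (OnePoint.infty_ne_coe _)
          | coe t => rw [← OnePoint.coe_injective hq, ofReal_im]
    rw [e]
    exact (isConnected_range hc).image _ continuous_fromRiemannSphere.continuousOn
  · have h0 : IsSubmanifoldAt (fromRiemannSphere '' extReal)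
        (fromRiemannSphere ((0 : ℂ) : OnePoint ℂ)) := by
      have := isSubmanifoldAt_of_plane_curve (S := extReal) (V := {infty}ᶜ)
        (γ := fun t : ℝ => (t : ℂ)) ofRealCLM.contDiff (fun t => by
          have := (hasDerivAt_id t).ofReal_comp.deriv
          simp only [id] at this
          rw [this]; simp) isEmbedding_ofReal
        OnePoint.isClosed_infty.isOpen_compl (by
          ext p
          induction p with
          | infty => simp
          | coe z =>
            simp only [Set.mem_inter_iff, coe_mem_extReal, Set.mem_compl_iff, Set.mem_singleton_iff,
              OnePoint.coe_ne_infty, not_false_eq_true, and_true, Set.mem_range, OnePoint.coe_eq_coe]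
            exact ⟨fun h => ⟨z.re, Complex.ext rfl (by simp [h])⟩,
              fun ⟨t, ht⟩ => by rw [← ht, ofReal_im]⟩) 0
      rwa [ofReal_zero] at this
    rintro _ ⟨p, hp, rfl⟩
    obtain ⟨B, hB, hB0⟩ := exists_smul_zero_extReal hp
    have := h0.mobPerm_image B
    rwa [mobPerm_image, hB, mobPerm_fromRiemannSphere, hB0] at this

theorem continuous_spiral (β : ℝ) : Continuous (spiral β) := by
  unfold spiral; fun_prop

/-- On the punctured plane, log|z|/β is a continuous left inverse. -/
theorem isEmbedding_spiral {β : ℝ} (hβ : β ≠ 0) : IsEmbedding (spiral β) := by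
  let g : {z : ℂ // z ≠ 0} → ℝ := fun z => Real.log ‖(z : ℂ)‖ / β
  let f : ℝ → {z : ℂ // z ≠ 0} := fun θ => ⟨spiral β θ, spiral_ne_zero β θ⟩
  have hg : Continuous g :=
    (Continuous.log (continuous_subtype_val.norm) fun z => norm_ne_zero_iff.2 z.2).div_const β
  have hf : Continuous f := (continuous_spiral β).subtype_mk _
  have hfg : Function.LeftInverse g f := log_norm_spiral hβ
  exact IsEmbedding.subtypeVal.comp (hfg.isEmbedding hg hf)

theorem isSmoothCurve_logSpiral {β : ℝ} (hβ : β ≠ 0) :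
    IsSmoothCurve (fromRiemannSphere '' logSpiral β) := by
  constructor
  · exact (isConnected_range (OnePoint.continuous_coe.comp (continuous_spiral β))).image _
      continuous_fromRiemannSphere.continuousOn
  · rintro _ ⟨_, ⟨θ, rfl⟩, rfl⟩
    refine isSubmanifoldAt_of_plane_curve (γ := spiral β) (V := (fun z : ℂ => (z : OnePoint ℂ)) '' {0}ᶜ)
      ?_ (fun t => (reg_spiral β t).1.deriv_ne) (isEmbedding_spiral hβ)
      (OnePoint.isOpen_image_coe.2 isOpen_compl_singleton) ?_ θ
    · exact contDiff_exp.comp (contDiff_const.mul ofRealCLM.contDiff)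
    · rw [logSpiral_eq]
      apply Set.inter_eq_left.2
      rintro _ ⟨t, rfl⟩
      exact ⟨_, spiral_ne_zero β t, rfl⟩

/-! ### Curves homogeneous under fractional linear transformations -/

/-- The stabilizer of a set in the group of fractional linear transformations is transitive
on it. -/
def MobHomogeneous (S : Set (OnePoint ℂ)) : Prop :=
  ∀ x ∈ S, ∀ y ∈ S, ∃ A : GL (Fin 2) ℂ, mobImage A S = S ∧ A • x = y

theorem MobHomogeneous.mobImage {S : Set (OnePoint ℂ)} (h : MobHomogeneous S) (B : GL (Fin 2) ℂ) :
    MobHomogeneous (mobImage B S) := by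
  rintro _ ⟨x, hx, rfl⟩ _ ⟨y, hy, rfl⟩
  obtain ⟨A, hA, hxy⟩ := h x hx y hy
  refine ⟨B * A * B⁻¹, ?_, ?_⟩
  · rw [mobImage_mul, mobImage_inv_mobImage, mobImage_mul, hA]
  · simp only [mul_smul, inv_smul_smul, hxy]

theorem MobHomogeneous.isHomogeneousCurve {S : Set (OnePoint ℂ)} (h : MobHomogeneous S)
    (hS : IsSmoothCurve (fromRiemannSphere '' S)) : IsHomogeneousCurve (fromRiemannSphere '' S) := by
  let H : Subgroup (Equiv.Perm S2) :=
    { carrier := {φ | ∃ A : GL (Fin 2) ℂ, φ = mobPerm A ∧ ConfLox.mobImage A S = S}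
      mul_mem' := by
        rintro _ _ ⟨A, rfl, hA⟩ ⟨B, rfl, hB⟩
        exact ⟨A * B, (mobPerm_mul A B).symm, by rw [mobImage_mul, hB, hA]⟩
      one_mem' := ⟨1, mobPerm_one.symm, by simp [ConfLox.mobImage]⟩
      inv_mem' := by
        rintro _ ⟨A, rfl, hA⟩
        refine ⟨A⁻¹, (mobPerm_inv A).symm, ?_⟩
        nth_rw 1 [← hA]
        rw [mobImage_inv_mobImage] }
  refine ⟨hS, H, ?_, ?_, ?_⟩
  · rintro _ ⟨A, rfl, -⟩
    exact isConformalTransformation_mobPerm A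
  · rintro _ ⟨A, rfl, hA⟩
    rw [mobPerm_image, hA]
  · rintro _ ⟨x, hx, rfl⟩ _ ⟨y, hy, rfl⟩
    obtain ⟨A, hA, hxy⟩ := h x hx y hy
    exact ⟨mobPerm A, ⟨A, rfl, hA⟩, by rw [mobPerm_fromRiemannSphere, hxy]⟩

theorem mobHomogeneous_extReal : MobHomogeneous extReal := by
  intro x hx y hy
  obtain ⟨B, hB, hBx⟩ := exists_smul_zero_extReal hx
  obtain ⟨D, hD, hDy⟩ := exists_smul_zero_extReal hy
  refine ⟨D * B⁻¹, ?_, by rw [← hBx, mul_smul, inv_smul_smul, hDy]⟩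
  rw [mobImage_mul]
  nth_rw 1 [← hB]
  rw [mobImage_inv_mobImage, hD]

theorem mobHomogeneous_logSpiral (β : ℝ) : MobHomogeneous (logSpiral β) := by
  rintro _ ⟨θ, rfl⟩ _ ⟨η, rfl⟩
  have hdet : spiral β (η - θ) * 1 - 0 * 0 ≠ 0 := by simpa using spiral_ne_zero β (η - θ)
  have hA : ∀ t, glMk _ 0 0 1 hdet • (spiral β t : OnePoint ℂ)
      = (spiral β (1 * t + (η - θ)) : OnePoint ℂ) := fun t => by
    rw [glMk_smul_coe, one_mul, add_comm t, spiral_add]; simp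
  refine ⟨_, smul_logSpiral_of (Or.inl rfl) hA, ?_⟩
  have := hA θ
  rwa [one_mul, add_sub_cancel] at this

/-! ### Homogeneity of arcs of circles -/

/-- The subset of the Riemann sphere given by a set of real numbers. -/
def realSet (J : Set ℝ) : Set (OnePoint ℂ) := (fun t : ℝ => ((t : ℂ) : OnePoint ℂ)) '' J

/-- A set of reals preserved transitively by real affine maps is homogeneous. -/
theorem mobHomogeneous_realSet_of_affine {J : Set ℝ}
    (h : ∀ x ∈ J, ∀ y ∈ J, ∃ k b : ℝ, k ≠ 0 ∧ k * x + b = y ∧ ∀ t, k * t + b ∈ J ↔ t ∈ J) :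
    MobHomogeneous (realSet J) := by
  rintro _ ⟨x, hx, rfl⟩ _ ⟨y, hy, rfl⟩
  obtain ⟨k, b, hk, hxy, hJ⟩ := h x hx y hy
  have hdet : (k : ℂ) * 1 - b * 0 ≠ 0 := by simpa using hk
  have hA : ∀ t : ℝ, glMk k b 0 1 hdet • ((t : ℂ) : OnePoint ℂ)
      = (((k * t + b : ℝ) : ℂ) : OnePoint ℂ) := fun t => by rw [glMk_smul_coe]; simp
  refine ⟨_, ?_, (hA x).trans (by rw [hxy])⟩
  ext p
  constructor
  · rintro ⟨_, ⟨t, ht, rfl⟩, rfl⟩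
    exact ⟨k * t + b, (hJ t).2 ht, (hA t).symm⟩
  · rintro ⟨t, ht, rfl⟩
    have e : k * ((t - b) / k) + b = t := by field_simp; ring
    refine ⟨_, ⟨(t - b) / k, (hJ _).1 (by rwa [e]), rfl⟩, ?_⟩
    exact (hA _).trans (by rw [e])

theorem mobHomogeneous_univ : MobHomogeneous (realSet Set.univ) :=
  mobHomogeneous_realSet_of_affine fun x _ y _ =>
    ⟨1, y - x, one_ne_zero, by ring, fun t => by simp⟩

theorem mobHomogeneous_Ioi (a : ℝ) : MobHomogeneous (realSet (Set.Ioi a)) :=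
  mobHomogeneous_realSet_of_affine fun x hx y hy => by
    have hx' : 0 < x - a := sub_pos.2 hx
    have hy' : 0 < y - a := sub_pos.2 hy
    have hk : 0 < (y - a) / (x - a) := by positivity
    refine ⟨(y - a) / (x - a), a - (y - a) / (x - a) * a, hk.ne', by field_simp; ring, fun t => ?_⟩
    have : (y - a) / (x - a) * t + (a - (y - a) / (x - a) * a)
        = a + (y - a) / (x - a) * (t - a) := by ring
    rw [this, Set.mem_Ioi, Set.mem_Ioi, lt_add_iff_pos_right, mul_pos_iff_of_pos_left hk, sub_pos]

theorem mobHomogeneous_Iio (a : ℝ) : MobHomogeneous (realSet (Set.Iio a)) :=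
  mobHomogeneous_realSet_of_affine fun x hx y hy => by
    have hx' : 0 < a - x := sub_pos.2 hx
    have hy' : 0 < a - y := sub_pos.2 hy
    have hk : 0 < (a - y) / (a - x) := by positivity
    refine ⟨(a - y) / (a - x), a - (a - y) / (a - x) * a, hk.ne', by field_simp; ring, fun t => ?_⟩
    have : (a - y) / (a - x) * t + (a - (a - y) / (a - x) * a)
        = a - (a - y) / (a - x) * (a - t) := by ring
    rw [this, Set.mem_Iio, Set.mem_Iio, sub_lt_self_iff, mul_pos_iff_of_pos_left hk, sub_pos]

theorem mobHomogeneous_Ioo {a b : ℝ} (hab : a < b) : MobHomogeneous (realSet (Set.Ioo a b)) := by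
  have hab' : 0 < b - a := sub_pos.2 hab
  -- The map t ↦ (b t + a)/(t + 1) carries the half-line (0, ∞) onto (a, b), so this case follows
  -- from the half-line.
  have hdet : (b : ℂ) * 1 - a * 1 ≠ 0 := by
    rw [mul_one, mul_one, ← ofReal_sub, Ne, ofReal_eq_zero]; exact hab'.ne'
  have hA : ∀ t : ℝ, 0 < t → glMk b a 1 1 hdet • ((t : ℂ) : OnePoint ℂ)
      = ((((b * t + a) / (t + 1) : ℝ) : ℂ) : OnePoint ℂ) := fun t ht => by
    have : (1 : ℂ) * t + 1 ≠ 0 := by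
      rw [one_mul, ← ofReal_one, ← ofReal_add, Ne, ofReal_eq_zero]; positivity
    rw [glMk_smul_coe, if_neg this]
    push_cast
    rw [one_mul]
  have := (mobHomogeneous_Ioi 0).mobImage (glMk b a 1 1 hdet)
  convert! this using 1
  ext p
  constructor
  · rintro ⟨t, ⟨h1, h2⟩, rfl⟩
    have h1' := sub_pos.2 h1
    have h2' := sub_pos.2 h2
    have hp : 0 < (t - a) / (b - t) := by positivity
    refine ⟨_, ⟨(t - a) / (b - t), hp, rfl⟩, ?_⟩
    refine (hA _ hp).trans ?_
    congr 2
    have : (t - a) / (b - t) + 1 = (b - a) / (b - t) := by field_simp; ring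
    rw [this]
    field_simp
    ring
  · rintro ⟨_, ⟨t, ht, rfl⟩, rfl⟩
    have ht' : 0 < t := ht
    refine ⟨_, ⟨?_, ?_⟩, (hA t ht').symm⟩
    · rw [lt_div_iff₀ (by positivity)]; nlinarith
    · rw [div_lt_iff₀ (by positivity)]; nlinarith

/-- Absence of a least or greatest element leaves only open intervals, half-lines and the whole line
(or the empty set). -/
theorem mobHomogeneous_of_interval {J : Set ℝ} (hJ : IsPreconnected J)
    (hlt : ∀ x ∈ J, ∃ y ∈ J, y < x) (hgt : ∀ x ∈ J, ∃ y ∈ J, x < y) :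
    MobHomogeneous (realSet J) := by
  have hno_min : ∀ a ∈ J, ¬ ∀ x ∈ J, a ≤ x := fun a ha h => by
    obtain ⟨y, hy, hlt⟩ := hlt a ha
    exact absurd (h y hy) (not_le.2 hlt)
  have hno_max : ∀ a ∈ J, ¬ ∀ x ∈ J, x ≤ a := fun a ha h => by
    obtain ⟨y, hy, hlt⟩ := hgt a ha
    exact absurd (h y hy) (not_le.2 hlt)
  rcases J.eq_empty_or_nonempty with rfl | hne
  · rintro _ ⟨x, hx, rfl⟩
    exact absurd hx (Set.notMem_empty x)
  have hcases := hJ.mem_intervals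
  simp only [Set.mem_insert_iff, Set.mem_singleton_iff] at hcases
  rcases hcases with h | h | h | h | h | h | h | h | h | h
  · rw [h] at hno_min hne
    exact absurd (fun x hx => hx.1) (hno_min _ (Set.left_mem_Icc.2 (Set.nonempty_Icc.1 hne)))
  · rw [h] at hno_min hne
    exact absurd (fun x hx => hx.1) (hno_min _ (Set.left_mem_Ico.2 (Set.nonempty_Ico.1 hne)))
  · rw [h] at hno_max hne
    exact absurd (fun x hx => hx.2) (hno_max _ (Set.right_mem_Ioc.2 (Set.nonempty_Ioc.1 hne)))
  · rw [h] at hne ⊢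
    exact mobHomogeneous_Ioo (Set.nonempty_Ioo.1 hne)
  · rw [h] at hno_min
    exact absurd (fun x hx => hx) (hno_min _ Set.self_mem_Ici)
  · rw [h]; exact mobHomogeneous_Ioi _
  · rw [h] at hno_max
    exact absurd (fun x hx => hx) (hno_max _ Set.self_mem_Iic)
  · rw [h]; exact mobHomogeneous_Iio _
  · rw [h]; exact mobHomogeneous_univ
  · rw [h] at hne; exact absurd hne Set.not_nonempty_empty

/-- A smooth curve contained in the real line is homogeneous. -/
theorem mobHomogeneous_of_isSmoothCurve_realSet {J : Set ℝ}
    (hC : IsSmoothCurve (fromRiemannSphere '' realSet J)) : MobHomogeneous (realSet J) := by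
  have he := isEmbedding_fromRiemannSphere_comp isEmbedding_ofReal
  have himg : fromRiemannSphere '' realSet J
      = (fun t : ℝ => fromRiemannSphere ((t : ℂ) : OnePoint ℂ)) '' J := by
    rw [realSet, Set.image_image]
  rw [himg] at hC
  have hlocal : ∀ x ∈ J, ∃ f : ℝ → ℝ, ∃ t, (StrictMono f ∨ StrictAnti f) ∧ f t = x ∧
      ∀ s, f s ∈ J := by
    intro x hx
    obtain ⟨U, α, -, hxU, -, -, hα, hr⟩ := hC.submanifold _ ⟨x, hx, rfl⟩
    have hf : ∀ s, ∃ y ∈ J, fromRiemannSphere ((y : ℂ) : OnePoint ℂ) = α s := by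
      intro s
      have : α s ∈ Set.range α := ⟨s, rfl⟩
      rw [← hr] at this
      exact this.1
    choose f hfJ hfα using hf
    have hcont : Continuous f := by
      rw [he.continuous_iff]
      exact hα.continuous.congr fun s => (hfα s).symm
    have hinj : Function.Injective f := fun s t hst => hα.injective (by
      rw [← hfα, ← hfα, hst])
    obtain ⟨t, ht⟩ : fromRiemannSphere ((x : ℂ) : OnePoint ℂ) ∈ Set.range α := by
      rw [← hr]; exact ⟨⟨x, hx, rfl⟩, hxU⟩
    -- A continuous injective function on the line is strictly monotone, so x, being a value of f,
    -- is not an extreme point of J.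
    exact ⟨f, t, hcont.strictMono_of_inj hinj, he.injective ((hfα t).trans ht), hfJ⟩
  apply mobHomogeneous_of_interval
  · exact he.isInducing.isPreconnected_image.1 hC.connected.isPreconnected
  · intro x hx
    obtain ⟨f, t, hf, rfl, hJ⟩ := hlocal x hx
    rcases hf with hf | hf
    · exact ⟨f (t - 1), hJ _, hf (by linarith)⟩
    · exact ⟨f (t + 1), hJ _, hf (by linarith)⟩
  · intro x hx
    obtain ⟨f, t, hf, rfl, hJ⟩ := hlocal x hx
    rcases hf with hf | hf
    · exact ⟨f (t + 1), hJ _, hf (by linarith)⟩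
    · exact ⟨f (t - 1), hJ _, hf (by linarith)⟩

/-- A smooth curve contained in a circle is homogeneous. -/
theorem mobHomogeneous_of_subset_isCirc {S K : Set (OnePoint ℂ)} (hK : IsCirc K) (hSK : S ⊆ K)
    (hS : IsSmoothCurve (fromRiemannSphere '' S)) : MobHomogeneous S := by
  obtain ⟨A, rfl⟩ := hK
  suffices h : MobHomogeneous (mobImage A⁻¹ S) by
    have := h.mobImage A
    rwa [mobImage_mobImage_inv] at this
  have hT : mobImage A⁻¹ S ⊆ extReal := by
    rw [← mobImage_inv_mobImage A extReal]; exact mobImage_mono hSK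
  have hTs := hS.mobImage A⁻¹
  generalize mobImage A⁻¹ S = T at hT hTs
  rcases hT.eq_or_ssubset with rfl | hss
  · exact mobHomogeneous_extReal
  obtain ⟨p, hp, hpT⟩ := Set.exists_of_ssubset hss
  -- A point of the circle missing from the curve is taken as ∞, so that the curve becomes a set of
  -- real numbers.
  obtain ⟨B, hB, hBp⟩ := exists_smul_infty_extReal hp
  suffices h : MobHomogeneous (mobImage B⁻¹ T) by
    have := h.mobImage B
    rwa [mobImage_mobImage_inv] at this
  have hT2 : mobImage B⁻¹ T ⊆ extReal := by
    rw [← mobImage_inv_mobImage B extReal, hB]; exact mobImage_mono hT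
  have hinf : infty ∉ mobImage B⁻¹ T := by
    rwa [mem_mobImage, inv_inv, hBp]
  have hTs2 := hTs.mobImage B⁻¹
  generalize mobImage B⁻¹ T = R at hT2 hinf hTs2
  have hR : R = realSet {t : ℝ | ((t : ℂ) : OnePoint ℂ) ∈ R} := by
    ext q
    constructor
    · intro hq
      induction q with
      | infty => exact absurd hq hinf
      | coe z =>
        have hz : z.im = 0 := hT2 hq
        have e : (z.re : ℂ) = z := Complex.ext rfl (by simp [hz])
        exact ⟨z.re, by rwa [Set.mem_ofPred_eq, e], by simp only [e]⟩
    · rintro ⟨t, ht, rfl⟩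
      exact ht
  rw [hR] at hTs2 ⊢
  exact mobHomogeneous_of_isSmoothCurve_realSet hTs2

/-! ### Curves whose Schwarzian derivative is homogeneous -/

theorem Reg.schw_comp_real {σ r : ℝ → ℝ} {t : ℝ} (hσ : Reg σ (r t)) (hr : Reg r t) :
    schw (fun s => σ (r s)) t = schw σ (r t) * deriv r t ^ 2 + schw r t := by
  have h := (hσ.ofReal_comp.comp_real hr).2
  rw [schw_ofReal_comp σ, schw_ofReal_comp (fun s => σ (r s))] at h
  exact_mod_cast h

theorem exists_antideriv {ρ : ℝ → ℝ} {t : ℝ} (h : ∀ᶠ s in 𝓝 t, ContDiffAt ℝ ∞ ρ s) :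
    ∃ σ : ℝ → ℝ, ∀ᶠ s in 𝓝 t, ContDiffAt ℝ ∞ σ s ∧ deriv σ s = ρ s := by
  obtain ⟨δ, hδ, hb⟩ := Metric.eventually_nhds_iff_ball.1 h
  have hd : ∀ s ∈ Metric.ball t δ, HasDerivAt (fun s => ∫ x in t..s, ρ x) (ρ s) s := by
    intro s hs
    have hsub : Set.uIcc t s ⊆ Metric.ball t δ :=
      (convex_ball t δ).ordConnected.uIcc_subset (Metric.mem_ball_self hδ) hs
    have hc : ContinuousOn ρ (Metric.ball t δ) := fun x hx =>
      (hb x hx).continuousAt.continuousWithinAt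
    refine intervalIntegral.integral_hasDerivAt_right (hc.mono hsub).intervalIntegrable ?_
      (hb s hs).continuousAt
    exact hc.stronglyMeasurableAtFilter Metric.isOpen_ball s hs
  refine ⟨fun s => ∫ x in t..s, ρ x, ?_⟩
  have hC : ContDiffOn ℝ ∞ (fun s => ∫ x in t..s, ρ x) (Metric.ball t δ) := by
    rw [contDiffOn_infty_iff_deriv_of_isOpen Metric.isOpen_ball]
    refine ⟨fun s hs => (hd s hs).differentiableAt.differentiableWithinAt, ?_⟩
    exact ContDiffOn.congr (f := ρ) (fun s hs => (hb s hs).contDiffWithinAt)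
      (fun s hs => (hd s hs).deriv)
  filter_upwards [Metric.ball_mem_nhds t hδ] with s hs
  exact ⟨hC.contDiffAt (Metric.isOpen_ball.mem_nhds hs), (hd s hs).deriv⟩

/-- The Schwarzian derivative of the curve `γ` is invariant, up to conjugation, under local
changes of parameter that move points near the origin to the origin. -/
def SchwHomogeneous (γ : ℝ → ℂ) : Prop :=
  ∀ᶠ t in 𝓝 (0 : ℝ), ∃ r : ℝ → ℝ, Reg r t ∧ r t = 0 ∧
    ((∀ᶠ s in 𝓝 t, schw γ s = schw γ (r s) * ((deriv r s : ℝ) : ℂ) ^ 2 + ((schw r s : ℝ) : ℂ)) ∨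
      (∀ᶠ s in 𝓝 t,
        conj (schw γ s) = schw γ (r s) * ((deriv r s : ℝ) : ℂ) ^ 2 + ((schw r s : ℝ) : ℂ)))

/-- The absolute value absorbs the sign that conjugation introduces in the imaginary part; the real
part is unaffected by conjugation. -/
theorem SchwHomogeneous.re_im {γ : ℝ → ℂ} (h : SchwHomogeneous γ) :
    ∀ᶠ t in 𝓝 (0 : ℝ), ∃ r : ℝ → ℝ, Reg r t ∧ r t = 0 ∧
      (∀ᶠ s in 𝓝 t, |(schw γ s).im| = |(schw γ (r s)).im| * deriv r s ^ 2) ∧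
      (schw γ t).re = (schw γ 0).re * deriv r t ^ 2 + schw r t := by
  have key : ∀ z w : ℂ, ∀ x y : ℝ, z = w * ((x : ℝ) : ℂ) ^ 2 + ((y : ℝ) : ℂ) →
      z.im = w.im * x ^ 2 ∧ z.re = w.re * x ^ 2 + y := by
    rintro z w x y rfl
    rw [← ofReal_pow]
    simp [-ofReal_pow]
  filter_upwards [h] with t ⟨r, hr, h0, h1⟩
  refine ⟨r, hr, h0, ?_, ?_⟩
  · rcases h1 with h1 | h1
    · filter_upwards [h1] with s hs
      rw [(key _ _ _ _ hs).1, abs_mul, abs_of_nonneg (sq_nonneg (deriv r s))]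
    · filter_upwards [h1] with s hs
      have := (key _ _ _ _ hs).1
      rw [conj_im] at this
      rw [← abs_neg, this, abs_mul, abs_of_nonneg (sq_nonneg (deriv r s))]
  · rcases h1 with h1 | h1
    · have := (key _ _ _ _ h1.self_of_nhds).2
      rwa [h0] at this
    · have := (key _ _ _ _ h1.self_of_nhds).2
      rwa [h0, conj_re] at this

/-- When Im S is nonzero, σ plays the role of conformal arc length and κ of the constant conformal
curvature. Then S(γ) = (κ + εi)σ'² + S(σ), which is the Schwarzian of exp(cσ) if −c²/2 = κ + εi. -/
theorem SchwHomogeneous.classification {γ : ℝ → ℂ} (hγ : Reg γ 0) (h : SchwHomogeneous γ) :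
    (∀ᶠ s in 𝓝 (0 : ℝ), (schw γ s).im = 0) ∨
    ∃ (c : ℂ) (σ : ℝ → ℝ), c.re ≠ 0 ∧ c.im ≠ 0 ∧ Reg (fun s => exp (c * σ s)) 0 ∧
      ∀ᶠ s in 𝓝 (0 : ℝ), schw (fun s => exp (c * σ s)) s = schw γ s := by
  have h := h.re_im
  by_cases hm : (schw γ 0).im = 0
  · left
    filter_upwards [h] with t ⟨r, _, h0, h1, _⟩
    have := h1.self_of_nhds
    rwa [h0, hm, abs_zero, zero_mul, abs_eq_zero] at this
  right
  -- the sign of the imaginary part is constant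
  have hcont : ContinuousAt (fun s => (schw γ s).im) 0 :=
    continuous_im.continuousAt.comp hγ.contDiffAt_schw.continuousAt
  obtain ⟨ε, hε, hpos⟩ : ∃ ε : ℝ, ε ^ 2 = 1 ∧ ∀ᶠ s in 𝓝 (0 : ℝ), 0 < ε * (schw γ s).im := by
    rcases lt_or_gt_of_ne hm with hlt | hgt
    · refine ⟨-1, by norm_num, ?_⟩
      filter_upwards [hcont.eventually_lt_const hlt] with s hs
      linarith
    · refine ⟨1, by norm_num, ?_⟩
      filter_upwards [hcont.eventually_const_lt hgt] with s hs
      linarith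
  have hεabs : |ε| = 1 := by
    rcases sq_eq_one_iff.1 hε with rfl | rfl <;> norm_num
  have habs : ∀ᶠ s in 𝓝 (0 : ℝ), |(schw γ s).im| = ε * (schw γ s).im := by
    filter_upwards [hpos] with s hs
    rw [← abs_of_pos hs, abs_mul, hεabs, one_mul]
  let ρ : ℝ → ℝ := fun s => √(ε * (schw γ s).im)
  have hρ : ∀ᶠ s in 𝓝 (0 : ℝ), ContDiffAt ℝ ∞ ρ s := by
    filter_upwards [hpos, hγ.eventually] with s h1 h2
    exact (contDiffAt_const.mul (imCLM.contDiff.contDiffAt.comp s h2.contDiffAt_schw)).sqrt h1.ne'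
  have hρpos : ∀ᶠ s in 𝓝 (0 : ℝ), 0 < ρ s := hpos.mono fun s hs => Real.sqrt_pos.2 hs
  have hρsq : ∀ᶠ s in 𝓝 (0 : ℝ), ρ s ^ 2 = |(schw γ s).im| := by
    filter_upwards [hpos, habs] with s h1 h2
    rw [Real.sq_sqrt h1.le, h2]
  obtain ⟨σ, hσ⟩ := exists_antideriv hρ
  have hσreg : Reg σ 0 := by
    filter_upwards [hσ, hρpos] with s h1 h2
    exact ⟨h1.1, h1.2.trans_ne h2.ne'⟩
  have hq : ∀ᶠ t in 𝓝 (0 : ℝ), ((schw γ t).re - schw σ t) * ρ 0 ^ 2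
      = ((schw γ 0).re - schw σ 0) * ρ t ^ 2 := by
    filter_upwards [h, hρsq.eventually_nhds, hρpos.eventually_nhds, hσ.eventually_nhds] with
      t ⟨r, hr, h0, h1, h2⟩ ht1 ht2 ht3
    have hrt : Tendsto r (𝓝 t) (𝓝 0) := by
      have := hr.contDiffAt.continuousAt
      rwa [ContinuousAt, h0] at this
    have hsq : ∀ᶠ s in 𝓝 t, ρ s ^ 2 = (ρ (r s) * deriv r s) ^ 2 := by
      filter_upwards [h1, ht1, hrt.eventually hρsq] with s hs1 hs2 hs3
      rw [hs2, hs1, mul_pow, hs3]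
    obtain ⟨k, hk, hsign⟩ : ∃ k : ℝ, k ^ 2 = 1 ∧ ∀ᶠ s in 𝓝 t, 0 < k * deriv r s := by
      have hc := (contDiffAt_deriv hr.contDiffAt).continuousAt
      rcases lt_or_gt_of_ne hr.deriv_ne with hlt | hgt
      · refine ⟨-1, by norm_num, ?_⟩
        filter_upwards [hc.eventually_lt_const hlt] with s hs
        linarith
      · refine ⟨1, by norm_num, ?_⟩
        filter_upwards [hc.eventually_const_lt hgt] with s hs
        linarith
    have hk0 : k ≠ 0 := by rintro rfl; norm_num at hk
    -- The form ρ ds is preserved by r up to the sign k of r', so σ ∘ r differs from kσ by a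
    -- constant and has the same Schwarzian as σ. Subtracting this from the real part of the
    -- invariance relation gives the claim.
    have hdσ : ∀ᶠ s in 𝓝 t, deriv (fun s => σ (r s)) s = k * deriv σ s := by
      filter_upwards [hsq, hsign, hr.eventually, ht2, ht3, hrt.eventually hσ,
        hrt.eventually hρpos] with s e1 e2 e3 e4 e5 e6 e7
      have := (hasDerivAt_of_contDiffAt e6.1).comp s e3.hasDerivAt
      rw [e6.2] at this
      refine this.deriv.trans ?_
      rw [e5.2]
      have e8 : ρ s = k * (ρ (r s) * deriv r s) := by
        refine (sq_eq_sq₀ e4.le ?_).1 ?_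
        · nlinarith
        · rw [e1, mul_pow k, hk, one_mul]
      rw [e8, ← mul_assoc, ← pow_two, hk, one_mul]
    have e1 := schw_of_deriv_eventuallyEq_mul hk0 hdσ
    rw [Reg.schw_comp_real (by rwa [h0]) hr, h0] at e1
    have e2 := hsq.self_of_nhds
    rw [h0] at e2
    rw [e2, h2]
    linear_combination ρ 0 ^ 2 * e1
  have hρ0 : ρ 0 ≠ 0 := hρpos.self_of_nhds.ne'
  obtain ⟨κ, hκ⟩ : ∃ κ, κ = ((schw γ 0).re - schw σ 0) / ρ 0 ^ 2 := ⟨_, rfl⟩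
  have hε0 : ε ≠ 0 := by rintro rfl; norm_num at hε
  obtain ⟨c, hc⟩ := IsAlgClosed.exists_pow_nat_eq (-2 * (κ + ε * I) : ℂ) (n := 2) two_pos
  -- The imaginary part of c² is −2ε ≠ 0, so c is neither real nor imaginary: exp(cσ) runs along a
  -- genuine spiral.
  have hcim : c.re * c.im = -ε := by
    have := congrArg im hc
    rw [pow_two, mul_im] at this
    simp at this
    linarith
  have hcre : c.re ≠ 0 := fun h0 => hε0 (by rw [h0, zero_mul] at hcim; linarith)
  have hcim0 : c.im ≠ 0 := fun h0 => hε0 (by rw [h0, mul_zero] at hcim; linarith)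
  have hc0 : c ≠ 0 := fun h0 => hcre (by rw [h0, zero_re])
  have hcomp : ∀ s, Reg σ s → Reg (fun s => exp (c * σ s)) s ∧ schw (fun s => exp (c * σ s)) s
      = -c ^ 2 / 2 * ((deriv σ s : ℝ) : ℂ) ^ 2 + ((schw σ s : ℝ) : ℂ) := by
    intro s hs
    rw [← (reg_exp hc0 (σ s)).2]
    exact (reg_exp hc0 (σ s)).1.comp_real hs
  refine ⟨c, σ, hcre, hcim0, (hcomp 0 hσreg).1, ?_⟩
  filter_upwards [hq, hσreg.eventually, hσ, hpos] with s h1 h2 h3 h4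
  rw [(hcomp s h2).2, hc, h3.2]
  have e1 : (schw γ s).re = κ * ρ s ^ 2 + schw σ s := by
    rw [hκ]; field_simp; linear_combination h1
  have e2 : (schw γ s).im = ε * ρ s ^ 2 := by
    rw [Real.sq_sqrt h4.le, ← mul_assoc, ← pow_two, hε, one_mul]
  apply Complex.ext
  · rw [e1, ← ofReal_pow]; simp [-ofReal_pow]
  · rw [e2, ← ofReal_pow]; simp [-ofReal_pow]

/-! ### Sets homogeneous under the extended group of fractional linear transformations -/

/-- A fractional linear transformation, possibly preceded by complex conjugation. -/
def IsExtMob (h : OnePoint ℂ → OnePoint ℂ) : Prop :=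
  ∃ A : GL (Fin 2) ℂ, (∀ p, h p = A • p) ∨ (∀ p, h p = A • conjRS p)

/-- The stabilizer of a set in the extended group of fractional linear transformations is
transitive on it. -/
def ExtHomogeneous (T : Set (OnePoint ℂ)) : Prop :=
  ∀ x ∈ T, ∀ y ∈ T, ∃ h, IsExtMob h ∧ h x = y ∧ ∀ p, h p ∈ T ↔ p ∈ T

theorem conjRS_conjRS (p : OnePoint ℂ) : conjRS (conjRS p) = p := by
  induction p with
  | infty => rfl
  | coe z => simp

theorem continuous_conjRS : Continuous conjRS := by
  apply OnePoint.continuous_map continuous_conj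
  rw [coclosedCompact_eq_cocompact]
  exact conjCLE.toHomeomorph.isClosedEmbedding.tendsto_cocompact

theorem conjRS_smul (A : GL (Fin 2) ℂ) (p : OnePoint ℂ) :
    conjRS (A • p) = (A.map (starRingEnd ℂ)) • conjRS p :=
  OnePoint.map_smul (starRingEnd ℂ) A p

theorem IsExtMob.continuous {h : OnePoint ℂ → OnePoint ℂ} (hh : IsExtMob h) : Continuous h := by
  obtain ⟨A, hA | hA⟩ := hh
  · rw [funext hA]; exact continuous_gl_smul A
  · rw [funext hA]; exact (continuous_gl_smul A).comp continuous_conjRS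

theorem IsExtMob.conj_gl {h : OnePoint ℂ → OnePoint ℂ} (hh : IsExtMob h) (B : GL (Fin 2) ℂ) :
    IsExtMob fun p => B • h (B⁻¹ • p) := by
  obtain ⟨A, hA | hA⟩ := hh
  · exact ⟨B * A * B⁻¹, Or.inl fun p => by simp only [hA, mul_smul]⟩
  · refine ⟨B * A * (B⁻¹.map (starRingEnd ℂ)), Or.inr fun p => ?_⟩
    simp only [hA, mul_smul, conjRS_smul]

theorem extHomogeneous_mobImage {T : Set (OnePoint ℂ)} (hT : ExtHomogeneous T) (B : GL (Fin 2) ℂ) :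
    ExtHomogeneous (mobImage B T) := by
  rintro _ ⟨x, hx, rfl⟩ _ ⟨y, hy, rfl⟩
  obtain ⟨h, hh, hxy, hp⟩ := hT x hx y hy
  refine ⟨_, hh.conj_gl B, by simp only [inv_smul_smul, hxy], fun p => ?_⟩
  rw [smul_mem_mobImage, hp, mem_mobImage]

theorem IsHomogeneousCurve.extHomogeneous {T : Set (OnePoint ℂ)}
    (hC : IsHomogeneousCurve (fromRiemannSphere '' T)) : ExtHomogeneous T := by
  obtain ⟨-, H, hconf, hpres, htrans⟩ := hC
  intro x hx y hy
  obtain ⟨φ, hφ, hxy⟩ := htrans _ ⟨x, hx, rfl⟩ _ ⟨y, hy, rfl⟩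
  have key : ∀ h : OnePoint ℂ → OnePoint ℂ,
      (∀ p, φ (fromRiemannSphere p) = fromRiemannSphere (h p)) →
      h x = y ∧ ∀ p, h p ∈ T ↔ p ∈ T := by
    intro h hh
    refine ⟨fromRiemannSphere_bijective.1 ((hh x).symm.trans hxy), fun p => ?_⟩
    rw [← fromRiemannSphere_bijective.1.mem_set_image, ← hh]
    nth_rw 1 [← hpres φ hφ]
    rw [φ.injective.mem_set_image, fromRiemannSphere_bijective.1.mem_set_image]
  obtain ⟨A, hA | hA⟩ := (hconf φ hφ).exists_gl
  · exact ⟨_, ⟨A, Or.inl fun p => rfl⟩, key _ hA⟩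
  · exact ⟨_, ⟨A, Or.inr fun p => rfl⟩, key _ hA⟩

/-! ### Local parameterisations -/

theorem exists_local_inverse {x : ℝ → ℝ} {t : ℝ} (hx : Reg x t) :
    ∃ y : ℝ → ℝ, y (x t) = t ∧ (∀ᶠ s in 𝓝 (x t), ContDiffAt ℝ ∞ y s ∧ x (y s) = s) ∧
      ∀ᶠ s in 𝓝 t, y (x s) = s := by
  have hd : HasFDerivAt x (ContinuousLinearEquiv.unitsEquivAut ℝ (Units.mk0 _ hx.deriv_ne) : ℝ →L[ℝ] ℝ) t := by
    have := hx.hasDerivAt.hasFDerivAt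
    convert! this using 1
  let e := hx.contDiffAt.toOpenPartialHomeomorph x hd (by simp)
  have he : ∀ s, e s = x s := fun s => rfl
  have ht : t ∈ e.source := hx.contDiffAt.mem_toOpenPartialHomeomorph_source hd (by simp)
  have hxt : x t ∈ e.target := e.map_source ht
  have hyt : e.symm (x t) = t := e.left_inv ht
  have hcont : Tendsto e.symm (𝓝 (x t)) (𝓝 t) := by
    have := e.continuousAt_symm hxt
    rwa [ContinuousAt, hyt] at this
  refine ⟨e.symm, hyt, ?_, ?_⟩
  · filter_upwards [e.open_target.mem_nhds hxt, hcont.eventually hx] with s hs hr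
    refine ⟨?_, e.right_inv hs⟩
    exact e.contDiffAt_symm_deriv hr.2 hs (hasDerivAt_of_contDiffAt hr.1) hr.1
  · filter_upwards [e.open_source.mem_nhds ht] with s hs using e.left_inv hs

/-- Near 0 the curve is a graph over its tangent line. The functional ℓ is a linear coordinate along
that tangent, and γ is the curve parameterised by it; the last property says that near 0 every point
of T is on γ. -/
theorem exists_local_param {T : Set (OnePoint ℂ)} (hC : IsSmoothCurve (fromRiemannSphere '' T))
    (h0 : ((0 : ℂ) : OnePoint ℂ) ∈ T) :
    ∃ (γ : ℝ → ℂ) (ℓ : ℂ →L[ℝ] ℝ), γ 0 = 0 ∧ Reg γ 0 ∧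
      (∀ᶠ s in 𝓝 (0 : ℝ), (γ s : OnePoint ℂ) ∈ T) ∧
      ∀ᶠ z : ℂ in 𝓝 0, (z : OnePoint ℂ) ∈ T → γ (ℓ z) = z := by
  obtain ⟨U, α, hU, hxU, hα, hd, he, hr⟩ := hC.submanifold _ ⟨_, h0, rfl⟩
  obtain ⟨t₀, ht₀⟩ : fromRiemannSphere ((0 : ℂ) : OnePoint ℂ) ∈ Set.range α := by
    rw [← hr]; exact ⟨⟨_, h0, rfl⟩, hxU⟩
  let g : ℝ → ℂ := fun t => stereo (α t)
  have hg0 : g t₀ = 0 := by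
    change stereo (α t₀) = 0
    rw [ht₀]
    exact stereo_stereoInvAux 0
  have hne : ∀ᶠ t in 𝓝 t₀, α t ≠ northPole :=
    he.continuous.continuousAt.eventually_ne (by rw [ht₀]; exact fromRiemannSphere_coe_ne 0)
  have hαg : ∀ᶠ t in 𝓝 t₀, α t = fromRiemannSphere (g t : OnePoint ℂ) := by
    filter_upwards [hne] with t ht using Subtype.ext (stereoInvAux_stereo ht).symm
  have hgs : ∀ᶠ t in 𝓝 t₀, ContDiffAt ℝ ∞ g t := by
    filter_upwards [hne] with t ht
    exact (contDiffAt_stereo fun h => ht (eq_northPole_of h)).comp t (f := fun t => (α t : E3))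
      hα.contDiffAt
  have hu : deriv g t₀ ≠ 0 := by
    intro h
    apply hd t₀
    have h1 : HasDerivAt g 0 t₀ := by
      have := hasDerivAt_of_contDiffAt hgs.self_of_nhds
      rwa [h] at this
    have h2 := (contDiff_stereoInvAux.differentiable (by simp) (g t₀)).hasFDerivAt.comp_hasDerivAt
      t₀ h1
    rw [map_zero] at h2
    have e : (fun t => (α t : E3)) =ᶠ[𝓝 t₀] stereoInvAux ∘ g := by
      filter_upwards [hαg] with t ht using congrArg Subtype.val ht
    exact (h2.congr_of_eventuallyEq e).deriv
  -- The scaling by the inverse velocity makes ℓ ∘ g have derivative 1 at t₀.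
  let ℓ : ℂ →L[ℝ] ℝ := reCLM.comp (ContinuousLinearMap.mul ℝ ℂ (deriv g t₀)⁻¹)
  have hℓ : ∀ z, ℓ z = ((deriv g t₀)⁻¹ * z).re := fun z => rfl
  have hx : Reg (fun t => ℓ (g t)) t₀ := by
    apply reg_of_contDiffAt
    · filter_upwards [hgs] with t ht using ℓ.contDiff.contDiffAt.comp t ht
    · have := ℓ.hasFDerivAt.comp_hasDerivAt t₀ (hasDerivAt_of_contDiffAt hgs.self_of_nhds)
      have h1 : deriv (fun t => ℓ (g t)) t₀ = ℓ (deriv g t₀) := this.deriv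
      rw [h1, hℓ, inv_mul_cancel₀ hu]
      simp
  obtain ⟨y, hy0, hy, hyx⟩ := exists_local_inverse hx
  rw [hg0, map_zero] at hy0 hy
  have hyc : Tendsto y (𝓝 0) (𝓝 t₀) := by
    have := hy.self_of_nhds.1.continuousAt
    rwa [ContinuousAt, hy0] at this
  have hγs : ∀ᶠ s in 𝓝 (0 : ℝ), ContDiffAt ℝ ∞ (fun s => g (y s)) s := by
    filter_upwards [hyc.eventually hgs, hy] with s h1 h2 using h1.comp s h2.1
  refine ⟨fun s => g (y s), ℓ, by change g (y 0) = 0; rw [hy0, hg0], reg_of_contDiffAt hγs ?_, ?_, ?_⟩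
  · intro h
    have h1 := hasDerivAt_of_contDiffAt hγs.self_of_nhds
    rw [h] at h1
    have h2 := ℓ.hasFDerivAt.comp_hasDerivAt 0 h1
    rw [map_zero] at h2
    have h3 : (ℓ ∘ fun s => g (y s)) =ᶠ[𝓝 0] id := hy.mono fun s hs => hs.2
    exact zero_ne_one (h2.unique ((hasDerivAt_id 0).congr_of_eventuallyEq h3))
  · filter_upwards [hyc.eventually hαg] with s hs
    have h1 : α (y s) ∈ fromRiemannSphere '' T := by
      have : α (y s) ∈ Set.range α := ⟨_, rfl⟩
      rw [← hr] at this
      exact this.1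
    rwa [hs, fromRiemannSphere_bijective.1.mem_set_image] at h1
  · have hN := hyx.and hαg
    -- Here embeddedness matters: points of T close to 0 have parameters close to t₀.
    rw [he.isInducing.nhds_eq_comap, eventually_comap, ht₀] at hN
    have hcont : Tendsto (fun z : ℂ => fromRiemannSphere (z : OnePoint ℂ)) (𝓝 0)
        (𝓝 (fromRiemannSphere ((0 : ℂ) : OnePoint ℂ))) :=
      (continuous_fromRiemannSphere.comp OnePoint.continuous_coe).continuousAt
    filter_upwards [hcont.eventually hN, hcont.eventually (hU.mem_nhds hxU)] with z h1 h2 hz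
    obtain ⟨t, ht⟩ : fromRiemannSphere (z : OnePoint ℂ) ∈ Set.range α := by
      rw [← hr]; exact ⟨⟨_, hz, rfl⟩, h2⟩
    obtain ⟨h3, h4⟩ := h1 t ht
    have h5 : g t = z := OnePoint.coe_injective
      (fromRiemannSphere_bijective.1 (h4.symm.trans ht))
    rw [h5] at h3
    rw [h3, h5]

/-- A regular curve in T through 0 is γ ∘ r with r = ℓ ∘ F, which is smooth because ℓ is linear and
regular because F is. -/
theorem schw_eq_of_local_param {T : Set (OnePoint ℂ)} {γ : ℝ → ℂ} {ℓ : ℂ →L[ℝ] ℝ}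
    (hγ : Reg γ 0) (hpar : ∀ᶠ z : ℂ in 𝓝 0, (z : OnePoint ℂ) ∈ T → γ (ℓ z) = z)
    {F : ℝ → ℂ} {t : ℝ} (hF : Reg F t) (hF0 : F t = 0)
    (hFT : ∀ᶠ s in 𝓝 t, (F s : OnePoint ℂ) ∈ T) :
    ∃ r : ℝ → ℝ, Reg r t ∧ r t = 0 ∧ ∀ᶠ s in 𝓝 t,
      schw F s = schw γ (r s) * ((deriv r s : ℝ) : ℂ) ^ 2 + ((schw r s : ℝ) : ℂ) := by
  have hFc : Tendsto F (𝓝 t) (𝓝 0) := by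
    have := hF.contDiffAt.continuousAt
    rwa [ContinuousAt, hF0] at this
  have hFr : ∀ᶠ s in 𝓝 t, F s = γ (ℓ (F s)) := by
    filter_upwards [hFT, hFc.eventually hpar] with s h1 h2 using (h2 h1).symm
  have hrs : ∀ᶠ s in 𝓝 t, ContDiffAt ℝ ∞ (fun s => ℓ (F s)) s := by
    filter_upwards [hF] with s hs using ℓ.contDiff.contDiffAt.comp s hs.1
  have hr0 : ℓ (F t) = 0 := by rw [hF0, map_zero]
  have hr : Reg (fun s => ℓ (F s)) t := by
    apply reg_of_contDiffAt hrs
    intro h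
    apply hF.deriv_ne
    have h1 := hasDerivAt_of_contDiffAt hrs.self_of_nhds
    rw [h] at h1
    have h2 : HasDerivAt γ (deriv γ 0) (ℓ (F t)) := by rw [hr0]; exact hγ.hasDerivAt
    have h3 := h2.scomp t h1
    rw [zero_smul] at h3
    exact (h3.congr_of_eventuallyEq hFr).deriv
  refine ⟨fun s => ℓ (F s), hr, hr0, ?_⟩
  have hrc : Tendsto (fun s => ℓ (F s)) (𝓝 t) (𝓝 0) := by
    have := hr.contDiffAt.continuousAt
    rwa [ContinuousAt, hr0] at this
  filter_upwards [hFr.eventually_nhds, hr.eventually, hrc.eventually hγ.eventually] with s h1 h2 h3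
  rw [← (h3.comp_real h2).2]
  exact schw_congr h1

/-- A symmetry of T carrying γ(t) to 0 maps γ near t to another curve in T through 0, which is a
reparameterisation of γ. Its Schwarzian is that of γ or the conjugate. -/
theorem schwHomogeneous_of_extHomogeneous {T : Set (OnePoint ℂ)} (hT : ExtHomogeneous T)
    (h0 : ((0 : ℂ) : OnePoint ℂ) ∈ T) {γ : ℝ → ℂ} {ℓ : ℂ →L[ℝ] ℝ} (hγ : Reg γ 0)
    (hγT : ∀ᶠ s in 𝓝 (0 : ℝ), (γ s : OnePoint ℂ) ∈ T)
    (hpar : ∀ᶠ z : ℂ in 𝓝 0, (z : OnePoint ℂ) ∈ T → γ (ℓ z) = z) : SchwHomogeneous γ := by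
  filter_upwards [hγ.eventually, hγT.eventually_nhds] with t ht htT
  obtain ⟨h, ⟨A, hA⟩, hh0, hhT⟩ := hT _ htT.self_of_nhds _ h0
  have key : ∀ f : ℝ → ℂ, Reg f t → (∀ s, h (γ s : OnePoint ℂ) = A • (f s : OnePoint ℂ)) →
      ∃ F : ℝ → ℂ, (∀ᶠ s in 𝓝 t, schw F s = schw f s) ∧ ∃ r : ℝ → ℝ, Reg r t ∧ r t = 0 ∧
      ∀ᶠ s in 𝓝 t,
        schw F s = schw γ (r s) * ((deriv r s : ℝ) : ℂ) ^ 2 + ((schw r s : ℝ) : ℂ) := by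
    intro f hf hhf
    have h1 : A • (f t : OnePoint ℂ) = ((0 : ℂ) : OnePoint ℂ) := by rw [← hhf, hh0]
    obtain ⟨F, hF, hAF, hSF⟩ := hf.smul A (by rw [h1]; exact OnePoint.coe_ne_infty _)
    refine ⟨F, hSF, schw_eq_of_local_param hγ hpar hF
      (OnePoint.coe_injective (hAF.self_of_nhds.symm.trans h1)) ?_⟩
    filter_upwards [hAF, htT] with s h2 h3
    rwa [← h2, ← hhf, hhT]
  rcases hA with hA | hA
  · obtain ⟨F, hS, r, hr, hr0, hSr⟩ := key γ ht fun s => hA _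
    refine ⟨r, hr, hr0, Or.inl ?_⟩
    filter_upwards [hS, hSr] with s h1 h2
    rw [← h1, h2]
  · obtain ⟨F, hS, r, hr, hr0, hSr⟩ := key _ ht.conj_comp fun s => hA _
    refine ⟨r, hr, hr0, Or.inr ?_⟩
    filter_upwards [hS, hSr] with s h1 h2
    rw [← schw_conj_comp, ← h1, h2]

/-- A homogeneous smooth curve is, near one of its points, contained in a circle or in a
loxodrome. -/
theorem locally_subset_of_extHomogeneous {T : Set (OnePoint ℂ)} (hT : ExtHomogeneous T)
    (hC : IsSmoothCurve (fromRiemannSphere '' T)) :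
    ∃ p ∈ T, ∃ U : Set (OnePoint ℂ), IsOpen U ∧ p ∈ U ∧ ∃ A : GL (Fin 2) ℂ,
      (T ∩ U ⊆ mobImage A extReal ∨ ∃ β : ℝ, β ≠ 0 ∧ T ∩ U ⊆ mobImage A (logSpiral β)) := by
  suffices key : ∀ T : Set (OnePoint ℂ), ExtHomogeneous T →
      IsSmoothCurve (fromRiemannSphere '' T) → ((0 : ℂ) : OnePoint ℂ) ∈ T →
      ∃ U : Set (OnePoint ℂ), IsOpen U ∧ ((0 : ℂ) : OnePoint ℂ) ∈ U ∧ ∃ A : GL (Fin 2) ℂ,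
      (T ∩ U ⊆ mobImage A extReal ∨ ∃ β : ℝ, β ≠ 0 ∧ T ∩ U ⊆ mobImage A (logSpiral β)) by
    obtain ⟨_, p, hp, -⟩ := hC.connected.nonempty
    obtain ⟨B, hB⟩ := exists_smul_eq_zero p
    obtain ⟨U, hU, h0, A, hA⟩ := key _ (extHomogeneous_mobImage hT B) (hC.mobImage B) ⟨p, hp, hB⟩
    have htr : ∀ M, mobImage B T ∩ U ⊆ mobImage A M →
        T ∩ (fun p => B • p) ⁻¹' U ⊆ mobImage (B⁻¹ * A) M := by
      rintro M hM q ⟨hq, hqU⟩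
      have := hM ⟨⟨q, hq, rfl⟩, hqU⟩
      rwa [mobImage_mul, mem_mobImage, inv_inv]
    refine ⟨p, hp, (fun p => B • p) ⁻¹' U, hU.preimage (continuous_gl_smul B),
      by rwa [Set.mem_preimage, hB], B⁻¹ * A, hA.imp (htr _) ?_⟩
    rintro ⟨β, hβ, h⟩
    exact ⟨β, hβ, htr _ h⟩
  clear hT hC T
  intro T hT hC h0
  obtain ⟨γ, ℓ, hγ0, hγ, hγT, hpar⟩ := exists_local_param hC h0
  have hS := schwHomogeneous_of_extHomogeneous hT h0 hγ hγT hpar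
  have hℓ : Tendsto ℓ (𝓝 0) (𝓝 0) := by
    have := ℓ.continuous.tendsto 0
    rwa [map_zero] at this
  have hloc : ∀ M : Set (OnePoint ℂ), (∀ᶠ s in 𝓝 (0 : ℝ), (γ s : OnePoint ℂ) ∈ M) →
      ∃ U : Set (OnePoint ℂ), IsOpen U ∧ ((0 : ℂ) : OnePoint ℂ) ∈ U ∧ T ∩ U ⊆ M := by
    intro M hM
    have h1 : ∀ᶠ z : ℂ in 𝓝 0, (z : OnePoint ℂ) ∈ T → (z : OnePoint ℂ) ∈ M := by
      filter_upwards [hpar, hℓ.eventually hM] with z h1 h2 hz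
      rwa [h1 hz] at h2
    obtain ⟨V, hV, hVo, hV0⟩ := eventually_nhds_iff.1 h1
    refine ⟨_, OnePoint.isOpen_image_coe.2 hVo, ⟨0, hV0, rfl⟩, ?_⟩
    rintro _ ⟨hz, z, hzV, rfl⟩
    exact hV z hzV hz
  rcases hS.classification hγ with him | ⟨c, σ, hcr, hci, hreg, hschw⟩
  · obtain ⟨A, hA⟩ := exists_gl_real_of_schw_im_eq_zero hγ him
    obtain ⟨U, hU, hU0, hsub⟩ := hloc (mobImage A⁻¹ extReal) (by
      filter_upwards [hA] with s ⟨x, hx⟩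
      rw [mem_mobImage, inv_inv, hx, coe_mem_extReal, ofReal_im])
    exact ⟨U, hU, hU0, A⁻¹, Or.inl hsub⟩
  · obtain ⟨A, hA⟩ := exists_gl_of_schw_eq hreg hγ hschw
    -- The bearing is the ratio of real to imaginary part of c, because cσ = (β + i) · (Im c) σ.
    obtain ⟨U, hU, hU0, hsub⟩ := hloc (mobImage A (logSpiral (c.re / c.im))) (by
      filter_upwards [hA] with s hs
      rw [← hs, smul_mem_mobImage]
      refine ⟨c.im * σ s, ?_⟩
      rw [OnePoint.coe_eq_coe]
      congr 1
      have hci' : (c.im : ℂ) ≠ 0 := by simpa using hci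
      push_cast
      rw [← mul_assoc]
      congr 1
      rw [add_mul, div_mul_cancel₀ _ hci', mul_comm I, re_add_im])
    exact ⟨U, hU, hU0, A, Or.inr ⟨_, div_ne_zero hcr hci, hsub⟩⟩

/-! ### From local to global -/

theorem IsSmoothCurve.exists_arc {T : Set (OnePoint ℂ)} (hC : IsSmoothCurve (fromRiemannSphere '' T))
    {q : OnePoint ℂ} (hq : q ∈ T) {W : Set (OnePoint ℂ)} (hW : IsOpen W) (hqW : q ∈ W) :
    ∃ γ : ℝ → OnePoint ℂ, Continuous γ ∧ Function.Injective γ ∧ ∀ t, γ t ∈ T ∩ W := by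
  obtain ⟨U, α, hU, hxU, -, -, he, hr⟩ := hC.submanifold _ ⟨_, hq, rfl⟩
  obtain ⟨t₀, ht₀⟩ : fromRiemannSphere q ∈ Set.range α := by
    rw [← hr]; exact ⟨⟨_, hq, rfl⟩, hxU⟩
  have hg : Continuous fun t => sphereHomeo.symm (α t) :=
    sphereHomeo.symm.continuous.comp he.continuous
  obtain ⟨ε, hε, hball⟩ := Metric.isOpen_iff.1 (hW.preimage hg) t₀ (by
    rwa [Set.mem_preimage, ht₀, sphereHomeo_symm_fromRiemannSphere])
  -- The arctangent squeezes the line into the parameter ball of radius ε about t₀, using |arctan| <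
  -- 2.
  have harc : Continuous fun s : ℝ => t₀ + ε / 2 * Real.arctan s := by fun_prop
  refine ⟨fun s => sphereHomeo.symm (α (t₀ + ε / 2 * Real.arctan s)), hg.comp harc, ?_,
    fun s => ⟨?_, hball ?_⟩⟩
  · intro s s' h
    have h1 := add_left_cancel (he.injective (sphereHomeo.symm.injective h))
    exact Real.arctan_injective (mul_left_cancel₀ (by positivity) h1)
  · have h1 : α (t₀ + ε / 2 * Real.arctan s) ∈ fromRiemannSphere '' T := by
      have : α (t₀ + ε / 2 * Real.arctan s) ∈ Set.range α := ⟨_, rfl⟩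
      rw [← hr] at this
      exact this.1
    obtain ⟨p, hp, hpe⟩ := h1
    change sphereHomeo.symm (α (t₀ + ε / 2 * Real.arctan s)) ∈ T
    rwa [← hpe, sphereHomeo_symm_fromRiemannSphere]
  · rw [Metric.mem_ball, Real.dist_eq, add_sub_cancel_left, abs_mul, abs_of_pos (half_pos hε)]
    have h1 : |Real.arctan s| < 2 := by
      have := Real.pi_lt_four
      rw [abs_lt]
      constructor <;> linarith [Real.neg_pi_div_two_lt_arctan s, Real.arctan_lt_pi_div_two s]
    nlinarith

/-- An extended fractional linear transformation which maps an arc of `M` into `M` preserves `M`. -/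
def IsRigid (M : Set (OnePoint ℂ)) : Prop :=
  ∀ h, IsExtMob h → ∀ γ : ℝ → OnePoint ℂ, Continuous γ → Function.Injective γ → (∀ t, γ t ∈ M) →
    (∀ t, h (γ t) ∈ M) → ∀ p, h p ∈ M ↔ p ∈ M

/-- A is the region where T is known to lie in M, and B the region where T avoids A. Rigidity shows
that A and B cover T; connectedness then makes B miss T. -/
theorem IsRigid.subset_of_locally_subset {T M U₀ : Set (OnePoint ℂ)} (hM : IsRigid M)
    (hT : ExtHomogeneous T) (hC : IsSmoothCurve (fromRiemannSphere '' T)) {p₀ : OnePoint ℂ}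
    (hp₀ : p₀ ∈ T) (hU₀ : IsOpen U₀) (hpU₀ : p₀ ∈ U₀) (hsub : T ∩ U₀ ⊆ M) : T ⊆ M := by
  have hconn : IsPreconnected T := by
    have := hC.connected.isPreconnected.image _ sphereHomeo.symm.continuous.continuousOn
    simpa only [Set.image_image, sphereHomeo_symm_fromRiemannSphere, Set.image_id'] using this
  let A : Set (OnePoint ℂ) := ⋃₀ {U | IsOpen U ∧ T ∩ U ⊆ M}
  let B : Set (OnePoint ℂ) := ⋃₀ {U | IsOpen U ∧ T ∩ U ∩ A = ∅}
  have hA : IsOpen A := isOpen_sUnion fun U hU => hU.1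
  have hB : IsOpen B := isOpen_sUnion fun U hU => hU.1
  have hAB : T ⊆ A ∪ B := by
    intro q hq
    by_contra hqAB
    rw [Set.mem_union, not_or] at hqAB
    obtain ⟨h, hh, hqp, hhT⟩ := hT q hq p₀ hp₀
    have hU : IsOpen (h ⁻¹' U₀) := hU₀.preimage hh.continuous
    have hqU : q ∈ h ⁻¹' U₀ := by rwa [Set.mem_preimage, hqp]
    have hUM : ∀ r ∈ T ∩ h ⁻¹' U₀, h r ∈ M := fun r hr => hsub ⟨(hhT r).2 hr.1, hr.2⟩
    -- A symmetry h from q to p₀ sends T near q into M. If T near q also meets A, some arc lies in M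
    -- and is mapped into M, so h preserves M and T near q lies in M.
    by_cases hne : T ∩ h ⁻¹' U₀ ∩ A = ∅
    · exact hqAB.2 ⟨_, ⟨hU, hne⟩, hqU⟩
    · obtain ⟨r, ⟨hrT, hrU⟩, V, ⟨hV, hVM⟩, hrV⟩ := Set.nonempty_iff_ne_empty.2 hne
      obtain ⟨γ, hγ, hγi, hγT⟩ := hC.exists_arc hrT (hU.inter hV) ⟨hrU, hrV⟩
      have := hM h hh γ hγ hγi (fun t => hVM ⟨(hγT t).1, (hγT t).2.2⟩)
        (fun t => hUM _ ⟨(hγT t).1, (hγT t).2.1⟩)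
      exact hqAB.1 ⟨_, ⟨hU, fun r hr => (this r).1 (hUM r hr)⟩, hqU⟩
  have hTB : ¬ (T ∩ B).Nonempty := fun hTB => by
    obtain ⟨r, hr, hrA, U, ⟨-, hU⟩, hrU⟩ :=
      hconn A B hA hB hAB ⟨p₀, hp₀, U₀, ⟨hU₀, hsub⟩, hpU₀⟩ hTB
    exact Set.notMem_empty r (hU ▸ ⟨⟨hr, hrU⟩, hrA⟩)
  intro q hq
  rcases hAB hq with ⟨U, ⟨-, hU⟩, hqU⟩ | hqB
  · exact hU ⟨hq, hqU⟩
  · exact absurd ⟨q, hq, hqB⟩ hTB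

/-- The preimage of M is again a circle, and two circles with infinitely many common points
coincide. -/
theorem IsCirc.isRigid {M : Set (OnePoint ℂ)} (hM : IsCirc M) : IsRigid M := by
  intro h hh γ _ hγi hγM hγh
  have hc : IsCirc (h ⁻¹' M) := by
    obtain ⟨A, hA | hA⟩ := hh
    · have : h ⁻¹' M = ConfLox.mobImage A⁻¹ M := by
        ext p; rw [Set.mem_preimage, hA, mem_mobImage, inv_inv]
      rw [this]; exact hM.mobImage _
    · have : h ⁻¹' M = conjRS ⁻¹' ConfLox.mobImage A⁻¹ M := by
        ext p; rw [Set.mem_preimage, hA, Set.mem_preimage, mem_mobImage, inv_inv]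
      rw [this]; exact (hM.mobImage _).conjRS_preimage
  have := hc.eq_of_infinite_inter hM ((Set.infinite_range_of_injective hγi).mono
    (Set.range_subset_iff.2 fun t => ⟨hγh t, hγM t⟩))
  exact fun p => Set.ext_iff.1 this p

theorem IsExtMob.injective {h : OnePoint ℂ → OnePoint ℂ} (hh : IsExtMob h) :
    Function.Injective h := by
  obtain ⟨A, hA | hA⟩ := hh
  · rw [funext hA]; exact MulAction.injective A
  · rw [funext hA]
    exact (MulAction.injective A).comp (Function.LeftInverse.injective conjRS_conjRS)

theorem exists_lift_logSpiral {β : ℝ} (hβ : β ≠ 0) {γ : ℝ → OnePoint ℂ} (hγ : Continuous γ)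
    (hγi : Function.Injective γ) (hγM : ∀ t, γ t ∈ logSpiral β) :
    ∃ θ : ℝ → ℝ, Continuous θ ∧ Function.Injective θ ∧ ∀ t, γ t = (spiral β (θ t) : OnePoint ℂ) := by
  choose θ hθ using fun t => mem_logSpiral.1 (hγM t)
  have he : IsEmbedding fun η => (spiral β η : OnePoint ℂ) :=
    OnePoint.isOpenEmbedding_coe.isEmbedding.comp (isEmbedding_spiral hβ)
  have hc : (fun η => (spiral β η : OnePoint ℂ)) ∘ θ = γ := funext hθ
  refine ⟨θ, he.continuous_iff.2 (hc ▸ hγ), ?_, fun t => (hθ t).symm⟩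
  exact Function.Injective.of_comp (hc ▸ hγi)

theorem eventually_spiral_mem_range {β : ℝ} (hβ : β ≠ 0) {γ : ℝ → OnePoint ℂ} (hγ : Continuous γ)
    (hγi : Function.Injective γ) (hγM : ∀ t, γ t ∈ logSpiral β) :
    ∃ θ₀, ∀ᶠ η in 𝓝 θ₀, (spiral β η : OnePoint ℂ) ∈ Set.range γ := by
  obtain ⟨θ, hθ, hθi, hγθ⟩ := exists_lift_logSpiral hβ hγ hγi hγM
  have hne : θ 0 ≠ θ 1 := fun h => zero_ne_one (hθi h)
  refine ⟨(θ 0 + θ 1) / 2, ?_⟩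
  have hmem : Set.uIcc (θ 0) (θ 1) ∈ 𝓝 ((θ 0 + θ 1) / 2) := by
    rcases lt_or_gt_of_ne hne with h | h
    · rw [Set.uIcc_of_lt h]; exact Icc_mem_nhds (by linarith) (by linarith)
    · rw [Set.uIcc_of_gt h]; exact Icc_mem_nhds (by linarith) (by linarith)
  filter_upwards [hmem] with η hη
  obtain ⟨t, -, ht⟩ := intermediate_value_uIcc hθ.continuousOn hη
  exact ⟨t, by rw [hγθ, ht]⟩

/-- If conjugation were involved, rigidity applied to the spiral of bearing −β would give β = −β,
which is excluded. -/
theorem IsExtMob.spiral_rigidity {h : OnePoint ℂ → OnePoint ℂ} (hh : IsExtMob h) {β : ℝ}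
    (hβ : β ≠ 0) {γ : ℝ → OnePoint ℂ} (hγ : Continuous γ) (hγi : Function.Injective γ)
    (hγM : ∀ t, γ t ∈ logSpiral β) (hγh : ∀ t, h (γ t) ∈ logSpiral β) :
    ∃ ε k : ℝ, (ε = 1 ∨ ε = -1) ∧
      ∀ θ, h (spiral β θ : OnePoint ℂ) = (spiral β (ε * θ + k) : OnePoint ℂ) := by
  obtain ⟨θ₀, hθ₀⟩ := eventually_spiral_mem_range hβ hγ hγi hγM
  have hev : ∀ᶠ η in 𝓝 θ₀, h (spiral β η : OnePoint ℂ) ∈ logSpiral β := by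
    filter_upwards [hθ₀] with η ⟨t, ht⟩
    rw [← ht]; exact hγh t
  obtain ⟨A, hA | hA⟩ := hh
  · obtain ⟨-, ε, k, hε, hk⟩ := ConfLox.spiral_rigidity (A := A) hβ hβ
      (hev.mono fun η hη => by rwa [← hA])
    exact ⟨ε, k, hε, fun θ => by rw [hA, hk]⟩
  · have hneg : Tendsto (fun η : ℝ => -η) (𝓝 (-θ₀)) (𝓝 θ₀) := by
      have := (continuous_neg (G := ℝ)).tendsto (-θ₀)
      rwa [neg_neg] at this
    have := (ConfLox.spiral_rigidity (A := A) (neg_ne_zero.2 hβ) hβ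
      ((hneg.eventually hev).mono fun η hη => by
        rwa [hA, conjRS_coe, conj_spiral, neg_neg] at hη)).1
    exact absurd (by linarith) hβ

theorem isRigid_logSpiral {β : ℝ} (hβ : β ≠ 0) : IsRigid (logSpiral β) := by
  intro h hh γ hγ hγi hγM hγh p
  obtain ⟨ε, k, hε, hk⟩ := hh.spiral_rigidity hβ hγ hγi hγM hγh
  constructor
  · intro hp
    obtain ⟨η, hη⟩ := mem_logSpiral.1 hp
    refine mem_logSpiral.2 ⟨ε * (η - k), hh.injective ?_⟩
    rw [hk, ← hη]
    rcases hε with rfl | rfl <;> ring_nf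
  · intro hp
    obtain ⟨η, rfl⟩ := mem_logSpiral.1 hp
    exact mem_logSpiral.2 ⟨_, (hk η).symm⟩

/-- Symmetries of T act on the spiral parameter by θ ↦ ±θ + k, which are isometries. One parameter
ball of radius δ inside J is thus copied around every point of J, and the uniform radius makes J
closed as well as open. -/
theorem eq_logSpiral_of_subset {T : Set (OnePoint ℂ)} {β : ℝ} (hβ : β ≠ 0)
    (hT : ExtHomogeneous T) (hC : IsSmoothCurve (fromRiemannSphere '' T))
    (hsub : T ⊆ logSpiral β) : T = logSpiral β := by
  obtain ⟨_, q, hq, -⟩ := hC.connected.nonempty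
  obtain ⟨γ, hγ, hγi, hγT⟩ := hC.exists_arc hq isOpen_univ trivial
  have hγM := fun t => hsub (hγT t).1
  obtain ⟨θ₀, hθ₀⟩ := eventually_spiral_mem_range hβ hγ hγi hγM
  let J : Set ℝ := {θ | (spiral β θ : OnePoint ℂ) ∈ T}
  have hJ : ∀ᶠ η in 𝓝 θ₀, η ∈ J := by
    filter_upwards [hθ₀] with η ⟨t, ht⟩
    change (spiral β η : OnePoint ℂ) ∈ T
    rw [← ht]; exact (hγT t).1
  obtain ⟨δ, hδ, hball⟩ := Metric.eventually_nhds_iff.1 hJ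
  have hall : ∀ θ₁ ∈ J, ∀ η, dist η θ₁ < δ → η ∈ J := by
    intro θ₁ hθ₁ η hη
    obtain ⟨h, hh, h01, hhT⟩ := hT _ hJ.self_of_nhds _ hθ₁
    obtain ⟨ε, k, hε, hk⟩ := hh.spiral_rigidity hβ hγ hγi hγM fun t => hsub ((hhT _).2 (hγT t).1)
    have h1 : ε * θ₀ + k = θ₁ :=
      spiral_injective hβ (OnePoint.coe_injective (by rw [← hk, h01]))
    have hεε : ε * ε = 1 := by rcases hε with rfl | rfl <;> norm_num
    have habs : |ε| = 1 := by rcases hε with rfl | rfl <;> norm_num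
    have h2 : ε * (η - k) ∈ J := by
      apply hball
      have : ε * (η - k) - θ₀ = ε * (η - θ₁) := by rw [← h1]; linear_combination θ₀ * hεε
      rwa [Real.dist_eq, this, abs_mul, habs, one_mul]
    have h3 := (hhT _).2 h2
    rw [hk] at h3
    have h4 : ε * (ε * (η - k)) + k = η := by linear_combination (η - k) * hεε
    rwa [h4] at h3
  have hclopen : IsClopen J := by
    refine ⟨closure_subset_iff_isClosed.1 fun θ hθ => ?_, Metric.isOpen_iff.2 fun θ hθ =>
      ⟨δ, hδ, fun η hη => hall θ hθ η hη⟩⟩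
    obtain ⟨θ₁, h1, h2⟩ := Metric.mem_closure_iff.1 hθ δ hδ
    exact hall θ₁ h1 θ h2
  have huniv := hclopen.eq_univ ⟨θ₀, hJ.self_of_nhds⟩
  refine hsub.antisymm fun p hp => ?_
  obtain ⟨η, rfl⟩ := mem_logSpiral.1 hp
  have : η ∈ J := huniv ▸ trivial
  exact this

theorem image_preimage_fromRiemannSphere (C : Set S2) :
    fromRiemannSphere '' (fromRiemannSphere ⁻¹' C) = C :=
  Set.image_preimage_eq C fromRiemannSphere_bijective.2

theorem isLoxodrome_iff {β : ℝ} {L : Set S2} :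
    IsLoxodrome β L ↔ ∃ A, L = fromRiemannSphere '' mobImage A (logSpiral β) := by
  simp only [IsLoxodrome, mobImage, Set.image_image]

theorem IsHomogeneousCurve.classification {C : Set S2} (h : IsHomogeneousCurve C) :
    (∃ K, IsRoundCircle K ∧ C ⊆ K) ∨ ∃ β, β ≠ 0 ∧ IsLoxodrome β C := by
  obtain ⟨T, rfl⟩ : ∃ T, fromRiemannSphere '' T = C := ⟨_, image_preimage_fromRiemannSphere C⟩
  have hT := h.extHomogeneous
  obtain ⟨p, hp, U, hU, hpU, A, hA | ⟨β, hβ, hA⟩⟩ := locally_subset_of_extHomogeneous hT h.1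
  · have hc : IsCirc (mobImage A extReal) := ⟨A, rfl⟩
    exact Or.inl ⟨_, isRoundCircle_iff.2 ⟨_, hc, rfl⟩,
      Set.image_mono (hc.isRigid.subset_of_locally_subset hT h.1 hp hU hpU hA)⟩
  · refine Or.inr ⟨β, hβ, isLoxodrome_iff.2 ⟨A, ?_⟩⟩
    have hT' := extHomogeneous_mobImage hT A⁻¹
    have hC' := h.1.mobImage A⁻¹
    have hsub := (isRigid_logSpiral hβ).subset_of_locally_subset hT' hC'
      (p₀ := A⁻¹ • p) (U₀ := (fun q => A • q) ⁻¹' U) ⟨p, hp, rfl⟩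
      (hU.preimage (continuous_gl_smul A)) (by rwa [Set.mem_preimage, smul_inv_smul]) (by
        rintro q ⟨hq, hqU⟩
        rw [mem_mobImage, inv_inv] at hq
        have := hA ⟨hq, hqU⟩
        rwa [smul_mem_mobImage] at this)
    rw [← eq_logSpiral_of_subset hβ hT' hC' hsub, mobImage_mobImage_inv]

/-! ### Circles, loxodromes and inclusions between them -/

/-- The spiral meets the real axis at every θ = nπ, so a circle containing it would have to be the
real axis; but at θ = π/2 the spiral leaves the axis. -/
theorem IsCirc.not_logSpiral_subset {S : Set (OnePoint ℂ)} (hS : IsCirc S) {β : ℝ} (hβ : β ≠ 0) :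
    ¬ logSpiral β ⊆ S := by
  intro h
  have hmem : ∀ n : ℕ, (spiral β (n * Real.pi) : OnePoint ℂ) ∈ extReal ∩ S := by
    refine fun n => ⟨?_, h (mem_logSpiral.2 ⟨_, rfl⟩)⟩
    rw [coe_mem_extReal, spiral, exp_im]
    have : ((β + I) * ((n * Real.pi : ℝ) : ℂ)).im = n * Real.pi := by simp
    rw [this, Real.sin_nat_mul_pi, mul_zero]
  have hinj : Function.Injective fun n : ℕ => (spiral β (n * Real.pi) : OnePoint ℂ) := by
    intro n m hnm
    have := mul_right_cancel₀ Real.pi_ne_zero (spiral_injective hβ (OnePoint.coe_injective hnm))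
    exact_mod_cast this
  have heq : extReal = S := IsCirc.eq_of_infinite_inter ⟨1, by simp [ConfLox.mobImage]⟩ hS
    ((Set.infinite_range_of_injective hinj).mono (Set.range_subset_iff.2 hmem))
  have h1 : (spiral β (Real.pi / 2) : OnePoint ℂ) ∈ extReal :=
    heq ▸ h (mem_logSpiral.2 ⟨_, rfl⟩)
  rw [coe_mem_extReal, spiral, exp_im] at h1
  have : ((β + I) * ((Real.pi / 2 : ℝ) : ℂ)).im = Real.pi / 2 := by simp
  rw [this, Real.sin_pi_div_two, mul_one] at h1
  exact (Real.exp_pos _).ne' h1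

theorem IsRoundCircle.not_isLoxodrome_subset {K L : Set S2} (hK : IsRoundCircle K) {β : ℝ}
    (hβ : β ≠ 0) (hL : IsLoxodrome β L) : ¬ L ⊆ K := by
  obtain ⟨S, hS, rfl⟩ := isRoundCircle_iff.1 hK
  obtain ⟨A, rfl⟩ := isLoxodrome_iff.1 hL
  intro h
  refine (hS.mobImage A⁻¹).not_logSpiral_subset hβ ?_
  rw [← mobImage_inv_mobImage A (logSpiral β)]
  exact mobImage_mono ((Set.image_subset_image_iff fromRiemannSphere_bijective.1).1 h)

theorem isHomogeneousCurve_of_subset_isRoundCircle {C K : Set S2} (hC : IsSmoothCurve C)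
    (hK : IsRoundCircle K) (h : C ⊆ K) : IsHomogeneousCurve C := by
  obtain ⟨S, hS, rfl⟩ := isRoundCircle_iff.1 hK
  obtain ⟨T, rfl⟩ : ∃ T, fromRiemannSphere '' T = C := ⟨_, image_preimage_fromRiemannSphere C⟩
  exact (mobHomogeneous_of_subset_isCirc hS
    ((Set.image_subset_image_iff fromRiemannSphere_bijective.1).1 h) hC).isHomogeneousCurve hC

theorem IsRoundCircle.isHomogeneousCurve {K : Set S2} (hK : IsRoundCircle K) :
    IsHomogeneousCurve K := by
  refine isHomogeneousCurve_of_subset_isRoundCircle ?_ hK subset_rfl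
  obtain ⟨S, ⟨A, rfl⟩, rfl⟩ := isRoundCircle_iff.1 hK
  exact isSmoothCurve_extReal.mobImage A

theorem IsLoxodrome.isHomogeneousCurve {β : ℝ} (hβ : β ≠ 0) {L : Set S2} (hL : IsLoxodrome β L) :
    IsHomogeneousCurve L := by
  obtain ⟨A, rfl⟩ := isLoxodrome_iff.1 hL
  exact ((mobHomogeneous_logSpiral β).mobImage A).isHomogeneousCurve
    ((isSmoothCurve_logSpiral hβ).mobImage A)

theorem IsLoxodrome.eq_of_isHomogeneousCurve_subset {β : ℝ} (hβ : β ≠ 0) {C L : Set S2}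
    (hL : IsLoxodrome β L) (hC : IsHomogeneousCurve C) (h : C ⊆ L) : C = L := by
  obtain ⟨A, rfl⟩ := isLoxodrome_iff.1 hL
  obtain ⟨T, rfl⟩ : ∃ T, fromRiemannSphere '' T = C := ⟨_, image_preimage_fromRiemannSphere C⟩
  have hsub : mobImage A⁻¹ T ⊆ logSpiral β := by
    rw [← mobImage_inv_mobImage A (logSpiral β)]
    exact mobImage_mono ((Set.image_subset_image_iff fromRiemannSphere_bijective.1).1 h)
  rw [← eq_logSpiral_of_subset hβ (extHomogeneous_mobImage hC.extHomogeneous A⁻¹)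
    (hC.1.mobImage A⁻¹) hsub, mobImage_mobImage_inv]

theorem IsRoundCircle.eq_of_subset {K K' : Set S2} (hK : IsRoundCircle K) (hK' : IsRoundCircle K')
    (h : K ⊆ K') : K = K' := by
  obtain ⟨q, hq⟩ := hK.isHomogeneousCurve.1.connected.nonempty
  have hC := hK.isHomogeneousCurve.1
  obtain ⟨S, hS, rfl⟩ := isRoundCircle_iff.1 hK
  obtain ⟨S', hS', rfl⟩ := isRoundCircle_iff.1 hK'
  rw [Set.image_subset_image_iff fromRiemannSphere_bijective.1] at h
  obtain ⟨p, hp, -⟩ := hq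
  obtain ⟨γ, -, hγi, hγ⟩ := hC.exists_arc hp isOpen_univ trivial
  rw [hS.eq_of_infinite_inter hS' ((Set.infinite_range_of_injective hγi).mono
    (Set.range_subset_iff.2 fun t => ⟨(hγ t).1, h (hγ t).1⟩))]

/-- A larger homogeneous curve lies in a circle, which then equals K, or is a loxodrome, which
contains no homogeneous curve other than itself. -/
theorem IsRoundCircle.maximal {K : Set S2} (hK : IsRoundCircle K) :
    Maximal IsHomogeneousCurve K := by
  refine ⟨hK.isHomogeneousCurve, fun D hD hKD => ?_⟩
  rcases hD.classification with ⟨K', hK', hDK'⟩ | ⟨β, hβ, hL⟩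
  · rw [hK.eq_of_subset hK' (hKD.trans hDK')]; exact hDK'
  · exact (hL.eq_of_isHomogeneousCurve_subset hβ hK.isHomogeneousCurve hKD).ge

theorem IsLoxodrome.maximal {β : ℝ} (hβ : β ≠ 0) {L : Set S2} (hL : IsLoxodrome β L) :
    Maximal IsHomogeneousCurve L := by
  refine ⟨hL.isHomogeneousCurve hβ, fun D hD hLD => ?_⟩
  rcases hD.classification with ⟨K, hK, hDK⟩ | ⟨β', hβ', hL'⟩
  · exact absurd (hLD.trans hDK) (hK.not_isLoxodrome_subset hβ hL)
  · exact (hL'.eq_of_isHomogeneousCurve_subset hβ' (hL.isHomogeneousCurve hβ) hLD).ge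

theorem logSpiral_zero_subset : ∃ S, IsCirc S ∧ logSpiral 0 ⊆ S := by
  refine ⟨herm 1 0 (-1), isCirc_iff.2 ⟨1, -1, 0, by simp, rfl⟩, ?_⟩
  intro p hp
  obtain ⟨θ, rfl⟩ := mem_logSpiral.1 hp
  have : normSq (spiral 0 θ) = 1 := by
    rw [normSq_eq_norm_sq, norm_spiral, zero_mul, Real.exp_zero, one_pow]
  rw [coe_mem_herm, this]
  simp

/-- The competing bearing may be zero; that spiral is the unit circle, which cannot contain a
loxodrome of nonzero bearing. -/
theorem IsLoxodrome.bearing_unique {β β' : ℝ} (hβ : β ≠ 0) {L : Set S2} (hL : IsLoxodrome β L)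
    (hL' : IsLoxodrome β' L) : β' = β := by
  rcases eq_or_ne β' 0 with rfl | hβ'
  · obtain ⟨A, rfl⟩ := isLoxodrome_iff.1 hL'
    obtain ⟨S, hS, hsub⟩ := logSpiral_zero_subset
    exact absurd (Set.image_mono (mobImage_mono hsub))
      ((isRoundCircle_iff.2 ⟨_, hS.mobImage A, rfl⟩).not_isLoxodrome_subset hβ hL)
  · obtain ⟨A, rfl⟩ := isLoxodrome_iff.1 hL
    obtain ⟨B, hB⟩ := isLoxodrome_iff.1 hL'
    have hAB := fromRiemannSphere_bijective.1.image_injective hB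
    refine (spiral_rigidity (A := B⁻¹ * A) hβ hβ' (θ₀ := 0) (Eventually.of_forall fun θ => ?_)).1
    have h1 : A • (spiral β θ : OnePoint ℂ) ∈ mobImage B (logSpiral β') :=
      hAB ▸ smul_mem_mobImage.2 (mem_logSpiral.2 ⟨θ, rfl⟩)
    rwa [mem_mobImage, ← mul_smul] at h1

theorem exists_isLoxodrome_iff {C : Set S2} :
    ((∃ β : ℝ, IsRightHandedLoxodrome β C) ∨ ∃ β : ℝ, IsLeftHandedLoxodrome β C) ↔
      ∃ β, β ≠ 0 ∧ IsLoxodrome β C := by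
  constructor
  · rintro (⟨β, hβ, h⟩ | ⟨β, hβ, h⟩)
    exacts [⟨β, hβ.ne', h⟩, ⟨β, hβ.ne, h⟩]
  · rintro ⟨β, hβ, h⟩
    exact hβ.lt_or_gt.symm.imp (fun h' => ⟨β, h', h⟩) (fun h' => ⟨β, h', h⟩)

end ConfLox

/-! ### The classification theorem -/

theorem mainTheorem2 :
    (∀ C : Set ConfLox.S2, Maximal ConfLox.IsHomogeneousCurve C ↔
      ConfLox.IsRoundCircle C ∨
      (∃ β : ℝ, ConfLox.IsRightHandedLoxodrome β C) ∨
      (∃ β : ℝ, ConfLox.IsLeftHandedLoxodrome β C)) ∧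
    (∀ C : Set ConfLox.S2, ConfLox.IsSmoothCurve C →
      (ConfLox.IsHomogeneousCurve C ↔
        (∃ K : Set ConfLox.S2, ConfLox.IsRoundCircle K ∧ C ⊆ K) ∨
        (∃ β : ℝ, ConfLox.IsRightHandedLoxodrome β C) ∨
        (∃ β : ℝ, ConfLox.IsLeftHandedLoxodrome β C))) ∧
    (∀ (C : Set ConfLox.S2) (β : ℝ), β ≠ 0 → ConfLox.IsLoxodrome β C →
      ¬ ConfLox.IsRoundCircle C ∧ ∀ β' : ℝ, ConfLox.IsLoxodrome β' C → β' = β) := by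
  refine ⟨fun C => ?_, fun C hC => ?_, fun C β hβ hL => ⟨fun hK => ?_, fun β' hL' => ?_⟩⟩
  · rw [ConfLox.exists_isLoxodrome_iff]
    constructor
    · intro hC
      refine hC.1.classification.imp ?_ id
      rintro ⟨K, hK, hCK⟩
      -- Maximality promotes the inclusion in a circle to equality, as the circle is itself
      -- homogeneous.
      rwa [hCK.antisymm (hC.2 hK.isHomogeneousCurve hCK)]
    · rintro (hK | ⟨β, hβ, hL⟩)
      exacts [hK.maximal, hL.maximal hβ]
  · rw [ConfLox.exists_isLoxodrome_iff]
    refine ⟨fun h => h.classification, ?_⟩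
    rintro (⟨K, hK, hCK⟩ | ⟨β, hβ, hL⟩)
    exacts [ConfLox.isHomogeneousCurve_of_subset_isRoundCircle hC hK hCK, hL.isHomogeneousCurve hβ]
  · exact hK.not_isLoxodrome_subset hβ hL subset_rfl
  · exact hL.bearing_unique hβ hL'
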